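/- **Setting.** Let $q\ge 1$. For a vector $z\in\mathbb R^q$ let $\delta_z$ be Dirac measure at $z$ and $\delta^{\rm s}_z=\frac12(\delta_z+\delta_{-z})$. Let $\mathbb R^{q\times q}_{\rm sym}$ be the space of symmetric matrices, with $\langle A,B\rangle=\mathrm{tr}(A^\top B)$ and the Frobenius norm $\|\cdot\|$. A *functional of scatter* is a map $\Sigma$ from a family $\mathcal Q$ of probability distributions on $\mathbb R^q$ into the symmetric positive definite matrices. A function $J:\mathbb R^q\to\mathbb R^{q\times q}_{\rm sym}$ is called an *influence function* of $\Sigma$ at $Q\in\mathcal Q$ if it is bounded, measurable and even, $\int J\,dQ=0$, and $$\Sigma(R)=\Sigma(Q)+\int J\,dR+o\Bigl(\Bigl\|\int J\,dR\Bigr\|\Bigr)\qquad\text{as } R\to Q \text{ weakly},\ R\in\mathcal Q .$$ Suppose that one of the following holds. (a) $\Sigma$ is linearly equivariant (for $R\in\mathcal Q$ and nonsingular $B$, the law $R^B$ of $BY$, $Y\sim R$, is in $\mathcal Q$ and $\Sigma(R^B)=B\Sigma(R)B^\top$) and differentiable ($\mathcal Q$ is open in the topology of weak convergence, and $\Sigma$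 has an influence function at each $Q\in\mathcal Q$). (b) $\Sigma$ is Tyler's functional: $\mathcal Q$ is the set of all $R$ with $R(\{0\})=0$ and $R(W)<\dim(W)/q$ for all linear subspaces $W$ with $1\le\dim W<q$, and $\Sigma(R)$ is the minimizer of $A\mapsto q\int\log\bigl(y^\top A^{-1}y/y^\top y\bigr)\,R(dy)+\log\det A$ over all positive definite $A$ with $\det A=1$. Let $X_1,X_2,\dots$ be independent random vectors in $\mathbb R^q$ with distribution $P$, let $Q$ be the distribution of $X_1-X_2$, and suppose that $Q\in\mathcal Q$. Put $\hat P_n=n^{-1}\sum_{i=1}^n\delta_{X_i}$, $$\hat Q_n=\binom n2^{-1}\sum_{1\le i<j\le n}\delta^{\rm s}_{X_j-X_i},\qquad \hat Q_{n,d}=(nd)^{-1}\sum_{i=1}^n\sum_{j=i+1}^{i+d}\delta^{\rm s}_{X_j-X_i}\quad(1\le d\le (n-1)/2),$$ where, in sums over the sample of size $n$, $X_{n+s}$ is read as $X_s$ for $1\le s\le n$. **Theorem.** There is an influence function $J$ of $\Sigma$ at $Q$; in case (b) it can be chosen such that in addition $J$ is continuous on $\mathbb R^q\setminus\{0\}$,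 $\mathrm{tr}(\Sigma(Q)^{-1}J(y))=0$ for $y\ne0$, and $J(0)=0$. For any such $J$ let $$H_1(x)=\mathbb E\,J(x-X_1),\qquad H_2(x,y)=J(x-y)-H_1(x)-H_1(y),$$ $$M_{n,d}=(nd)^{-1}\sum_{i=1}^n\sum_{j=i+1}^{i+d}H_2(X_i,X_j),$$ and let $G_1,G_2$ be independent centered Gaussian random matrices in $\mathbb R^{q\times q}_{\rm sym}$ with $\mathbb E\langle A,G_1\rangle^2=\mathbb E\langle A,H_1(X_1)\rangle^2$ and $\mathbb E\langle A,G_2\rangle^2=\mathbb E\langle A,H_2(X_1,X_2)\rangle^2$ for all $A\in\mathbb R^{q\times q}_{\rm sym}$. Then, as $n\to\infty$, the following holds, where $\to_{\mathcal L}$ is convergence in distribution and $o_p(n^{-1/2})$ is a term which, multiplied by $\sqrt n$, tends to $0$ in probability. 1. $\hat Q_n\in\mathcal Q$ with probability tending to one, and $$\Sigma(\hat Q_n)=\Sigma(Q)+2\int H_1\,d\hat P_n+o_p(n^{-1/2}),\qquad \sqrt n\,\bigl(\Sigma(\hat Q_n)-\Sigma(Q)\bigr)\to_{\mathcal L}2G_1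 .$$ 2. If $(n-1)/2\ge d(n)$ for all sufficiently large $n$ and $d(n)\to\infty$, then $\hat Q_{n,d(n)}\in\mathcal Q$ with probability tending to one, and $$\Sigma(\hat Q_{n,d(n)})=\Sigma(Q)+2\int H_1\,d\hat P_n+o_p(n^{-1/2}),\qquad \sqrt n\,\bigl(\Sigma(\hat Q_{n,d(n)})-\Sigma(Q)\bigr)\to_{\mathcal L}2G_1 .$$ 3. For every fixed integer $d\ge1$, $\hat Q_{n,d}\in\mathcal Q$ with probability tending to one, $$\Sigma(\hat Q_{n,d})=\Sigma(\hat Q_n)+M_{n,d}+o_p(n^{-1/2}),$$ $$\Bigl(\sqrt n\int H_1\,d\hat P_n,\ \sqrt{nd}\,M_{n,d}\Bigr)\to_{\mathcal L}(G_1,G_2),$$ $$\sqrt n\,\bigl(\Sigma(\hat Q_{n,d})-\Sigma(Q)\bigr)\to_{\mathcal L}2G_1+d^{-1/2}G_2 .$$ Here $\Sigma(\hat Q_n)$ and $\Sigma(\hat Q_{n,d})$ are set to $0$ on the event where the empirical distribution is not in $\mathcal Q$. -/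

import Mathlib

open MeasureTheory ProbabilityTheory Filter Topology Asymptotics
open scoped ENNReal

attribute [local instance] Matrix.frobeniusNormedAddCommGroup Matrix.frobeniusNormedSpace

namespace SymScatter

/-- Euclidean space of dimension `q`, with its Euclidean norm. -/
abbrev Vec (q : ℕ) : Type := EuclideanSpace ℝ (Fin q)

/-- Real square matrices of size `q`; the norm is the Frobenius norm. -/
abbrev Mat (q : ℕ) : Type := Matrix (Fin q) (Fin q) ℝ

noncomputable section

/-- The topology of the Frobenius norm, which is the usual (entrywise) topology. -/
instance {q : ℕ} : TopologicalSpace (Mat q) :=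
  (Matrix.frobeniusNormedAddCommGroup (m := Fin q) (n := Fin q)
    (α := ℝ)).toPseudoMetricSpace.toUniformSpace.toTopologicalSpace

/-- Matrices carry the Borel sigma-algebra. -/
instance {q : ℕ} : MeasurableSpace (Mat q) := borel _

instance {q : ℕ} : BorelSpace (Mat q) := ⟨rfl⟩

instance {q : ℕ} : SecondCountableTopology (Mat q) :=
  inferInstanceAs (SecondCountableTopology (Fin q → Fin q → ℝ))

/-! ### Distributions derived from the data -/

/-- The symmetrized distribution `Q(P)`, the law of `X₁ - X₂` for independent `X₁, X₂ ∼ P`. -/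
def symmetrized {q : ℕ} (P : ProbabilityMeasure (Vec q)) : ProbabilityMeasure (Vec q) :=
  (P.prod P).map (f := fun p : Vec q × Vec q => p.1 - p.2)
    (measurable_fst.sub measurable_snd).aemeasurable

/-- The symmetrized Dirac measure `(δ_z + δ_{-z}) / 2`. -/
def symDirac {q : ℕ} (z : Vec q) : Measure (Vec q) :=
  (2 : ℝ≥0∞)⁻¹ • (Measure.dirac z + Measure.dirac (-z))

/-- The empirical distribution of `x 0, …, x (n - 1)`. -/
def empirical {q : ℕ} (n : ℕ) (x : ℕ → Vec q) : Measure (Vec q) :=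
  (n : ℝ≥0∞)⁻¹ • ∑ i ∈ Finset.range n, Measure.dirac (x i)

/-- The empirical distribution of all differences of two different observations among
`x 0, …, x (n - 1)`. It is a probability measure for `n ≥ 2`. -/
def empiricalDiff {q : ℕ} (n : ℕ) (x : ℕ → Vec q) : Measure (Vec q) :=
  ((n.choose 2 : ℕ) : ℝ≥0∞)⁻¹ •
    ∑ j ∈ Finset.range n, ∑ i ∈ Finset.range j, symDirac (x j - x i)

/-- The balanced incomplete version using only the `n * d` differences `x (i + k) - x i`,
`i < n`, `1 ≤ k ≤ d`, where indices are read cyclically modulo `n`. -/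
def empiricalDiffInc {q : ℕ} (n d : ℕ) (x : ℕ → Vec q) : Measure (Vec q) :=
  ((n * d : ℕ) : ℝ≥0∞)⁻¹ •
    ∑ i ∈ Finset.range n, ∑ k ∈ Finset.Icc 1 d, symDirac (x ((i + k) % n) - x i)

/-! ### Functionals of scatter -/

/-- A functional of scatter: a family `domain` of probability distributions and a map which
assigns to each member of the family a symmetric positive definite matrix. The values of `toFun`
outside of `domain` are irrelevant. -/
structure ScatterFunctional (q : ℕ) where
  domain : Set (ProbabilityMeasure (Vec q))
  toFun : ProbabilityMeasure (Vec q) → Mat q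
  posDef : ∀ R ∈ domain, (toFun R).PosDef

/-- The measure `m` is a probability distribution in the domain of `S`. -/
def ScatterFunctional.IsDefinedAt {q : ℕ} (S : ScatterFunctional q) (m : Measure (Vec q)) : Prop :=
  ∃ h : IsProbabilityMeasure m, (⟨m, h⟩ : ProbabilityMeasure (Vec q)) ∈ S.domain

open Classical in
/-- The scatter matrix of the measure `m`, with value `0` if it is not defined. -/
def ScatterFunctional.eval {q : ℕ} (S : ScatterFunctional q) (m : Measure (Vec q)) : Mat q :=
  if h : S.IsDefinedAt m then S.toFun ⟨m, h.1⟩ else 0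

/-- The law of `B Y` for `Y ∼ R`. -/
def linearImage {q : ℕ} (B : Mat q) (R : ProbabilityMeasure (Vec q)) :
    ProbabilityMeasure (Vec q) :=
  R.map (f := fun y => Matrix.toEuclideanCLM (n := Fin q) (𝕜 := ℝ) B y)
    (Matrix.toEuclideanCLM (n := Fin q) (𝕜 := ℝ) B).continuous.measurable.aemeasurable

/-- Linear equivariance. -/
def ScatterFunctional.IsLinearEquivariant {q : ℕ} (S : ScatterFunctional q) : Prop :=
  ∀ B : Mat q, B.det ≠ 0 → ∀ R ∈ S.domain,
    linearImage B R ∈ S.domain ∧ S.toFun (linearImage B R) = B * S.toFun R * B.transpose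

/-- `J` is an influence function of `S` at the distribution `Q`: a bounded, measurable, even
function with values in the symmetric matrices and `∫ J dQ = 0`, such that
`S(R) = S(Q) + ∫ J dR + o(‖∫ J dR‖)` as `R → Q` weakly within the domain of `S`. -/
structure ScatterFunctional.IsInfluenceFunction {q : ℕ} (S : ScatterFunctional q)
    (Q : ProbabilityMeasure (Vec q)) (J : Vec q → Mat q) : Prop where
  measurable : Measurable J
  bounded : ∃ C : ℝ, ∀ y, ‖J y‖ ≤ C
  even : ∀ y, J (-y) = J y
  symm : ∀ y, (J y).IsSymm
  integral_eq_zero : ∫ y, J y ∂(Q : Measure (Vec q)) = 0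
  expansion :
    (fun R : ProbabilityMeasure (Vec q) =>
        S.toFun R - S.toFun Q - ∫ y, J y ∂(R : Measure (Vec q)))
      =o[𝓝[S.domain] Q]
    (fun R : ProbabilityMeasure (Vec q) => ∫ y, J y ∂(R : Measure (Vec q)))

/-- Differentiability: the domain is open in the topology of weak convergence, and there is an
influence function at each of its members. -/
def ScatterFunctional.IsDifferentiable {q : ℕ} (S : ScatterFunctional q) : Prop :=
  IsOpen S.domain ∧ ∀ Q ∈ S.domain, ∃ J : Vec q → Mat q, S.IsInfluenceFunction Q J

/-! ### Tyler's functional -/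

/-- The quadratic form `yᵀ A y`. -/
def quadForm {q : ℕ} (A : Mat q) (y : Vec q) : ℝ :=
  (y : Fin q → ℝ) ⬝ᵥ A.mulVec (y : Fin q → ℝ)

/-- Tyler's criterion `q ∫ log (yᵀ A⁻¹ y / yᵀ y) R(dy) + log det A`. -/
def tylerCriterion {q : ℕ} (A : Mat q) (R : ProbabilityMeasure (Vec q)) : ℝ :=
  q * ∫ y, Real.log (quadForm A⁻¹ y / quadForm 1 y) ∂(R : Measure (Vec q)) + Real.log A.det

/-- `A` minimizes Tyler's criterion over the positive definite matrices with determinant one. -/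
def IsTylerMinimizer {q : ℕ} (R : ProbabilityMeasure (Vec q)) (A : Mat q) : Prop :=
  (A.PosDef ∧ A.det = 1) ∧
    ∀ B : Mat q, B.PosDef → B.det = 1 → tylerCriterion A R ≤ tylerCriterion B R

/-- The distributions `R` with `R {0} = 0` and `R W < dim W / q` for all linear subspaces `W`
with `1 ≤ dim W < q`. For these, Tyler's criterion has a unique minimizer. -/
def tylerDomain (q : ℕ) : Set (ProbabilityMeasure (Vec q)) :=
  {R | (R : Measure (Vec q)) {0} = 0 ∧
    ∀ W : Submodule ℝ (Vec q), 1 ≤ Module.finrank ℝ W → Module.finrank ℝ W < q →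
      (R : Measure (Vec q)).real (W : Set (Vec q)) < (Module.finrank ℝ W : ℝ) / q}

open Classical in
/-- Tyler's scatter matrix, the minimizer of Tyler's criterion. (The default value is irrelevant:
on `tylerDomain q` a minimizer exists.) -/
def tylerMatrix {q : ℕ} (R : ProbabilityMeasure (Vec q)) : Mat q :=
  if h : ∃ A : Mat q, IsTylerMinimizer R A then h.choose else 1

/-- Tyler's functional of scatter. -/
def tyler (q : ℕ) : ScatterFunctional q where
  domain := tylerDomain q
  toFun := tylerMatrix
  posDef := by
    intro R _
    unfold tylerMatrix
    split_ifs with h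
    · exact h.choose_spec.1.1
    · exact Matrix.PosDef.one

/-- The additional properties of the influence function of Tyler's functional at `Q`, which is
a continuous function on the complement of `0` with `tr (Σ₀(Q)⁻¹ J) ≡ 0`, extended
by `J(0) := 0`. -/
structure IsTylerNormalized {q : ℕ} (Q : ProbabilityMeasure (Vec q)) (J : Vec q → Mat q) :
    Prop where
  map_zero : J 0 = 0
  continuousOn : ContinuousOn J {0}ᶜ
  trace_eq_zero : ∀ y, y ≠ 0 → (((tyler q).toFun Q)⁻¹ * J y).trace = 0

/-! ### The kernels of the linear expansion -/

/-- `H₁(x) = E J(x - X₁)`. -/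
def H₁ {q : ℕ} (P : ProbabilityMeasure (Vec q)) (J : Vec q → Mat q) (x : Vec q) : Mat q :=
  ∫ z, J (x - z) ∂(P : Measure (Vec q))

/-- `H₂(x, y) = J(x - y) - H₁(x) - H₁(y)`. -/
def H₂ {q : ℕ} (P : ProbabilityMeasure (Vec q)) (J : Vec q → Mat q) (x y : Vec q) : Mat q :=
  J (x - y) - H₁ P J x - H₁ P J y

/-- `M_{n,d} = (n d)⁻¹ ∑_i ∑_{j = i+1}^{i+d} H₂(x i, x j)`, indices modulo `n`. -/
def M {q : ℕ} (P : ProbabilityMeasure (Vec q)) (J : Vec q → Mat q) (n d : ℕ) (x : ℕ → Vec q) :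
    Mat q :=
  ((n * d : ℕ) : ℝ)⁻¹ •
    ∑ i ∈ Finset.range n, ∑ k ∈ Finset.Icc 1 d, H₂ P J (x i) (x ((i + k) % n))

/-- The Frobenius inner product `tr (Aᵀ B)`. -/
def frob {q : ℕ} (A B : Mat q) : ℝ := (A.transpose * B).trace

/-- `G` is a centered Gaussian random symmetric matrix with
`E ⟨A, G⟩² = v A` for all symmetric `A`. -/
structure IsCenteredGaussian {q : ℕ} {Ω : Type*} [MeasurableSpace Ω] (μ : Measure Ω)
    (G : Ω → Mat q) (v : Mat q → ℝ) : Prop where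
  gaussian : HasGaussianLaw G μ
  symm : ∀ᵐ ω ∂μ, (G ω).IsSymm
  mean : ∫ ω, G ω ∂μ = 0
  second_moment : ∀ A : Mat q, A.IsSymm → ∫ ω, (frob A (G ω)) ^ 2 ∂μ = v A

/-- `Z n = o_p(n^{-1/2})`. -/
def IsLittleOpInvSqrt {q : ℕ} {Ω : Type*} [MeasurableSpace Ω] (μ : Measure Ω)
    (Z : ℕ → Ω → Mat q) : Prop :=
  TendstoInMeasure μ (fun (n : ℕ) ω => √(n : ℝ) • Z n ω) atTop (fun _ => 0)

end

end SymScatter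

open SymScatter

/-! ### Convergence in probability as convergence along a filter. -/

section InProbability

variable {Ω : Type*} [MeasurableSpace Ω]

/-! The argument separates a statistical part, valid for any functional with influence functions,
from an analytic part about Tyler's functional.

Statistical part. Let R̂ be the empirical distribution of the symmetrized differences over a
collection of pairs. It converges weakly to Q in probability (`tendsto_toProb_pairEmpirical`), and ∫
J dR̂ is O_p(n^{-1/2}) by a second moment bound, so the defining expansion of J gives Σ(R̂) = Σ(Q) +
∫ J dR̂ + o_p(n^{-1/2}) (`tendsto_sqrt_smul_eval_sub`). The Hoeffding decomposition J(x - y) = H₁(x)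
+ H₁(y) + H₂(x, y) then splits ∫ J dR̂. If every observation occurs in equally many pairs
(`IsBalancedDesign`), the linear part is exactly 2 ∫ H₁ dP̂ₙ. The H₂ terms of different pairs are
uncorrelated, so their mean has variance of order one over the number of pairs. It is negligible
when there are many more than n pairs, and for fixed d it is the term M_{n,d}.

Central limit theorem. For fixed d, up to boundary terms from the cyclic indexing, every linear
combination of the two parts is a moving sum of a function φ of d + 1 consecutive observations which
integrates to zero over the first one: a reverse martingale difference sequence. McLeish's method
applies. The product of the factors 1 + iφ/√n has expectation exactly one
(`integral_prod_windowFun`), and it is close to exp(iS + V/2), where S is the normalized sum and the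
mean square V satisfies a law of large numbers. Orthogonality of H₁ and H₂ makes the limits of the
two parts independent, and the Cramér–Wold device gives the joint statement
(`tendstoInDistribution_linear_quadratic`).

Tyler's functional. The criterion is coercive with constants that depend only on the masses of cones
around subspaces (`le_integral_tylerLog`). By compactness of the set of orthonormal frames these
masses are controlled uniformly near Q (`eventually_measureReal_coneAround_le`), so minimizers exist
and stay in one compact set. They solve an estimating equation. Uniqueness of its solution and
injectivity of its linearization both follow from `eq_smul_of_ae_orthogonal`: otherwise R would live
on the union of two subspaces of complementary dimensions, which the domain forbids. Compactness and
uniqueness give continuity; the exact identity `tylerScore_sub` then gives the first order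
expansion, and the inverse of the linearization applied to the centered score is the influence
function. The domain need not be open, since nearby distributions may have an atom at zero; but if Q
has none, then almost surely the empirical distributions have none. -/

/-- The filter on `ℕ × Ω` of those events, indexed by `n`, whose probability tends to one.
Convergence in probability is convergence along this filter. -/
def probFilter (μ : Measure Ω) : Filter (ℕ × Ω) where
  sets := {A | Tendsto (fun n => μ {ω | (n, ω) ∉ A}) atTop (𝓝 0)}
  univ_sets := by simp
  sets_of_superset {A B} hA hAB := tendsto_of_tendsto_of_tendsto_of_le_of_le tendsto_const_nhds hA
    (fun _ => zero_le) (fun n => measure_mono fun ω hω h => hω (hAB h))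
  inter_sets {A B} hA hB := by
    have h := Tendsto.add (show Tendsto _ _ _ from hA) (show Tendsto _ _ _ from hB)
    rw [add_zero] at h
    refine tendsto_of_tendsto_of_tendsto_of_le_of_le tendsto_const_nhds h
      (fun _ => zero_le) (fun n => ?_)
    refine le_trans (measure_mono ?_) (measure_union_le _ _)
    intro ω hω
    by_contra hc
    simp only [Set.mem_union, Set.mem_ofPred_eq, not_or, not_not] at hc
    exact hω hc

variable {μ : Measure Ω}

lemma eventually_probFilter {p : ℕ × Ω → Prop} :
    (∀ᶠ x in probFilter μ, p x) ↔ Tendsto (fun n => μ {ω | ¬ p (n, ω)}) atTop (𝓝 0) := Iff.rfl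

lemma eventually_probFilter_of_ae {p : ℕ × Ω → Prop} (h : ∀ᶠ n in atTop, ∀ᵐ ω ∂μ, p (n, ω)) :
    ∀ᶠ x in probFilter μ, p x := by
  rw [eventually_probFilter]
  refine tendsto_const_nhds.congr' ?_
  filter_upwards [h] with n hn
  exact (ae_iff.1 hn).symm

lemma eventually_probFilter_of_eventually {p : ℕ → Prop} (h : ∀ᶠ n in atTop, p n) :
    ∀ᶠ x in probFilter μ, p x.1 :=
  eventually_probFilter_of_ae (h.mono fun _ hn => ae_of_all _ fun _ => hn)

/-- This is what makes the filter useful: a deterministic expansion along a neighbourhood filter can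
be composed with a limit in probability. -/
lemma tendstoInMeasure_iff_probFilter {E : Type*} [PseudoEMetricSpace E] {Z : ℕ → Ω → E} {c : E} :
    TendstoInMeasure μ Z atTop (fun _ => c) ↔
      Tendsto (fun x : ℕ × Ω => Z x.1 x.2) (probFilter μ) (𝓝 c) := by
  rw [EMetric.tendsto_nhds, TendstoInMeasure]
  refine forall₂_congr fun ε _ => ?_
  rw [eventually_probFilter]
  simp only [not_lt]

lemma tendsto_measure_of_eventually_probFilter [IsProbabilityMeasure μ] {p : ℕ → Ω → Prop}
    (h : ∀ᶠ x in probFilter μ, p x.1 x.2) :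
    Tendsto (fun n => μ {ω | p n ω}) atTop (𝓝 1) := by
  rw [eventually_probFilter] at h
  have h1 : Tendsto (fun n => 1 - μ {ω | ¬ p n ω}) atTop (𝓝 (1 - 0)) :=
    ENNReal.Tendsto.sub tendsto_const_nhds h (by simp)
  rw [tsub_zero] at h1
  refine tendsto_of_tendsto_of_tendsto_of_le_of_le h1 tendsto_const_nhds (fun n => ?_)
    (fun n => prob_le_one)
  rw [tsub_le_iff_right, ← measure_univ (μ := μ)]
  refine le_trans (measure_mono ?_) (measure_union_le _ _)
  intro ω _
  exact em _

/-- Chebyshev's inequality with an explicit constant, used both for convergence to zero and for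
boundedness in probability. -/
lemma measure_norm_ge_le_of_integral_sq_le {Z : Ω → ℝ} [IsFiniteMeasure μ]
    (hZ : Integrable (fun ω => Z ω ^ 2) μ) {c K : ℝ} (hc : ∫ ω, Z ω ^ 2 ∂μ ≤ c) (hK : 0 < K) :
    μ {ω | K ≤ ‖Z ω‖} ≤ ENNReal.ofReal (c / K ^ 2) := by
  have h := mul_meas_ge_le_integral_of_nonneg (μ := μ) (ae_of_all _ fun ω => sq_nonneg (Z ω)) hZ
    (K ^ 2)
  have hs : {ω | K ≤ ‖Z ω‖} = {ω | K ^ 2 ≤ Z ω ^ 2} := by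
    ext ω
    simp only [Set.mem_ofPred_eq, Real.norm_eq_abs]
    rw [← sq_abs (Z ω), pow_le_pow_iff_left₀ hK.le (abs_nonneg _) two_ne_zero]
  rw [hs, ← ofReal_measureReal (measure_ne_top _ _)]
  apply ENNReal.ofReal_le_ofReal
  rw [le_div_iff₀ (by positivity), mul_comm]
  exact h.trans hc

lemma tendsto_probFilter_of_integral_sq {Z : ℕ → Ω → ℝ} [IsFiniteMeasure μ] {c : ℕ → ℝ}
    (hZ : ∀ᶠ n in atTop, Integrable (fun ω => Z n ω ^ 2) μ)
    (hc : ∀ᶠ n in atTop, ∫ ω, Z n ω ^ 2 ∂μ ≤ c n) (h0 : Tendsto c atTop (𝓝 0)) :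
    Tendsto (fun x : ℕ × Ω => Z x.1 x.2) (probFilter μ) (𝓝 0) := by
  rw [Metric.tendsto_nhds]
  intro ε hε
  rw [eventually_probFilter]
  have h1 : Tendsto (fun n => ENNReal.ofReal (c n / ε ^ 2)) atTop (𝓝 0) := by
    have := ENNReal.tendsto_ofReal (h0.div_const (ε ^ 2))
    simpa using this
  refine tendsto_of_tendsto_of_tendsto_of_le_of_le' tendsto_const_nhds h1
    (Eventually.of_forall fun _ => zero_le) ?_
  filter_upwards [hZ, hc] with n h2 h3
  simpa [dist_zero_right] using measure_norm_ge_le_of_integral_sq_le h2 h3 hε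

/-- If `R` is of smaller order than `I` in probability and `b n • I n` is bounded in probability
then `b n • R n` tends to zero in probability. -/
lemma tendsto_smul_of_isLittleO_probFilter {E : Type*} [NormedAddCommGroup E] [NormedSpace ℝ E]
    {R I : ℕ → Ω → E} {b : ℕ → ℝ}
    (hR : (fun x : ℕ × Ω => R x.1 x.2) =o[probFilter μ] (fun x : ℕ × Ω => I x.1 x.2))
    {C : ℝ} (hI : ∀ K : ℝ, 0 < K → ∀ᶠ n in atTop,
      μ {ω | K ≤ ‖b n • I n ω‖} ≤ ENNReal.ofReal (C / K ^ 2)) :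
    Tendsto (fun x : ℕ × Ω => b x.1 • R x.1 x.2) (probFilter μ) (𝓝 0) := by
  rw [Metric.tendsto_nhds]
  intro ε hε
  rw [eventually_probFilter, ENNReal.tendsto_nhds_zero]
  intro η hη
  -- Half of η pays for the event that the scaled I exceeds K, the other half for the failure of the
  -- little-o bound with constant ε / K.
  obtain ⟨K, hK, hKη⟩ : ∃ K : ℝ, 0 < K ∧ ENNReal.ofReal (C / K ^ 2) ≤ η / 2 := by
    have h1 : Tendsto (fun K : ℝ => ENNReal.ofReal (C / K ^ 2)) atTop (𝓝 0) := by
      have := ENNReal.tendsto_ofReal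
        (tendsto_const_nhds.div_atTop (a := C) (tendsto_pow_atTop (α := ℝ) two_ne_zero))
      simpa using this
    have h2 : ∀ᶠ K : ℝ in atTop, ENNReal.ofReal (C / K ^ 2) ≤ η / 2 :=
      h1.eventually (Iic_mem_nhds (ENNReal.half_pos hη.ne'))
    obtain ⟨K, h2, h3⟩ := (h2.and (eventually_gt_atTop 0)).exists
    exact ⟨K, h3, h2⟩
  have hev := (isLittleO_iff.1 hR) (div_pos hε hK)
  rw [eventually_probFilter, ENNReal.tendsto_nhds_zero] at hev
  filter_upwards [hev (η / 2) (by simpa using hη.ne'), hI K hK] with n h1 h2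
  calc _ ≤ μ ({ω | ¬ ‖R n ω‖ ≤ ε / K * ‖I n ω‖} ∪ {ω | K ≤ ‖b n • I n ω‖}) := by
        refine measure_mono fun ω hω => ?_
        by_contra hc
        simp only [Set.mem_union, Set.mem_ofPred_eq, not_or, not_le] at hc
        apply hω
        simp only [dist_zero_right, norm_smul] at hc ⊢
        calc ‖b n‖ * ‖R n ω‖ ≤ ‖b n‖ * (ε / K * ‖I n ω‖) := by gcongr; exact not_lt.1 hc.1
          _ = ε / K * (‖b n‖ * ‖I n ω‖) := by ring
          _ < ε / K * K := by gcongr; exact hc.2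
          _ = ε := by field_simp
    _ ≤ η / 2 + η / 2 := (measure_union_le _ _).trans (add_le_add h1 (h2.trans hKη))
    _ = η := ENNReal.add_halves η

end InProbability

/-! ### Reduction of joint convergence to one-dimensional characteristic functions. -/

section CramerWold

/-- Cramér–Wold device in terms of characteristic functions. -/
lemma tendstoInDistribution_of_forall_dual {E : Type*} [NormedAddCommGroup E] [NormedSpace ℝ E]
    [FiniteDimensional ℝ E] [MeasurableSpace E] [BorelSpace E]
    {Ω Ω' : Type*} [MeasurableSpace Ω] [MeasurableSpace Ω'] {μ : Measure Ω} {μ' : Measure Ω'}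
    [IsProbabilityMeasure μ] [IsProbabilityMeasure μ'] {Z : ℕ → Ω → E} {G : Ω' → E}
    (hZ : ∀ n, AEMeasurable (Z n) μ) (hG : AEMeasurable G μ')
    (h : ∀ L : StrongDual ℝ E,
      Tendsto (fun n => ∫ ω, Complex.exp (L (Z n ω) * Complex.I) ∂μ) atTop
        (𝓝 (∫ ω, Complex.exp (L (G ω) * Complex.I) ∂μ'))) :
    TendstoInDistribution Z atTop G (fun _ => μ) μ' := by
  -- The continuity theorem for characteristic functions is applied in Euclidean space, where
  -- functionals are inner products; the result is carried back by the inverse isomorphism.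
  let e := toEuclidean (E := E)
  have he : Measurable e := e.continuous.measurable
  have key : TendstoInDistribution (fun n ω => e (Z n ω)) atTop (fun ω => e (G ω))
      (fun _ => μ) μ' := by
    refine ⟨fun n => he.comp_aemeasurable (hZ n), he.comp_aemeasurable hG, ?_⟩
    refine ProbabilityMeasure.tendsto_iff_tendsto_charFun.2 fun t => ?_
    simp only [ProbabilityMeasure.coe_mk, charFun_apply]
    have h1 := h ((innerSL ℝ t).comp (e : E →L[ℝ] _))
    convert! h1 using 2
    · rename_i n
      rw [integral_map (φ := fun ω => e (Z n ω)) (he.comp_aemeasurable (hZ n)) (by fun_prop)]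
      simp [real_inner_comm]
    · rw [integral_map (φ := fun ω => e (G ω)) (he.comp_aemeasurable hG) (by fun_prop)]
      simp [real_inner_comm]
  have h2 := key.continuous_comp (g := e.symm) e.symm.continuous
  simpa [Function.comp_def] using h2

end CramerWold

/-! ### Measurability of the estimators. -/

section Evaluation

variable {q : ℕ}

lemma norm_integral_probabilityMeasure_le {J : Vec q → Mat q} {C : ℝ} (hC : ∀ y, ‖J y‖ ≤ C)
    (R : ProbabilityMeasure (Vec q)) : ‖∫ y, J y ∂(R : Measure (Vec q))‖ ≤ C := by
  simpa using norm_integral_le_of_norm_le_const (μ := (R : Measure (Vec q))) (ae_of_all _ hC)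

open Classical in
/-- The composition of a scatter functional having influence functions with a continuous family of
distributions is measurable. -/
lemma measurable_toFun_comp {E : Type*} [TopologicalSpace E] [SecondCountableTopology E]
    [MeasurableSpace E] [BorelSpace E] {S : ScatterFunctional q} (hG : IsGδ S.domain)
    (hJ : ∀ Q ∈ S.domain, ∃ J, S.IsInfluenceFunction Q J)
    {T : E → ProbabilityMeasure (Vec q)} (hT : Continuous T)
    (hTJ : ∀ J : Vec q → Mat q, Measurable J →
      Measurable fun x => ∫ y, J y ∂(T x : Measure (Vec q))) :
    Measurable fun x => if T x ∈ S.domain then S.toFun (T x) else 0 := by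
  set f : E → Mat q := fun x => if T x ∈ S.domain then S.toFun (T x) else 0 with hf
  have hD : MeasurableSet (T ⁻¹' S.domain) := (hG.preimage hT).measurableSet
  -- Influence functions make the functional locally ε-close to the measurable function S(T x) + ∫ J
  -- dT(z) of z. Gluing countably many of these gives a uniform measurable approximation, and ε → 0
  -- finishes.
  have key : ∀ ε : ℝ, 0 < ε → ∃ g : E → Mat q, Measurable g ∧ ∀ x, ‖f x - g x‖ ≤ ε := by
    intro ε hε
    have h1 : ∀ x ∈ T ⁻¹' S.domain, ∃ (V : Set E) (g : E → Mat q), IsOpen V ∧ x ∈ V ∧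
        Measurable g ∧ ∀ z ∈ V ∩ T ⁻¹' S.domain, ‖f z - g z‖ ≤ ε := by
      intro x hx
      obtain ⟨J, hJ⟩ := hJ _ hx
      obtain ⟨C, hC⟩ := hJ.bounded
      have hC0 : 0 ≤ C := (norm_nonneg _).trans (hC 0)
      -- Since ‖∫ J‖ ≤ C, a relative error of ε / (C + 1) is an absolute error of at most ε; the
      -- summand 1 covers C = 0.
      have h2 := (isLittleO_iff.1 hJ.expansion) (show 0 < ε / (C + 1) by positivity)
      rw [eventually_nhdsWithin_iff, eventually_nhds_iff] at h2
      obtain ⟨U, hU, hUo, hxU⟩ := h2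
      refine ⟨T ⁻¹' U, fun z => S.toFun (T x) + ∫ y, J y ∂(T z : Measure (Vec q)),
        hUo.preimage hT, hxU, measurable_const.add (hTJ J hJ.measurable), ?_⟩
      rintro z ⟨hz, hzD⟩
      rw [hf]
      simp only [if_pos (show T z ∈ S.domain from hzD)]
      rw [← sub_sub]
      refine (hU _ hz hzD).trans ?_
      calc _ ≤ ε / (C + 1) * C := by
            gcongr
            exact norm_integral_probabilityMeasure_le hC _
        _ ≤ ε := by
            rw [div_mul_eq_mul_div, div_le_iff₀ (by positivity)]
            nlinarith
    choose! V g hV hxV hg hgV using h1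
    -- Lindelöf property: countably many of the neighbourhoods cover the preimage of the domain.
    obtain ⟨s, hsD, hs, hsV⟩ := TopologicalSpace.countable_cover_nhdsWithin
      (s := T ⁻¹' S.domain) (f := V) fun x hx =>
        mem_nhdsWithin_of_mem_nhds ((hV x hx).mem_nhds (hxV x hx))
    rcases s.eq_empty_or_nonempty with h0 | h0
    · refine ⟨0, measurable_const, fun x => ?_⟩
      have : T x ∉ S.domain := fun hx => by
        have := hsV (show x ∈ T ⁻¹' S.domain from hx)
        simp [h0] at this
      simp [hf, this, hε.le]
    obtain ⟨c, rfl⟩ := hs.exists_eq_range h0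
    have hcD : ∀ n, c n ∈ T ⁻¹' S.domain := fun n => hsD ⟨n, rfl⟩
    -- Adding the complement of the domain, where the indicators and the function vanish, makes
    -- these sets cover everything.
    let t : ℕ → Set E := fun n => V (c n) ∪ (T ⁻¹' S.domain)ᶜ
    have ht : ∀ n, MeasurableSet (t n) := fun n => ((hV _ (hcD n)).measurableSet).union hD.compl
    obtain ⟨G, hGm, hGt⟩ := exists_measurable_piecewise (disjointed t)
      (fun n => MeasurableSet.disjointed ht n)
      (fun n => (T ⁻¹' S.domain).indicator (g (c n)))
      (fun n => (hg _ (hcD n)).indicator hD) (fun i j hij x hx => by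
        exact absurd hx (by
          have := disjoint_disjointed t hij
          exact fun h => Set.disjoint_left.1 this h.1 h.2))
    refine ⟨G, hGm, fun x => ?_⟩
    have hx : x ∈ ⋃ n, disjointed t n := by
      rw [iUnion_disjointed]
      by_cases hxD : x ∈ T ⁻¹' S.domain
      · have := hsV hxD
        simp only [Set.mem_range, Set.iUnion_exists, Set.iUnion_iUnion_eq', Set.mem_iUnion] at this
        obtain ⟨n, hn⟩ := this
        exact Set.mem_iUnion.2 ⟨n, Or.inl hn⟩
      · exact Set.mem_iUnion.2 ⟨0, Or.inr hxD⟩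
    obtain ⟨n, hn⟩ := Set.mem_iUnion.1 hx
    rw [hGt n hn]
    by_cases hxD : x ∈ T ⁻¹' S.domain
    · rw [Set.indicator_of_mem hxD]
      rcases disjointed_subset t n hn with h | h
      · exact hgV _ (hcD n) _ ⟨h, hxD⟩
      · exact absurd hxD h
    · rw [Set.indicator_of_notMem hxD]
      simp [hf, show T x ∉ S.domain from hxD, hε.le]
  choose! g hg hgf using key
  refine measurable_of_tendsto_metrizable (f := fun n : ℕ => g (1 / ((n : ℝ) + 1)))
    (fun n => hg _ (by positivity)) ?_
  rw [tendsto_pi_nhds]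
  intro x
  rw [tendsto_iff_norm_sub_tendsto_zero]
  refine squeeze_zero (fun _ => norm_nonneg _) (fun n => ?_)
    (tendsto_one_div_add_atTop_nhds_zero_nat (𝕜 := ℝ))
  rw [norm_sub_rev]
  exact hgf _ (by positivity) x

end Evaluation

/-! ### Integrating out one coordinate of an i.i.d. sequence. -/

section Resampling

variable {E : Type*} [MeasurableSpace E] {P : Measure E} [IsProbabilityMeasure P]

lemma measurable_update_pair (a : ℕ) :
    Measurable fun p : (ℕ → E) × E => Function.update p.1 a p.2 := by
  rw [measurable_pi_iff]
  intro i
  by_cases h : i = a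
  · subst h; simpa using measurable_snd
  · simpa [Function.update_of_ne h, Function.comp_def] using (measurable_pi_apply i).comp (measurable_fst (α := ℕ → E) (β := E))

/-- Replacing one coordinate of an i.i.d. sequence by an independent copy does not change its
law. -/
lemma map_update_infinitePi (a : ℕ) :
    ((Measure.infinitePi fun _ : ℕ => P).prod P).map
      (fun p : (ℕ → E) × E => Function.update p.1 a p.2) = Measure.infinitePi fun _ : ℕ => P := by
  refine Measure.eq_infinitePi _ fun s t ht => ?_
  rw [Measure.map_apply (measurable_update_pair a) (MeasurableSet.pi s.countable_toSet fun i _ => ht i)]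
  have hset : (fun p : (ℕ → E) × E => Function.update p.1 a p.2) ⁻¹' (Set.pi s t)
      = (Set.pi (s.erase a : Finset ℕ) t) ×ˢ (if a ∈ s then t a else Set.univ) := by
    ext ⟨x, v⟩
    simp only [Set.mem_preimage, Set.mem_pi, Set.mem_prod, Finset.mem_coe, Finset.mem_erase]
    constructor
    · intro h
      refine ⟨fun i hi => by simpa [Function.update_of_ne hi.1] using h i hi.2, ?_⟩
      split_ifs with has
      · simpa using h a has
      · trivial
    · rintro ⟨h1, h2⟩ i hi
      by_cases hia : i = a
      · subst hia; simpa [hi] using h2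
      · simpa [Function.update_of_ne hia] using h1 i ⟨hia, hi⟩
  rw [hset, Measure.prod_prod, Measure.infinitePi_pi _ (fun i _ => ht i)]
  split_ifs with has
  · rw [mul_comm, Finset.mul_prod_erase s (fun i => P (t i)) has]
  · rw [Finset.erase_eq_of_notMem has]; simp

/-- Resampling plus Fubini replaces conditioning on all coordinates except `a`: if the conditional
mean vanishes pointwise, so does the mean. All orthogonality relations for h₁, h₂ and window
functions are obtained in this way. -/
lemma integral_infinitePi_eq_zero_of_update {𝕜 : Type*} [RCLike 𝕜] {F : (ℕ → E) → 𝕜}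
    (hF : Measurable F) {K : ℝ} (hK : ∀ x, ‖F x‖ ≤ K) (a : ℕ)
    (h : ∀ x, ∫ v, F (Function.update x a v) ∂P = 0) :
    ∫ x, F x ∂(Measure.infinitePi fun _ : ℕ => P) = 0 := by
  have hm := measurable_update_pair (E := E) a
  rw [← map_update_infinitePi a, integral_map hm.aemeasurable hF.aestronglyMeasurable,
    integral_prod (fun p : (ℕ → E) × E => F (Function.update p.1 a p.2)) (Integrable.of_bound
      (hF.comp hm).aestronglyMeasurable K (ae_of_all _ fun _ => hK _))]
  simp [h]

end Resampling

/-! ### Second moments of sums of weakly correlated terms. -/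

section SecondMoment

variable {Ω : Type*} [MeasurableSpace Ω] {ν : Measure Ω} [IsProbabilityMeasure ν]

/-- The second moment of a sum of bounded variables, each of which is correlated with at most `m`
of them. -/
lemma integral_sum_sq_le {ι : Type*} (s : Finset ι) {f : ι → Ω → ℝ} {K : ℝ} {m : ℕ}
    (hf : ∀ i ∈ s, Measurable (f i)) (hK : ∀ i ∈ s, ∀ x, |f i x| ≤ K)
    (r : ι → ι → Prop) [∀ i j, Decidable (r i j)]
    (h : ∀ i ∈ s, ∀ j ∈ s, ¬ r i j → ∫ x, f i x * f j x ∂ν = 0)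
    (hm : ∀ i ∈ s, (s.filter (r i)).card ≤ m) :
    ∫ x, (∑ i ∈ s, f i x) ^ 2 ∂ν ≤ s.card * m * K ^ 2 := by
  have hb : ∀ i ∈ s, ∀ j ∈ s, ∀ x, ‖f i x * f j x‖ ≤ K ^ 2 := by
    intro i hi j hj x
    rw [Real.norm_eq_abs, abs_mul, sq]
    exact mul_le_mul (hK i hi x) (hK j hj x) (abs_nonneg _) ((abs_nonneg _).trans (hK i hi x))
  have hint : ∀ i ∈ s, ∀ j ∈ s, Integrable (fun x => f i x * f j x) ν := fun i hi j hj =>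
    Integrable.of_bound ((hf i hi).mul (hf j hj)).aestronglyMeasurable (K ^ 2)
      (ae_of_all _ (hb i hi j hj))
  simp only [sq (∑ i ∈ s, f i _), Finset.sum_mul_sum]
  rw [integral_finsetSum _ fun i hi => integrable_finsetSum _ fun j hj => hint i hi j hj]
  have h1 : ∀ i ∈ s, ∫ x, ∑ j ∈ s, f i x * f j x ∂ν ≤ m * K ^ 2 := by
    intro i hi
    rw [integral_finsetSum _ fun j hj => hint i hi j hj,
      ← Finset.sum_filter_add_sum_filter_not s (r i)]
    rw [Finset.sum_eq_zero (s := s.filter fun j => ¬ r i j) fun j hj =>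
      h i hi j (Finset.mem_filter.1 hj).1 (Finset.mem_filter.1 hj).2, add_zero]
    calc _ ≤ ∑ j ∈ s.filter (r i), K ^ 2 := by
          refine Finset.sum_le_sum fun j hj => ?_
          refine (Real.le_norm_self _).trans ?_
          simpa using norm_integral_le_of_norm_le_const (μ := ν)
            (ae_of_all _ (hb i hi j (Finset.mem_filter.1 hj).1))
      _ = ((s.filter (r i)).card : ℝ) * K ^ 2 := by simp
      _ ≤ m * K ^ 2 := by gcongr; exact hm i hi
  calc _ ≤ ∑ i ∈ s, m * K ^ 2 := Finset.sum_le_sum h1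
    _ = _ := by simp [mul_assoc]

variable {E : Type*} [MeasurableSpace E] {P : Measure E} [IsProbabilityMeasure P]

lemma integral_sum_sq_le_of_centered {g : E → ℝ} (hg : Measurable g) {K : ℝ}
    (hK : ∀ x, |g x| ≤ K) (h0 : ∫ x, g x ∂P = 0) (n : ℕ) :
    ∫ x, (∑ i ∈ Finset.range n, g (x i)) ^ 2 ∂(Measure.infinitePi fun _ : ℕ => P) ≤ n * K ^ 2 := by
  have h := integral_sum_sq_le (ν := Measure.infinitePi fun _ : ℕ => P) (Finset.range n)
    (f := fun i x => g (x i)) (K := K) (m := 1) (fun i _ => hg.comp (measurable_pi_apply i))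
    (fun i _ x => hK _) (fun i j => i = j) ?_ ?_
  · simpa using h
  · intro i _ j _ hij
    refine integral_infinitePi_eq_zero_of_update (K := K ^ 2)
      ((hg.comp (measurable_pi_apply i)).mul (hg.comp (measurable_pi_apply j))) (fun x => ?_) i ?_
    · rw [Real.norm_eq_abs, abs_mul, sq]
      exact mul_le_mul (hK _) (hK _) (abs_nonneg _) ((abs_nonneg _).trans (hK (x i)))
    · intro x
      simp only [Function.update_self, Function.update_of_ne (Ne.symm hij)]
      rw [integral_mul_const, h0, zero_mul]
  · intro i _
    refine (Finset.card_le_card (t := {i}) ?_)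
    intro j
    simp +contextual

/-- The second moment of a sum of a bounded degenerate kernel over different pairs. -/
lemma integral_sum_pairs_sq_le {h : E → E → ℝ} (hh : Measurable (Function.uncurry h)) {K : ℝ}
    (hK : ∀ x y, |h x y| ≤ K) (h1 : ∀ x, ∫ y, h x y ∂P = 0) (h2 : ∀ y, ∫ x, h x y ∂P = 0)
    {ι : Type*} (s : Finset ι) {a b : ι → ℕ} (hab : ∀ i ∈ s, a i ≠ b i)
    (hinj : Set.InjOn (fun i => s(a i, b i)) s) :
    ∫ x, (∑ i ∈ s, h (x (a i)) (x (b i))) ^ 2 ∂(Measure.infinitePi fun _ : ℕ => P)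
      ≤ s.card * K ^ 2 := by
  classical
  have hm : ∀ i, Measurable fun x : ℕ → E => h (x (a i)) (x (b i)) := fun i => by
    simpa [Function.comp_def, Function.uncurry] using hh.comp
      ((measurable_pi_apply (X := fun _ : ℕ => E) (a i)).prodMk (measurable_pi_apply (b i)))
  have hmain := integral_sum_sq_le (ν := Measure.infinitePi fun _ : ℕ => P) s
    (f := fun i x => h (x (a i)) (x (b i))) (K := K) (m := 1) (fun i _ => hm i)
    (fun i _ x => hK _ _) (fun i j => i = j) ?_ ?_
  · simpa using hmain
  · intro i hi j hj hij
    have hne : s(a i, b i) ≠ s(a j, b j) := fun h => hij (hinj hi hj h)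
    have hb : ∀ x : ℕ → E, ‖h (x (a i)) (x (b i)) * h (x (a j)) (x (b j))‖ ≤ K ^ 2 := by
      intro x
      rw [Real.norm_eq_abs, abs_mul, sq]
      exact mul_le_mul (hK _ _) (hK _ _) (abs_nonneg _) ((abs_nonneg _).trans (hK (x 0) (x 0)))
    have hi' := hab i hi
    -- Two different pairs share at most one index, so one index of pair i is absent from pair j.
    -- Integrating over that coordinate kills the product by degeneracy.
    by_cases hA : a i ≠ a j ∧ a i ≠ b j
    · refine integral_infinitePi_eq_zero_of_update ((hm i).mul (hm j)) hb (a i) fun x => ?_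
      simp only [Function.update_self, Function.update_of_ne hA.1.symm,
        Function.update_of_ne hA.2.symm, Function.update_of_ne hi'.symm]
      rw [integral_mul_const, h2, zero_mul]
    · have hB : b i ≠ a j ∧ b i ≠ b j := by
        by_contra hc
        apply hne
        rw [Sym2.eq_iff]
        have := hab j hj
        omega
      refine integral_infinitePi_eq_zero_of_update ((hm i).mul (hm j)) hb (b i) fun x => ?_
      simp only [Function.update_self, Function.update_of_ne hB.1.symm,
        Function.update_of_ne hB.2.symm, Function.update_of_ne hi']
      rw [integral_mul_const, h1, zero_mul]
  · intro i _
    refine (Finset.card_le_card (t := {i}) ?_)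
    intro j
    simp +contextual

end SecondMoment

/-! ### McLeish's central limit theorem for sliding windows. -/

section CLT

/-- In the exponential series at iy + y²/2 the quadratic terms -y²/2 and y²/2 cancel, so the factor
1 + iy is reached up to third order. Compensating by y²/2 is the heart of McLeish's method. -/
lemma norm_exp_add_sub_le {y : ℝ} (hy : |y| ≤ 1 / 2) :
    ‖Complex.exp (y * Complex.I + (y ^ 2 / 2 : ℝ)) - (1 + y * Complex.I)‖ ≤ 2 * |y| ^ 3 := by
  set z : ℂ := y * Complex.I + (y ^ 2 / 2 : ℝ) with hz
  have h0 := abs_nonneg y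
  have hzn : ‖z‖ ≤ 3 / 2 * |y| := by
    refine (norm_add_le _ _).trans ?_
    rw [norm_mul, Complex.norm_I, Complex.norm_real, Complex.norm_real, Real.norm_eq_abs,
      Real.norm_eq_abs, abs_div, abs_pow, abs_two]
    nlinarith
  have h1 := Complex.exp_bound (x := z) (by linarith) (n := 3) (by norm_num)
  have h2 : (∑ m ∈ Finset.range 3, z ^ m / (m.factorial : ℂ)) - (1 + y * Complex.I)
      = (y ^ 3 / 2 : ℝ) * Complex.I + (y ^ 4 / 8 : ℝ) := by
    simp only [Finset.sum_range_succ, Finset.sum_range_zero, Nat.factorial, hz]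
    push_cast
    ring_nf
    simp only [Complex.I_sq]
    ring
  have h3 : ‖((y ^ 3 / 2 : ℝ) * Complex.I + (y ^ 4 / 8 : ℝ) : ℂ)‖ ≤ |y| ^ 3 / 2 + |y| ^ 3 / 16 := by
    refine (norm_add_le _ _).trans ?_
    rw [norm_mul, Complex.norm_I, Complex.norm_real, Complex.norm_real, Real.norm_eq_abs,
      Real.norm_eq_abs, abs_div, abs_div, abs_pow, abs_pow, abs_two]
    have : |(8 : ℝ)| = 8 := by norm_num
    rw [this]
    have : |y| ^ 4 ≤ |y| ^ 3 * (1 / 2) := by rw [pow_succ]; gcongr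
    linarith
  have h4 : ‖z‖ ^ 3 ≤ 27 / 8 * |y| ^ 3 := by
    calc ‖z‖ ^ 3 ≤ (3 / 2 * |y|) ^ 3 := by gcongr
      _ = _ := by ring
  calc _ = ‖(Complex.exp z - ∑ m ∈ Finset.range 3, z ^ m / (m.factorial : ℂ))
        + ((∑ m ∈ Finset.range 3, z ^ m / (m.factorial : ℂ)) - (1 + y * Complex.I))‖ := by
        congr 1; ring
    _ ≤ ‖z‖ ^ 3 * ((Nat.succ 3 : ℝ) * ((Nat.factorial 3 : ℝ) * (3 : ℕ))⁻¹)
        + (|y| ^ 3 / 2 + |y| ^ 3 / 16) := by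
        refine (norm_add_le _ _).trans (add_le_add h1 ?_)
        rw [h2]; exact h3
    _ ≤ 2 * |y| ^ 3 := by
        norm_num [Nat.factorial]
        have := pow_nonneg h0 3
        linarith

/-- Factors are exchanged one at a time. The requirement 1 ≤ B i allows the full product of bounds
to serve as a common majorant. -/
lemma norm_prod_sub_prod_le_sum {ι : Type*} (s : Finset ι) {a b : ι → ℂ} {B : ι → ℝ}
    (hB : ∀ i, 1 ≤ B i) (ha : ∀ i, ‖a i‖ ≤ B i) (hb : ∀ i, ‖b i‖ ≤ B i) :
    ‖∏ i ∈ s, a i - ∏ i ∈ s, b i‖ ≤ (∑ i ∈ s, ‖a i - b i‖) * ∏ i ∈ s, B i := by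
  classical
  induction s using Finset.induction_on with
  | empty => simp
  | insert j s hj ih =>
    rw [Finset.prod_insert hj, Finset.prod_insert hj, Finset.prod_insert hj, Finset.sum_insert hj]
    have hP : 0 ≤ ∏ i ∈ s, B i := Finset.prod_nonneg fun i _ => zero_le_one.trans (hB i)
    have hbP : ‖∏ i ∈ s, b i‖ ≤ ∏ i ∈ s, B i := by
      rw [norm_prod]; exact Finset.prod_le_prod (fun _ _ => norm_nonneg _) fun i _ => hb i
    have hS : 0 ≤ ∑ i ∈ s, ‖a i - b i‖ := Finset.sum_nonneg fun _ _ => norm_nonneg _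
    calc _ = ‖a j * (∏ i ∈ s, a i - ∏ i ∈ s, b i) + (a j - b j) * ∏ i ∈ s, b i‖ := by
          congr 1; ring
      _ ≤ B j * ((∑ i ∈ s, ‖a i - b i‖) * ∏ i ∈ s, B i) + ‖a j - b j‖ * ∏ i ∈ s, B i := by
          refine (norm_add_le _ _).trans ?_
          rw [norm_mul, norm_mul]
          exact add_le_add (mul_le_mul (ha j) ih (norm_nonneg _) (zero_le_one.trans (hB j)))
            (mul_le_mul_of_nonneg_left hbP (norm_nonneg _))
      _ ≤ B j * ((∑ i ∈ s, ‖a i - b i‖) * ∏ i ∈ s, B i)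
          + B j * (‖a j - b j‖ * ∏ i ∈ s, B i) := by
          exact add_le_add le_rfl (le_mul_of_one_le_left
            (mul_nonneg (norm_nonneg (a j - b j)) hP) (hB j))
      _ = _ := by ring

lemma norm_one_add_mul_I_le (y : ℝ) : ‖(1 + y * Complex.I : ℂ)‖ ≤ Real.exp (y ^ 2 / 2) := by
  rw [← abs_of_nonneg (norm_nonneg (1 + y * Complex.I : ℂ)), ← abs_of_pos (Real.exp_pos _),
    ← sq_le_sq, ← Real.exp_nat_mul, Complex.sq_norm, Complex.normSq_apply]
  simp only [Complex.add_re, Complex.one_re, Complex.mul_re, Complex.ofReal_re, Complex.I_re,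
    Complex.ofReal_im, Complex.I_im, Complex.add_im, Complex.one_im, Complex.mul_im]
  have := Real.add_one_le_exp (y ^ 2)
  rw [show ((2 : ℕ) : ℝ) * (y ^ 2 / 2) = y ^ 2 by push_cast; ring]
  linarith

/-- With c of order n^{-1/2} and n factors, the error is of order n · n^{-3/2} and the exponential
stays bounded. -/
lemma norm_exp_sum_sub_prod_le {ι : Type*} (s : Finset ι) {y : ι → ℝ} {c : ℝ} (hc : c ≤ 1 / 2)
    (hy : ∀ i, |y i| ≤ c) :
    ‖Complex.exp ((∑ i ∈ s, y i : ℝ) * Complex.I + ((∑ i ∈ s, y i ^ 2) / 2 : ℝ))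
        - ∏ i ∈ s, (1 + y i * Complex.I)‖
      ≤ (s.card * (2 * c ^ 3)) * Real.exp (s.card * c ^ 2 / 2) := by
  have h1 : Complex.exp ((∑ i ∈ s, y i : ℝ) * Complex.I + ((∑ i ∈ s, y i ^ 2) / 2 : ℝ))
      = ∏ i ∈ s, Complex.exp (y i * Complex.I + (y i ^ 2 / 2 : ℝ)) := by
    rw [← Complex.exp_sum, Finset.sum_add_distrib, ← Finset.sum_mul, Finset.sum_div]
    push_cast
    rfl
  have hsq : ∀ i, y i ^ 2 ≤ c ^ 2 := fun i => by
    rw [← sq_abs]; exact pow_le_pow_left₀ (abs_nonneg _) (hy i) 2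
  rw [h1]
  refine (norm_prod_sub_prod_le_sum s (B := fun _ => Real.exp (c ^ 2 / 2))
    (fun i => Real.one_le_exp (by positivity)) (fun i => ?_) (fun i => ?_)).trans ?_
  · rw [Complex.norm_exp]
    simp only [Complex.add_re, Complex.mul_re, Complex.ofReal_re, Complex.I_re, Complex.ofReal_im,
      Complex.I_im]
    apply Real.exp_le_exp.2
    have := hsq i
    linarith
  · refine (norm_one_add_mul_I_le _).trans (Real.exp_le_exp.2 ?_)
    have := hsq i
    linarith
  · rw [Finset.prod_const, ← Real.exp_nat_mul, mul_div_assoc]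
    gcongr
    calc _ ≤ ∑ i ∈ s, 2 * c ^ 3 := by
          refine Finset.sum_le_sum fun i _ => (norm_exp_add_sub_le ((hy i).trans hc)).trans ?_
          have := pow_le_pow_left₀ (abs_nonneg _) (hy i) 3
          linarith
      _ = _ := by simp

variable {E : Type*} [MeasurableSpace E] {P : Measure E} [IsProbabilityMeasure P]

/-- The value of `φ` at the window of length `d + 1` starting at `i`. -/
def windowFun {d : ℕ} (φ : (Fin (d + 1) → E) → ℝ) (i : ℕ) (x : ℕ → E) : ℝ :=
  φ fun k => x (i + k)

variable {d : ℕ} {φ : (Fin (d + 1) → E) → ℝ}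

lemma measurable_windowFun (hφ : Measurable φ) (i : ℕ) : Measurable (windowFun φ i) :=
  hφ.comp (measurable_pi_lambda _ fun k => measurable_pi_apply (i + k.1))

omit [MeasurableSpace E] in
lemma windowFun_update_of_lt {a i : ℕ} (h : a < i) (x : ℕ → E) (v : E) :
    windowFun φ i (Function.update x a v) = windowFun φ i x := by
  unfold windowFun
  congr 1
  funext k
  exact Function.update_of_ne (by omega) _ _

omit [MeasurableSpace E] in
lemma windowFun_update_self (i : ℕ) (x : ℕ → E) (v : E) :
    windowFun φ i (Function.update x i v)
      = φ (Function.update (fun k : Fin (d + 1) => x (i + k)) 0 v) := by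
  unfold windowFun
  congr 1
  funext k
  by_cases hk : k = 0
  · subst hk; simp
  · rw [Function.update_of_ne hk, Function.update_of_ne]
    have : (k : ℕ) ≠ 0 := fun h => hk (Fin.ext h)
    omega

lemma map_shift_infinitePi (i : ℕ) :
    (Measure.infinitePi fun _ : ℕ => P).map (fun x k => x (i + k))
      = Measure.infinitePi fun _ : ℕ => P :=
  Measure.map_infinitePi_infinitePi_of_inj (P := fun _ : ℕ => P) (f := fun k => i + k)
    (add_right_injective i)

lemma integral_comp_windowFun (hφ : Measurable φ) {g : ℝ → ℝ} (hg : Measurable g) (i : ℕ) :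
    ∫ x, g (windowFun φ i x) ∂(Measure.infinitePi fun _ : ℕ => P)
      = ∫ x, g (windowFun φ 0 x) ∂(Measure.infinitePi fun _ : ℕ => P) := by
  conv_rhs => rw [← map_shift_infinitePi i]
  rw [integral_map]
  · simp [windowFun]
  · exact (measurable_pi_lambda _ fun k => measurable_pi_apply (i + k)).aemeasurable
  · exact (hg.comp (measurable_windowFun hφ 0)).aestronglyMeasurable

lemma indepFun_windowFun (hφ : Measurable φ) {i j : ℕ} (hij : i + d < j) :
    IndepFun (windowFun φ i) (windowFun φ j) (Measure.infinitePi fun _ : ℕ => P) := by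
  have h := (iIndepFun_infinitePi (P := fun _ : ℕ => P) (X := fun _ v => v)
    (fun _ => measurable_id)).indepFun_finset (Finset.Icc i (i + d)) (Finset.Icc j (j + d))
    (by
      rw [Finset.disjoint_left]
      intro a ha hb
      rw [Finset.mem_Icc] at ha hb
      omega) (fun k => measurable_pi_apply k)
  have hm : ∀ l : ℕ, Measurable fun (y : (Finset.Icc l (l + d)) → E) =>
      φ fun k : Fin (d + 1) => y ⟨l + k, Finset.mem_Icc.2 ⟨by omega, by omega⟩⟩ := fun l =>
    hφ.comp (measurable_pi_lambda _ fun k => measurable_pi_apply _)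
  exact h.comp (hm i) (hm j)

/-- Among the windows starting at a or later, only the first contains coordinate a. Integrating over
that coordinate removes the first factor from the product, and induction gives exactly one. In the
application c = i/√n. -/
lemma integral_prod_windowFun (hφ : Measurable φ) {K : ℝ} (hK : ∀ y, |φ y| ≤ K)
    (h0 : ∀ y, ∫ v, φ (Function.update y 0 v) ∂P = 0) (c : ℂ) (m a : ℕ) :
    ∫ x, ∏ i ∈ Finset.Ico a (a + m), (1 + c * (windowFun φ i x : ℂ))
      ∂(Measure.infinitePi fun _ : ℕ => P) = 1 := by
  induction m generalizing a with
  | zero => simp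
  | succ m ih =>
    have hK0 : ∀ i x, ‖(windowFun φ i x : ℂ)‖ ≤ K := fun i x => by
      rw [Complex.norm_real]; exact hK _
    have hKn : 0 ≤ K := by
      obtain ⟨x⟩ : Nonempty E := nonempty_of_isProbabilityMeasure P
      exact (abs_nonneg _).trans (hK fun _ => x)
    have hmw : ∀ i, Measurable fun x : ℕ → E => (windowFun φ i x : ℂ) := fun i =>
      Complex.measurable_ofReal.comp (measurable_windowFun hφ i)
    have hmp : Measurable fun x : ℕ → E =>
        ∏ i ∈ Finset.Ico (a + 1) (a + (m + 1)), (1 + c * (windowFun φ i x : ℂ)) :=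
      Finset.measurable_prod _ fun i _ => ((hmw i).const_mul c).const_add 1
    have hbp : ∀ x : ℕ → E, ‖∏ i ∈ Finset.Ico (a + 1) (a + (m + 1)),
        (1 + c * (windowFun φ i x : ℂ))‖ ≤ (1 + ‖c‖ * K) ^ m := by
      intro x
      rw [norm_prod]
      refine (Finset.prod_le_prod (g := fun _ => 1 + ‖c‖ * K) (fun _ _ => norm_nonneg _)
        fun i _ => ?_).trans ?_
      · refine (norm_add_le _ _).trans ?_
        rw [norm_one, norm_mul]
        gcongr
        exact hK0 _ _
      · rw [Finset.prod_const, Nat.card_Ico]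
        apply le_of_eq
        congr 1
        omega
    have hsplit : ∀ x : ℕ → E, ∏ i ∈ Finset.Ico a (a + (m + 1)), (1 + c * (windowFun φ i x : ℂ))
        = (∏ i ∈ Finset.Ico (a + 1) (a + (m + 1)), (1 + c * (windowFun φ i x : ℂ)))
          + c * (windowFun φ a x : ℂ) *
            ∏ i ∈ Finset.Ico (a + 1) (a + (m + 1)), (1 + c * (windowFun φ i x : ℂ)) := by
      intro x
      rw [Finset.prod_eq_prod_Ico_succ_bot (by omega : a < a + (m + 1))]
      ring
    have hb2 : ∀ x : ℕ → E, ‖c * (windowFun φ a x : ℂ) *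
        ∏ i ∈ Finset.Ico (a + 1) (a + (m + 1)), (1 + c * (windowFun φ i x : ℂ))‖
        ≤ ‖c‖ * K * (1 + ‖c‖ * K) ^ m := by
      intro x
      rw [norm_mul, norm_mul]
      gcongr
      · exact hK0 _ _
      · exact hbp x
    have hm2 := ((hmw a).const_mul c).mul hmp
    have hzero : ∫ x, c * (windowFun φ a x : ℂ) *
        ∏ i ∈ Finset.Ico (a + 1) (a + (m + 1)), (1 + c * (windowFun φ i x : ℂ))
        ∂(Measure.infinitePi fun _ : ℕ => P) = 0 := by
      refine integral_infinitePi_eq_zero_of_update hm2 hb2 a fun x => ?_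
      have : ∀ v, ∏ i ∈ Finset.Ico (a + 1) (a + (m + 1)),
          (1 + c * (windowFun φ i (Function.update x a v) : ℂ))
          = ∏ i ∈ Finset.Ico (a + 1) (a + (m + 1)), (1 + c * (windowFun φ i x : ℂ)) := by
        intro v
        refine Finset.prod_congr rfl fun i hi => ?_
        rw [windowFun_update_of_lt (Finset.mem_Ico.1 hi).1]
      simp only [this, windowFun_update_self]
      rw [integral_mul_const, integral_const_mul, integral_complex_ofReal, h0]
      simp
    simp only [hsplit]
    rw [integral_add, hzero, add_zero]
    · have := ih (a + 1)
      rwa [show a + 1 + m = a + (m + 1) by ring] at this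
    · exact Integrable.of_bound hmp.aestronglyMeasurable _ (ae_of_all _ hbp)
    · exact Integrable.of_bound hm2.aestronglyMeasurable _ (ae_of_all _ hb2)

lemma abs_one_sub_exp_le (w : ℝ) : |1 - Real.exp w| ≤ |w| * Real.exp |w| := by
  rcases le_total 0 w with h | h
  · rw [abs_of_nonneg h, abs_of_nonpos (by linarith [Real.one_le_exp h])]
    have h1 := Real.add_one_le_exp (-w)
    have h2 : Real.exp (-w) * Real.exp w = 1 := by rw [← Real.exp_add]; simp
    nlinarith [Real.exp_pos w]
  · rw [abs_of_nonpos h, abs_of_nonneg (by linarith [Real.exp_le_one_iff.2 h])]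
    have h1 := Real.add_one_le_exp w
    have h2 := Real.one_le_exp (neg_nonneg.2 h)
    nlinarith

/-- The average of the squares of a bounded window function satisfies the weak law of large
numbers. -/
lemma integral_average_sq_windowFun_sub_sq_le (hφ : Measurable φ) {K : ℝ} (hK : ∀ y, |φ y| ≤ K)
    {n : ℕ} (hn : 0 < n) :
    ∫ x, (((n : ℝ)⁻¹ * ∑ i ∈ Finset.range n, windowFun φ i x ^ 2)
        - ∫ z, windowFun φ 0 z ^ 2 ∂(Measure.infinitePi fun _ : ℕ => P)) ^ 2
        ∂(Measure.infinitePi fun _ : ℕ => P) ≤ (2 * d + 1 : ℕ) * (K ^ 2) ^ 2 * (n : ℝ)⁻¹ := by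
  set σ := ∫ z, windowFun φ 0 z ^ 2 ∂(Measure.infinitePi fun _ : ℕ => P) with hσ
  have hsq : ∀ i (x : ℕ → E), windowFun φ i x ^ 2 ≤ K ^ 2 := fun i x => by
    rw [← sq_abs]; exact pow_le_pow_left₀ (abs_nonneg _) (hK _) 2
  have hσ0 : 0 ≤ σ := integral_nonneg fun _ => sq_nonneg _
  have hσK : σ ≤ K ^ 2 := by
    have := norm_integral_le_of_norm_le_const (μ := Measure.infinitePi fun _ : ℕ => P)
      (f := fun z => windowFun φ 0 z ^ 2) (C := K ^ 2) (ae_of_all _ fun z => by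
        rw [Real.norm_eq_abs, abs_of_nonneg (sq_nonneg _)]; exact hsq 0 z)
    simp only [probReal_univ, mul_one] at this
    exact (Real.le_norm_self _).trans this
  have hmY : ∀ i, Measurable fun x : ℕ → E => windowFun φ i x ^ 2 - σ := fun i =>
    ((measurable_windowFun hφ i).pow_const 2).sub_const σ
  have hbY : ∀ i (x : ℕ → E), |windowFun φ i x ^ 2 - σ| ≤ K ^ 2 := fun i x => by
    rw [abs_le]
    constructor <;> linarith [hsq i x, sq_nonneg (windowFun φ i x)]
  have h0Y : ∀ i, ∫ x, (windowFun φ i x ^ 2 - σ) ∂(Measure.infinitePi fun _ : ℕ => P) = 0 := by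
    intro i
    rw [integral_comp_windowFun hφ (g := fun u => u ^ 2 - σ) (by fun_prop) i, integral_sub,
      integral_const, ← hσ]
    · simp
    · refine Integrable.of_bound ((measurable_windowFun hφ 0).pow_const 2).aestronglyMeasurable
        (K ^ 2) (ae_of_all _ fun z => ?_)
      rw [Real.norm_eq_abs, abs_of_nonneg (sq_nonneg _)]; exact hsq 0 z
    · exact integrable_const _
  have hind : ∀ i j, i + d < j → ∫ x, (windowFun φ i x ^ 2 - σ) * (windowFun φ j x ^ 2 - σ)
      ∂(Measure.infinitePi fun _ : ℕ => P) = 0 := by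
    intro i j hij
    have h := (indepFun_windowFun (P := P) hφ hij).comp (φ := fun u : ℝ => u ^ 2 - σ)
      (ψ := fun u : ℝ => u ^ 2 - σ) (by fun_prop) (by fun_prop)
    have h2 := h.integral_mul_eq_mul_integral (hmY i).aestronglyMeasurable
      (hmY j).aestronglyMeasurable
    simp only [Function.comp_def] at h2
    change ∫ x, _ ∂_ = _ at h2
    simp only [Pi.mul_apply] at h2
    rw [h2, h0Y i, zero_mul]
  -- Windows starting more than d apart are independent, so each term is correlated with at most 2d
  -- + 1 terms.
  have hmain := integral_sum_sq_le (ν := Measure.infinitePi fun _ : ℕ => P) (Finset.range n)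
    (f := fun i x => windowFun φ i x ^ 2 - σ) (K := K ^ 2) (m := 2 * d + 1)
    (fun i _ => hmY i) (fun i _ => hbY i) (fun i j => i ≤ j + d ∧ j ≤ i + d) ?_ ?_
  · have hn' : (0 : ℝ) < n := Nat.cast_pos.2 hn
    have heq : ∀ x : ℕ → E, (((n : ℝ)⁻¹ * ∑ i ∈ Finset.range n, windowFun φ i x ^ 2) - σ) ^ 2
        = ((n : ℝ)⁻¹) ^ 2 * (∑ i ∈ Finset.range n, (windowFun φ i x ^ 2 - σ)) ^ 2 := by
      intro x
      rw [Finset.sum_sub_distrib, Finset.sum_const, Finset.card_range, nsmul_eq_mul]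
      field_simp
    simp only [heq]
    rw [integral_const_mul]
    calc _ ≤ ((n : ℝ)⁻¹) ^ 2 * ((Finset.range n).card * (2 * d + 1 : ℕ) * (K ^ 2) ^ 2) := by
          gcongr
      _ = _ := by
          rw [Finset.card_range]
          field_simp
  · intro i _ j _ hij
    rw [not_and_or, not_le, not_le] at hij
    rcases hij with h | h
    · simp only [mul_comm (windowFun φ i _ ^ 2 - σ)]
      exact hind j i h
    · exact hind i j h
  · intro i _
    refine (Finset.card_le_card (t := Finset.Icc (i - d) (i + d)) fun j hj => ?_).trans ?_
    · have := (Finset.mem_filter.1 hj).2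
      rw [Finset.mem_Icc]
      omega
    · rw [Nat.card_Icc]
      omega

/-- Central limit theorem for a bounded reverse martingale difference sequence which is a function
of a sliding window. -/
theorem tendsto_integral_exp_sum_windowFun (hφ : Measurable φ) {K : ℝ} (hK : ∀ y, |φ y| ≤ K)
    (h0 : ∀ y, ∫ v, φ (Function.update y 0 v) ∂P = 0) :
    Tendsto (fun n : ℕ => ∫ x, Complex.exp
        (((√(n : ℝ))⁻¹ * ∑ i ∈ Finset.range n, windowFun φ i x : ℝ) * Complex.I)
        ∂(Measure.infinitePi fun _ : ℕ => P)) atTop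
      (𝓝 (Real.exp (-(∫ z, windowFun φ 0 z ^ 2 ∂(Measure.infinitePi fun _ : ℕ => P)) / 2))) := by
  set ν := Measure.infinitePi fun _ : ℕ => P with hν
  set σ := ∫ z, windowFun φ 0 z ^ 2 ∂ν with hσ
  have hsq : ∀ i (x : ℕ → E), windowFun φ i x ^ 2 ≤ K ^ 2 := fun i x => by
    rw [← sq_abs]; exact pow_le_pow_left₀ (abs_nonneg _) (hK _) 2
  have hK0 : 0 ≤ K := by
    obtain ⟨x⟩ : Nonempty E := nonempty_of_isProbabilityMeasure P
    exact (abs_nonneg _).trans (hK fun _ => x)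
  have hσ0 : 0 ≤ σ := integral_nonneg fun _ => sq_nonneg _
  have hσK : σ ≤ K ^ 2 := by
    have := norm_integral_le_of_norm_le_const (μ := ν)
      (f := fun z => windowFun φ 0 z ^ 2) (C := K ^ 2) (ae_of_all _ fun z => by
        rw [Real.norm_eq_abs, abs_of_nonneg (sq_nonneg _)]; exact hsq 0 z)
    simp only [probReal_univ, mul_one] at this
    exact (Real.le_norm_self _).trans this
  -- The first summand bounds the passage from the exponential to the product, the second the
  -- replacement of the random V by σ.
  set A : ℝ := 2 * K ^ 3 * Real.exp (K ^ 2 / 2)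
    + Real.exp (K ^ 2) * ((1 + (2 * d + 1 : ℕ) * (K ^ 2) ^ 2) / 2) with hA
  rw [tendsto_iff_norm_sub_tendsto_zero]
  have hlim : Tendsto (fun n : ℕ => A * (√(n : ℝ))⁻¹) atTop (𝓝 0) := by
    have : Tendsto (fun n : ℕ => (√(n : ℝ))⁻¹) atTop (𝓝 0) :=
      tendsto_inv_atTop_zero.comp (Real.tendsto_sqrt_atTop.comp tendsto_natCast_atTop_atTop)
    simpa using this.const_mul A
  refine squeeze_zero' (Eventually.of_forall fun _ => norm_nonneg _) ?_ hlim
  -- This makes c = K/√n at most 1/2, as the Taylor estimate requires.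
  have hev : ∀ᶠ n : ℕ in atTop, 2 * K ≤ √(n : ℝ) :=
    (Real.tendsto_sqrt_atTop.comp tendsto_natCast_atTop_atTop).eventually_ge_atTop _
  filter_upwards [hev, eventually_gt_atTop 0] with n hn hn0
  have hn' : (0 : ℝ) < n := Nat.cast_pos.2 hn0
  set r := √(n : ℝ) with hr
  have hr0 : 0 < r := Real.sqrt_pos.2 hn'
  have hrn : r ^ 2 = n := Real.sq_sqrt hn'.le
  let y : ℕ → (ℕ → E) → ℝ := fun i x => r⁻¹ * windowFun φ i x
  let c : ℝ := r⁻¹ * K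
  have hyc : ∀ i x, |y i x| ≤ c := fun i x => by
    simp only [y, c, abs_mul, abs_of_pos (inv_pos.2 hr0)]
    gcongr
    exact hK _
  have hc : c ≤ 1 / 2 := by
    simp only [c]
    rw [inv_mul_le_iff₀ hr0]
    linarith
  let V : (ℕ → E) → ℝ := fun x => (n : ℝ)⁻¹ * ∑ i ∈ Finset.range n, windowFun φ i x ^ 2
  have hV : ∀ x, ∑ i ∈ Finset.range n, y i x ^ 2 = V x := fun x => by
    simp only [y, V, mul_pow, Finset.mul_sum, inv_pow, hrn]
  have hS : ∀ x, r⁻¹ * ∑ i ∈ Finset.range n, windowFun φ i x = ∑ i ∈ Finset.range n, y i x :=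
    fun x => by simp only [y, Finset.mul_sum]
  have hmy : ∀ i, Measurable (y i) := fun i => (measurable_windowFun hφ i).const_mul _
  have hmV : Measurable V :=
    (Finset.measurable_sum _ fun i _ => (measurable_windowFun hφ i).pow_const 2).const_mul _
  have hV0 : ∀ x, 0 ≤ V x := fun x =>
    mul_nonneg (inv_nonneg.2 hn'.le) (Finset.sum_nonneg fun _ _ => sq_nonneg _)
  have hVK : ∀ x, V x ≤ K ^ 2 := fun x => by
    simp only [V]
    rw [inv_mul_le_iff₀ hn']
    calc _ ≤ ∑ i ∈ Finset.range n, K ^ 2 := Finset.sum_le_sum fun i _ => hsq i x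
      _ = _ := by simp
  have hmS : Measurable fun x => ∑ i ∈ Finset.range n, y i x :=
    Finset.measurable_sum _ fun i _ => hmy i
  -- the three parts of the difference
  let e₁ : (ℕ → E) → ℂ := fun x => Complex.exp ((∑ i ∈ Finset.range n, y i x : ℝ) * Complex.I
    + ((∑ i ∈ Finset.range n, y i x ^ 2) / 2 : ℝ))
  let W : (ℕ → E) → ℂ := fun x => ∏ i ∈ Finset.range n, (1 + y i x * Complex.I)
  let e₂ : (ℕ → E) → ℂ := fun x => Complex.exp ((∑ i ∈ Finset.range n, y i x : ℝ) * Complex.I)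
    * (1 - Real.exp ((V x - σ) / 2) : ℝ)
  have hcn : n * c ^ 2 = K ^ 2 := by
    simp only [c]; rw [mul_pow, inv_pow, hrn]; field_simp
  have h1 : ∀ x, ‖e₁ x - W x‖ ≤ 2 * K ^ 3 * Real.exp (K ^ 2 / 2) * r⁻¹ := fun x => by
    refine (norm_exp_sum_sub_prod_le _ hc fun i => hyc i x).trans (le_of_eq ?_)
    rw [Finset.card_range, hcn]
    have : (n : ℝ) * (2 * c ^ 3) = 2 * (n * c ^ 2) * c := by ring
    rw [this, hcn]
    simp only [c]
    ring
  have h2 : ∫ x, W x ∂ν = 1 := by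
    have := integral_prod_windowFun (P := P) hφ hK h0 ((r⁻¹ : ℝ) * Complex.I) n 0
    rw [← this]
    refine integral_congr_ae (ae_of_all _ fun x => ?_)
    simp only [W, zero_add, y, Nat.Ico_zero_eq_range]
    refine Finset.prod_congr rfl fun i _ => ?_
    push_cast
    ring
  -- By 2|t| ≤ r⁻¹ + r t² with r = √n, the first absolute moment of V - σ is controlled through its
  -- variance, which is O(1/n); the result is O(n^{-1/2}).
  have h3 : ∀ x, ‖e₂ x‖ ≤ Real.exp (K ^ 2) * ((r⁻¹ + r * (V x - σ) ^ 2) / 2) := fun x => by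
    simp only [e₂]
    rw [norm_mul, Complex.norm_exp_ofReal_mul_I, one_mul, Complex.norm_real, Real.norm_eq_abs]
    have hab : |V x - σ| ≤ K ^ 2 := by
      rw [abs_le]; constructor <;> linarith [hV0 x, hVK x]
    refine (abs_one_sub_exp_le _).trans ?_
    have hw : |(V x - σ) / 2| ≤ |V x - σ| := by
      rw [abs_div, abs_two]; linarith [abs_nonneg (V x - σ)]
    rw [mul_comm]
    gcongr
    · exact hw.trans hab
    · rw [abs_div, abs_two]
      gcongr
      have h5 : 0 ≤ r⁻¹ * (1 - r * |V x - σ|) ^ 2 := by positivity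
      have h6 : r⁻¹ * (1 - r * |V x - σ|) ^ 2
          = r⁻¹ + r * (V x - σ) ^ 2 - 2 * |V x - σ| := by
        rw [← sq_abs (V x - σ)]; field_simp; ring
      linarith [abs_nonneg (V x - σ)]
  have hme1 : Measurable e₁ := by
    refine Complex.measurable_exp.comp ?_
    simp only [hV]
    exact ((Complex.measurable_ofReal.comp hmS).mul_const _).add
      (Complex.measurable_ofReal.comp (hmV.div_const _))
  have hmW : Measurable W := Finset.measurable_prod _ fun i _ =>
    ((Complex.measurable_ofReal.comp (hmy i)).mul_const _).const_add 1
  have hmE : Measurable fun x => Complex.exp ((∑ i ∈ Finset.range n, y i x : ℝ) * Complex.I) :=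
    Complex.measurable_exp.comp ((Complex.measurable_ofReal.comp hmS).mul_const _)
  have hme2 : Measurable e₂ := hmE.mul (Complex.measurable_ofReal.comp
    ((Real.measurable_exp.comp ((hmV.sub_const _).div_const _)).const_sub 1))
  -- e^{iS} = e^{-σ/2} e^{iS + V/2} + e^{iS}(1 - e^{(V-σ)/2}). Replacing e^{iS + V/2} by W, which
  -- has mean one, leaves the claimed limit e^{-σ/2}.
  have hdec : ∀ x, Complex.exp ((r⁻¹ * ∑ i ∈ Finset.range n, windowFun φ i x : ℝ) * Complex.I)
      = (Real.exp (-σ / 2) : ℂ) * (e₁ x - W x) + (Real.exp (-σ / 2) : ℂ) * W x + e₂ x := by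
    intro x
    have h7 : (Real.exp (-σ / 2) : ℂ) * e₁ x
        = Complex.exp ((∑ i ∈ Finset.range n, y i x : ℝ) * Complex.I)
          * (Real.exp ((V x - σ) / 2) : ℝ) := by
      simp only [e₁, hV]
      rw [Complex.exp_add, ← Complex.ofReal_exp (V x / 2)]
      have : Real.exp ((V x - σ) / 2) = Real.exp (-σ / 2) * Real.exp (V x / 2) := by
        rw [← Real.exp_add]; congr 1; ring
      rw [this]
      push_cast
      ring
    rw [hS, mul_sub, h7]
    simp only [e₂]
    push_cast
    ring
  have hb1 : Integrable (fun x => e₁ x - W x) ν :=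
    Integrable.of_bound (hme1.sub hmW).aestronglyMeasurable _ (ae_of_all _ h1)
  have hbe : ∀ x, ‖e₁ x‖ ≤ Real.exp (K ^ 2 / 2) := fun x => by
    simp only [e₁, hV]
    rw [Complex.norm_exp]
    simp only [Complex.add_re, Complex.mul_re, Complex.ofReal_re, Complex.I_re, Complex.ofReal_im,
      Complex.I_im]
    apply Real.exp_le_exp.2
    linarith [hVK x]
  have hbW : Integrable W ν := by
    have := (Integrable.of_bound (μ := ν) hme1.aestronglyMeasurable _ (ae_of_all _ hbe)).sub hb1
    refine this.congr (ae_of_all _ fun x => ?_)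
    simp
  have hbd : ∀ x, Real.exp (K ^ 2) * ((r⁻¹ + r * (V x - σ) ^ 2) / 2)
      ≤ Real.exp (K ^ 2) * ((r⁻¹ + r * (K ^ 2) ^ 2) / 2) := fun x => by
    gcongr 2
    have hab : |V x - σ| ≤ K ^ 2 := by
      rw [abs_le]; constructor <;> linarith [hV0 x, hVK x]
    have : (V x - σ) ^ 2 ≤ (K ^ 2) ^ 2 := by
      rw [← sq_abs]; exact pow_le_pow_left₀ (abs_nonneg _) hab 2
    gcongr
  have hb2 : Integrable e₂ ν := Integrable.of_bound hme2.aestronglyMeasurable _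
    (ae_of_all _ fun x => (h3 x).trans (hbd x))
  have hVint : Integrable (fun x => (V x - σ) ^ 2) ν := by
    refine Integrable.of_bound ((hmV.sub_const _).pow_const 2).aestronglyMeasurable
      ((K ^ 2) ^ 2) (ae_of_all _ fun x => ?_)
    have hab : |V x - σ| ≤ K ^ 2 := by
      rw [abs_le]; constructor <;> linarith [hV0 x, hVK x]
    rw [Real.norm_eq_abs, abs_of_nonneg (sq_nonneg _), ← sq_abs]
    exact pow_le_pow_left₀ (abs_nonneg _) hab 2
  have hi3 : ‖∫ x, e₂ x ∂ν‖
      ≤ Real.exp (K ^ 2) * ((1 + (2 * d + 1 : ℕ) * (K ^ 2) ^ 2) / 2) * r⁻¹ := by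
    refine (norm_integral_le_integral_norm _).trans ((integral_mono_of_nonneg
      (ae_of_all _ fun _ => norm_nonneg _) ?_ (ae_of_all _ h3)).trans ?_)
    · exact ((((integrable_const r⁻¹).add (hVint.const_mul r)).div_const 2).const_mul _)
    · rw [integral_const_mul, integral_div, integral_add (integrable_const _)
        (hVint.const_mul r), integral_const_mul, integral_const, mul_assoc]
      simp only [probReal_univ, one_smul]
      gcongr
      have h8 := integral_average_sq_windowFun_sub_sq_le (P := P) hφ hK hn0
      rw [← hν, ← hσ] at h8
      have h9 : r * ∫ x, (V x - σ) ^ 2 ∂ν ≤ r * ((2 * d + 1 : ℕ) * (K ^ 2) ^ 2 * (n : ℝ)⁻¹) := by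
        gcongr
      have h10 : r * ((2 * d + 1 : ℕ) * (K ^ 2) ^ 2 * (n : ℝ)⁻¹)
          = (2 * d + 1 : ℕ) * (K ^ 2) ^ 2 * r⁻¹ := by
        rw [← hrn]; field_simp
      linarith
  have hi1 : ‖∫ x, (e₁ x - W x) ∂ν‖ ≤ 2 * K ^ 3 * Real.exp (K ^ 2 / 2) * r⁻¹ := by
    simpa using norm_integral_le_of_norm_le_const (μ := ν) (ae_of_all _ h1)
  have hexp : ‖(Real.exp (-σ / 2) : ℂ)‖ ≤ 1 := by
    rw [Complex.norm_real, Real.norm_eq_abs, abs_of_pos (Real.exp_pos _), Real.exp_le_one_iff]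
    linarith
  simp only [hdec]
  rw [integral_add (f := fun x => (Real.exp (-σ / 2) : ℂ) * (e₁ x - W x)
      + (Real.exp (-σ / 2) : ℂ) * W x) ((hb1.const_mul _).add (hbW.const_mul _)) hb2,
    integral_add (hb1.const_mul _) (hbW.const_mul _), integral_const_mul, integral_const_mul, h2]
  calc _ = ‖(Real.exp (-σ / 2) : ℂ) * ∫ x, (e₁ x - W x) ∂ν + ∫ x, e₂ x ∂ν‖ := by
        congr 1; ring
    _ ≤ 1 * (2 * K ^ 3 * Real.exp (K ^ 2 / 2) * r⁻¹)
        + Real.exp (K ^ 2) * ((1 + (2 * d + 1 : ℕ) * (K ^ 2) ^ 2) / 2) * r⁻¹ := by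
        refine (norm_add_le _ _).trans (add_le_add ?_ hi3)
        rw [norm_mul]
        gcongr
    _ = A * r⁻¹ := by rw [hA]; ring

end CLT

/-! ### Balanced designs of pairs and their empirical distributions. -/

section Design

variable {q : ℕ} {ι : Type*}

lemma integral_symDirac {F : Type*} [NormedAddCommGroup F] [NormedSpace ℝ F] [CompleteSpace F] (z : Vec q)
    (f : Vec q → F) : ∫ y, f y ∂(symDirac z) = (2 : ℝ)⁻¹ • (f z + f (-z)) := by
  rw [symDirac, integral_smul_measure, integral_add_measure (integrable_dirac (by simp))
    (integrable_dirac (by simp)), integral_dirac, integral_dirac]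
  simp

lemma integrable_symDirac {F : Type*} [NormedAddCommGroup F] (z : Vec q)
    (f : Vec q → F) : Integrable f (symDirac z) :=
  ((integrable_dirac (by simp)).add_measure (integrable_dirac (by simp))).smul_measure (by simp)

instance isProbabilityMeasure_symDirac (z : Vec q) : IsProbabilityMeasure (symDirac z) := by
  refine ⟨?_⟩
  simp only [symDirac, Measure.smul_apply, Measure.add_apply, measure_univ, smul_eq_mul]
  rw [one_add_one_eq_two]
  exact ENNReal.inv_mul_cancel (by simp) (by simp)

/-- The empirical distribution of the symmetrized differences over the pairs `(a i, b i)`. -/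
noncomputable def pairEmpirical (s : Finset ι) (a b : ι → ℕ) (x : ℕ → Vec q) : Measure (Vec q) :=
  (s.card : ℝ≥0∞)⁻¹ • ∑ i ∈ s, symDirac (x (b i) - x (a i))

lemma empiricalDiffInc_eq_pairEmpirical (n d : ℕ) (x : ℕ → Vec q) :
    empiricalDiffInc n d x = pairEmpirical (Finset.range n ×ˢ Finset.Icc 1 d)
      (fun p : ℕ × ℕ => p.1) (fun p => (p.1 + p.2) % n) x := by
  rw [empiricalDiffInc, pairEmpirical, Finset.sum_product]
  simp

lemma card_sigma_range (n : ℕ) :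
    ((Finset.range n).sigma fun j => Finset.range j).card = n.choose 2 := by
  rw [Finset.card_sigma]
  simp [Finset.sum_range_id, Nat.choose_two_right]

lemma empiricalDiff_eq_pairEmpirical (n : ℕ) (x : ℕ → Vec q) :
    empiricalDiff n x = pairEmpirical ((Finset.range n).sigma fun j => Finset.range j)
      (fun p : (_ : ℕ) × ℕ => p.2) (fun p => p.1) x := by
  rw [empiricalDiff, pairEmpirical, Finset.sum_sigma, card_sigma_range]

lemma isProbabilityMeasure_pairEmpirical {s : Finset ι} (hs : s.Nonempty) (a b : ι → ℕ)
    (x : ℕ → Vec q) : IsProbabilityMeasure (pairEmpirical s a b x) := by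
  refine ⟨?_⟩
  rw [pairEmpirical, Measure.smul_apply, Measure.finsetSum_apply]
  simp only [measure_univ, Finset.sum_const, nsmul_eq_mul, mul_one, smul_eq_mul]
  refine ENNReal.inv_mul_cancel ?_ (by simp)
  simpa using hs.ne_empty

lemma pairEmpirical_empty (a b : ι → ℕ) (x : ℕ → Vec q) : pairEmpirical ∅ a b x = 0 := by
  simp [pairEmpirical]

lemma integral_pairEmpirical {F : Type*} [NormedAddCommGroup F] [NormedSpace ℝ F] [CompleteSpace F]
    (s : Finset ι) (a b : ι → ℕ) (x : ℕ → Vec q) (f : Vec q → F) :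
    ∫ y, f y ∂(pairEmpirical s a b x) = (s.card : ℝ)⁻¹ •
      ∑ i ∈ s, (2 : ℝ)⁻¹ • (f (x (b i) - x (a i)) + f (-(x (b i) - x (a i)))) := by
  rw [pairEmpirical, integral_smul_measure, integral_finsetSum_measure
    fun i _ => integrable_symDirac _ _]
  simp [integral_symDirac]

lemma integral_pairEmpirical_of_even {F : Type*} [NormedAddCommGroup F] [NormedSpace ℝ F] [CompleteSpace F]
    (s : Finset ι) (a b : ι → ℕ) (x : ℕ → Vec q) {f : Vec q → F} (hf : ∀ y, f (-y) = f y) :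
    ∫ y, f y ∂(pairEmpirical s a b x) = (s.card : ℝ)⁻¹ • ∑ i ∈ s, f (x (a i) - x (b i)) := by
  rw [integral_pairEmpirical]
  congr 1
  refine Finset.sum_congr rfl fun i _ => ?_
  rw [← hf (x (b i) - x (a i)), neg_sub, ← two_smul ℝ, smul_smul]
  norm_num

lemma integral_empirical {F : Type*} [NormedAddCommGroup F] [NormedSpace ℝ F] [CompleteSpace F]
    (n : ℕ) (x : ℕ → Vec q) (f : Vec q → F) :
    ∫ y, f y ∂(empirical n x) = (n : ℝ)⁻¹ • ∑ i ∈ Finset.range n, f (x i) := by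
  rw [empirical, integral_smul_measure, integral_finsetSum_measure
    fun i _ => integrable_dirac (by simp)]
  simp

/-- A design of pairs of different indices below `n`, without repetitions, in which every index
occurs equally often. -/
structure IsBalancedDesign (n : ℕ) (s : Finset ι) (a b : ι → ℕ) : Prop where
  pos : 0 < n
  -- Together with balance this says that every index occurs at least once; it bounds the variance
  -- of the degenerate part by a multiple of 1/n.
  le_card : n ≤ 2 * s.card
  ne : ∀ i ∈ s, a i ≠ b i
  injOn : Set.InjOn (fun i => s(a i, b i)) s
  balance : ∀ {F : Type} [AddCommGroup F] [Module ℝ F] (g : ℕ → F),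
    ∑ i ∈ s, (g (a i) + g (b i)) = (2 * s.card / n : ℝ) • ∑ i ∈ Finset.range n, g i

lemma add_mod_cases {n i k : ℕ} (hi : i < n) (hk : k < n) :
    (i + k < n ∧ (i + k) % n = i + k) ∨ (n ≤ i + k ∧ (i + k) % n = i + k - n) := by
  rcases lt_or_ge (i + k) n with h | h
  · exact Or.inl ⟨h, Nat.mod_eq_of_lt h⟩
  · exact Or.inr ⟨h, by rw [Nat.mod_eq_sub_mod h, Nat.mod_eq_of_lt (by omega)]⟩

lemma sum_range_add_mod {F : Type*} [AddCommMonoid F] {n k : ℕ} (hk : k < n) (g : ℕ → F) :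
    ∑ i ∈ Finset.range n, g ((i + k) % n) = ∑ i ∈ Finset.range n, g i := by
  have hmaps : Set.MapsTo (fun i => (i + k) % n) (Finset.range n) (Finset.range n) := fun i hi => by
    simp only [Finset.coe_range, Set.mem_Iio] at hi ⊢
    exact Nat.mod_lt _ (by omega)
  have hinj : Set.InjOn (fun i => (i + k) % n) (Finset.range n) := fun i hi j hj h => by
    simp only [Finset.coe_range, Set.mem_Iio] at hi hj h
    have h1 := add_mod_cases hi hk
    have h2 := add_mod_cases hj hk
    omega
  exact Finset.sum_nbij (fun i => (i + k) % n) hmaps hinj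
    (Finset.surjOn_of_injOn_of_card_le _ hmaps hinj le_rfl) fun _ _ => rfl

/-- A pair could repeat only as {i, i+k} = {i+k, i+k+l} with k + l divisible by n, which 2d < n
excludes. Balance holds because each cyclic shift permutes the indices. -/
lemma isBalancedDesign_cyclic {n d : ℕ} (hd : 1 ≤ d) (hn : 2 * d + 1 ≤ n) :
    IsBalancedDesign n (Finset.range n ×ˢ Finset.Icc 1 d)
      (fun p : ℕ × ℕ => p.1) (fun p => (p.1 + p.2) % n) where
  pos := by omega
  le_card := by
    simp only [Finset.card_product, Finset.card_range, Nat.card_Icc, Nat.add_sub_cancel]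
    nlinarith
  ne := by
    rintro ⟨i, k⟩ h
    simp only [Finset.mem_product, Finset.mem_range, Finset.mem_Icc] at h
    have := add_mod_cases (n := n) (i := i) (k := k) h.1 (by omega)
    simp only
    omega
  injOn := by
    rintro ⟨i, k⟩ h ⟨j, l⟩ h' he
    simp only [Finset.coe_product, Set.mem_prod, Finset.mem_coe, Finset.mem_range,
      Finset.mem_Icc] at h h'
    have h1 := add_mod_cases (n := n) (i := i) (k := k) h.1 (by omega)
    have h2 := add_mod_cases (n := n) (i := j) (k := l) h'.1 (by omega)
    simp only [Sym2.eq_iff] at he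
    rw [Prod.mk.injEq]
    omega
  balance := by
    intro F _ _ g
    have hn0 : (n : ℝ) ≠ 0 := by
      have : n ≠ 0 := by omega
      exact_mod_cast this
    rw [Finset.sum_product_right]
    have : ∀ k ∈ Finset.Icc 1 d, ∑ i ∈ Finset.range n, (g i + g ((i + k) % n))
        = (2 : ℝ) • ∑ i ∈ Finset.range n, g i := by
      intro k hk
      rw [Finset.mem_Icc] at hk
      rw [Finset.sum_add_distrib, sum_range_add_mod (by omega), two_smul]
    rw [Finset.sum_congr rfl this, Finset.sum_const, Nat.card_Icc, ← Nat.cast_smul_eq_nsmul ℝ,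
      smul_smul, Finset.card_product]
    congr 1
    simp only [Finset.card_range, Nat.card_Icc, Nat.add_sub_cancel, Nat.cast_mul]
    field_simp

lemma sum_range_pairs {F : Type*} [AddCommGroup F] [Module ℝ F] (n : ℕ) (g : ℕ → F) :
    ∑ j ∈ Finset.range n, ∑ i ∈ Finset.range j, (g i + g j)
      = ((n : ℝ) - 1) • ∑ i ∈ Finset.range n, g i := by
  induction n with
  | zero => simp
  | succ n ih =>
    rw [Finset.sum_range_succ, ih, Finset.sum_range_succ _ n, Finset.sum_add_distrib,
      Finset.sum_const, Finset.card_range, ← Nat.cast_smul_eq_nsmul ℝ]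
    push_cast
    module

lemma isBalancedDesign_complete {n : ℕ} (hn : 2 ≤ n) :
    IsBalancedDesign n ((Finset.range n).sigma fun j => Finset.range j)
      (fun p : (_ : ℕ) × ℕ => p.2) (fun p => p.1) where
  pos := by omega
  le_card := by
    rw [card_sigma_range, Nat.choose_two_right, Nat.mul_div_cancel' (Nat.even_mul_pred_self n).two_dvd]
    exact Nat.le_mul_of_pos_right _ (by omega)
  ne := by
    rintro ⟨j, i⟩ h
    simp only [Finset.mem_sigma, Finset.mem_range] at h ⊢
    omega
  injOn := by
    rintro ⟨j, i⟩ h ⟨j', i'⟩ h' he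
    simp only [Finset.coe_sigma, Set.mem_sigma_iff, Finset.mem_coe, Finset.mem_range] at h h'
    simp only [Sym2.eq_iff] at he
    obtain ⟨rfl, rfl⟩ : j = j' ∧ i = i' := by omega
    rfl
  balance := by
    intro F _ _ g
    rw [Finset.sum_sigma, sum_range_pairs, card_sigma_range]
    congr 1
    have h2 : 2 * n.choose 2 = n * (n - 1) := by
      rw [Nat.choose_two_right, Nat.mul_div_cancel' (Nat.even_mul_pred_self n).two_dvd]
    have h3 : (2 : ℝ) * (n.choose 2 : ℕ) = n * (n - 1) := by
      have : ((n - 1 : ℕ) : ℝ) = (n : ℝ) - 1 := by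
        rw [Nat.cast_sub (by omega)]; simp
      rw [← this]
      exact_mod_cast h2
    have hn0 : (n : ℝ) ≠ 0 := by
      have : n ≠ 0 := by omega
      exact_mod_cast this
    rw [h3]
    field_simp

/-- The pairwise empirical distribution as a probability measure. -/
noncomputable def pairEmpiricalProb (s : Finset ι) (hs : s.Nonempty) (a b : ι → ℕ)
    (x : ℕ → Vec q) : ProbabilityMeasure (Vec q) :=
  ⟨pairEmpirical s a b x, isProbabilityMeasure_pairEmpirical hs a b x⟩

/-- A test integral is a finite sum of continuous functions of finitely many coordinates. Continuity
in the data is the hypothesis on T in `measurable_toFun_comp`. -/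
lemma continuous_pairEmpiricalProb (s : Finset ι) (hs : s.Nonempty) (a b : ι → ℕ) :
    Continuous (pairEmpiricalProb (q := q) s hs a b) := by
  rw [ProbabilityMeasure.continuous_iff_forall_continuous_integral]
  intro f
  simp only [pairEmpiricalProb, ProbabilityMeasure.coe_mk, integral_pairEmpirical,
    smul_eq_mul]
  refine continuous_const.mul ?_
  refine continuous_finsetSum (M := ℝ) _ fun i _ => ?_
  have hf := f.continuous
  fun_prop

lemma measurable_integral_pairEmpirical {F : Type*} [NormedAddCommGroup F] [NormedSpace ℝ F] [CompleteSpace F]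
    [MeasurableSpace F] [BorelSpace F] [SecondCountableTopology F]
    (s : Finset ι) (a b : ι → ℕ) {J : Vec q → F} (hJ : Measurable J) :
    Measurable fun x : ℕ → Vec q => ∫ y, J y ∂(pairEmpirical s a b x) := by
  simp only [integral_pairEmpirical]
  refine (Finset.measurable_sum _ fun i _ => ?_).const_smul _
  have h : Measurable fun x : ℕ → Vec q => x (b i) - x (a i) :=
    (measurable_pi_apply _).sub (measurable_pi_apply _)
  exact ((hJ.comp h).add (hJ.comp h.neg)).const_smul _

/-- Convergence in distribution presupposes measurable estimators. No measurability of the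
functional is assumed; it comes from the existence of influence functions and the form of the
domain. -/
lemma measurable_eval_pairEmpirical {S : ScatterFunctional q} (hG : IsGδ S.domain)
    (hJ : ∀ Q ∈ S.domain, ∃ J, S.IsInfluenceFunction Q J) (s : Finset ι) (a b : ι → ℕ) :
    Measurable fun x : ℕ → Vec q => S.eval (pairEmpirical s a b x) := by
  classical
  rcases s.eq_empty_or_nonempty with rfl | hs
  · simp only [pairEmpirical_empty]
    exact measurable_const
  · have h := measurable_toFun_comp hG hJ (continuous_pairEmpiricalProb s hs a b)
      fun J hJ => measurable_integral_pairEmpirical s a b hJ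
    convert h using 2 with x
    rw [ScatterFunctional.eval]
    by_cases h : pairEmpiricalProb s hs a b x ∈ S.domain
    · rw [if_pos h, dif_pos ⟨isProbabilityMeasure_pairEmpirical hs a b x, h⟩]
      rfl
    · rw [if_neg h, dif_neg]
      rintro ⟨_, h'⟩
      exact h h'

end Design

/-! ### Hoeffding decomposition and second moments of its parts. -/

section Hoeffding

variable {q : ℕ} {F : Type*} [NormedAddCommGroup F] [NormedSpace ℝ F]

/-- The first order projection `x ↦ E j(x - X)` of the kernel `j(x - y)`. -/
noncomputable def kernelProj (P : ProbabilityMeasure (Vec q)) (j : Vec q → F) (x : Vec q) : F :=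
  ∫ z, j (x - z) ∂(P : Measure (Vec q))

/-- The degenerate part of the kernel `j(x - y)`. -/
noncomputable def kernelRest (P : ProbabilityMeasure (Vec q)) (j : Vec q → F) (x y : Vec q) : F :=
  j (x - y) - kernelProj P j x - kernelProj P j y

variable {P : ProbabilityMeasure (Vec q)} {j : Vec q → F}

lemma measurable_kernelProj [MeasurableSpace F] [BorelSpace F] [SecondCountableTopology F]
    (hj : Measurable j) : Measurable (kernelProj P j) := by
  have h : StronglyMeasurable (Function.uncurry fun (x z : Vec q) => j (x - z)) :=
    (hj.comp (measurable_fst.sub measurable_snd)).stronglyMeasurable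
  exact (h.integral_prod_right (ν := (P : Measure (Vec q)))).measurable

lemma norm_kernelProj_le {K : ℝ} (hK : ∀ y, ‖j y‖ ≤ K) (x : Vec q) : ‖kernelProj P j x‖ ≤ K := by
  simpa [kernelProj] using norm_integral_le_of_norm_le_const (μ := (P : Measure (Vec q)))
    (f := fun z => j (x - z)) (ae_of_all _ fun z => hK _)

lemma measurable_kernelRest [MeasurableSpace F] [BorelSpace F] [SecondCountableTopology F]
    (hj : Measurable j) : Measurable (Function.uncurry (kernelRest P j)) := by
  have h := measurable_kernelProj (P := P) hj
  exact ((hj.comp (measurable_fst.sub measurable_snd)).sub (h.comp measurable_fst)).sub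
    (h.comp measurable_snd)

lemma measurable_kernelRest_comp [MeasurableSpace F] [BorelSpace F] [SecondCountableTopology F]
    (hj : Measurable j) (c e : ℕ) :
    Measurable fun x : ℕ → Vec q => kernelRest P j (x c) (x e) :=
  (measurable_kernelRest (P := P) hj).comp (f := fun x : ℕ → Vec q => (x c, x e))
    ((measurable_pi_apply c).prodMk (measurable_pi_apply e))

lemma norm_kernelRest_le {K : ℝ} (hK : ∀ y, ‖j y‖ ≤ K) (x y : Vec q) :
    ‖kernelRest P j x y‖ ≤ 3 * K := by
  have h1 := norm_sub_le (j (x - y) - kernelProj P j x) (kernelProj P j y)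
  have h2 := norm_sub_le (j (x - y)) (kernelProj P j x)
  have h3 := norm_kernelProj_le (P := P) hK x
  have h4 := norm_kernelProj_le (P := P) hK y
  have h5 := hK (x - y)
  unfold kernelRest
  linarith

lemma kernelRest_comm (hj : ∀ y, j (-y) = j y) (x y : Vec q) :
    kernelRest P j x y = kernelRest P j y x := by
  rw [kernelRest, kernelRest, ← hj (x - y), neg_sub]
  abel

/-- By Fubini the integral of the projection is the integral of j under the law of X₁ - X₂. -/
lemma integral_kernelProj_eq_zero [MeasurableSpace F] [BorelSpace F] [SecondCountableTopology F]
    (hj : Measurable j) {K : ℝ} (hK : ∀ y, ‖j y‖ ≤ K)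
    (h0 : ∫ y, j y ∂(symmetrized P : Measure (Vec q)) = 0) :
    ∫ x, kernelProj P j x ∂(P : Measure (Vec q)) = 0 := by
  have hm : Measurable fun p : Vec q × Vec q => p.1 - p.2 := measurable_fst.sub measurable_snd
  rw [symmetrized, ProbabilityMeasure.toMeasure_map, integral_map hm.aemeasurable
    hj.aestronglyMeasurable] at h0
  rw [ProbabilityMeasure.toMeasure_prod, integral_prod (fun p : Vec q × Vec q => j (p.1 - p.2))
    (Integrable.of_bound (hj.comp hm).aestronglyMeasurable K (ae_of_all _ fun _ => hK _))] at h0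
  exact h0

lemma integral_kernelRest_right [MeasurableSpace F] [BorelSpace F] [SecondCountableTopology F]
    [CompleteSpace F] (hj : Measurable j) {K : ℝ} (hK : ∀ y, ‖j y‖ ≤ K)
    (h0 : ∫ y, j y ∂(symmetrized P : Measure (Vec q)) = 0) (x : Vec q) :
    ∫ y, kernelRest P j x y ∂(P : Measure (Vec q)) = 0 := by
  have hi : Integrable (kernelProj P j) (P : Measure (Vec q)) :=
    Integrable.of_bound (measurable_kernelProj hj).aestronglyMeasurable K
      (ae_of_all _ fun _ => norm_kernelProj_le hK _)
  have hi2 : Integrable (fun y => j (x - y)) (P : Measure (Vec q)) :=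
    Integrable.of_bound (hj.comp (measurable_const.sub measurable_id)).aestronglyMeasurable K
      (ae_of_all _ fun _ => hK _)
  simp only [kernelRest]
  rw [integral_sub (f := fun y => j (x - y) - kernelProj P j x)
      (hi2.sub (integrable_const _)) hi, integral_kernelProj_eq_zero hj hK h0,
    integral_sub hi2 (integrable_const _), integral_const]
  simp [kernelProj]

/-- Projections commute with linear functionals, so that scalar estimates apply to the entries of
matrix kernels and, in the Cramér–Wold step, to arbitrary functionals. -/
lemma kernelProj_clm {F' : Type*} [NormedAddCommGroup F'] [NormedSpace ℝ F'] [CompleteSpace F]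
    [CompleteSpace F'] [MeasurableSpace F] [BorelSpace F] [SecondCountableTopology F]
    (hj : Measurable j) {K : ℝ} (hK : ∀ y, ‖j y‖ ≤ K) (L : F →L[ℝ] F') (x : Vec q) :
    kernelProj P (fun y => L (j y)) x = L (kernelProj P j x) :=
  L.integral_comp_comm (Integrable.of_bound
    (hj.comp (measurable_const.sub measurable_id)).aestronglyMeasurable K
      (ae_of_all _ fun _ => hK _))

lemma kernelRest_clm {F' : Type*} [NormedAddCommGroup F'] [NormedSpace ℝ F'] [CompleteSpace F]
    [CompleteSpace F'] [MeasurableSpace F] [BorelSpace F] [SecondCountableTopology F]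
    (hj : Measurable j) {K : ℝ} (hK : ∀ y, ‖j y‖ ≤ K) (L : F →L[ℝ] F') (x y : Vec q) :
    kernelRest P (fun y => L (j y)) x y = L (kernelRest P j x y) := by
  simp only [kernelRest, kernelProj_clm hj hK, map_sub]

/-- Hoeffding decomposition of the mean of `j` under a pairwise empirical distribution. -/
lemma integral_pairEmpirical_eq {G : Type} [NormedAddCommGroup G] [NormedSpace ℝ G]
    [CompleteSpace G] {j : Vec q → G}
    {ι : Type*} {n : ℕ} {s : Finset ι} {a b : ι → ℕ}
    (hD : IsBalancedDesign n s a b) (hj : ∀ y, j (-y) = j y) (x : ℕ → Vec q) :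
    ∫ y, j y ∂(pairEmpirical s a b x)
      = (2 : ℝ) • ((n : ℝ)⁻¹ • ∑ i ∈ Finset.range n, kernelProj P j (x i))
        + (s.card : ℝ)⁻¹ • ∑ i ∈ s, kernelRest P j (x (a i)) (x (b i)) := by
  have hn : (n : ℝ) ≠ 0 := Nat.cast_ne_zero.2 hD.pos.ne'
  have hs : (s.card : ℝ) ≠ 0 := by
    have := hD.le_card
    have := hD.pos
    exact Nat.cast_ne_zero.2 (by omega)
  rw [integral_pairEmpirical_of_even _ _ _ _ hj]
  -- Balance converts the sum of projections over pairs into a multiple of the plain sum over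
  -- observations, so the linear part does not depend on the design.
  have h := hD.balance fun i => kernelProj P j (x i)
  have h2 : ∀ i ∈ s, j (x (a i) - x (b i)) = (kernelProj P j (x (a i)) + kernelProj P j (x (b i)))
      + kernelRest P j (x (a i)) (x (b i)) := fun i _ => by
    rw [kernelRest]; abel
  rw [Finset.sum_congr rfl h2, Finset.sum_add_distrib, h, smul_add, smul_smul, smul_smul]
  congr 2
  field_simp

variable {ι : Type*} {n : ℕ} {s : Finset ι} {a b : ι → ℕ}

lemma integral_sum_kernelProj_sq_le {j : Vec q → ℝ} (hj : Measurable j) {K : ℝ}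
    (hK : ∀ y, |j y| ≤ K) (h0 : ∫ y, j y ∂(symmetrized P : Measure (Vec q)) = 0) (n : ℕ) :
    ∫ x, (∑ i ∈ Finset.range n, kernelProj P j (x i)) ^ 2
      ∂(Measure.infinitePi fun _ : ℕ => (P : Measure (Vec q))) ≤ n * K ^ 2 :=
  integral_sum_sq_le_of_centered (measurable_kernelProj hj) (fun x => norm_kernelProj_le (P := P) (j := j) hK x)
    (integral_kernelProj_eq_zero hj hK h0) n

lemma integral_sum_kernelRest_sq_le {j : Vec q → ℝ} (hj : Measurable j) {K : ℝ}
    (hK : ∀ y, |j y| ≤ K) (heven : ∀ y, j (-y) = j y)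
    (h0 : ∫ y, j y ∂(symmetrized P : Measure (Vec q)) = 0) (hD : IsBalancedDesign n s a b) :
    ∫ x, (∑ i ∈ s, kernelRest P j (x (a i)) (x (b i))) ^ 2
      ∂(Measure.infinitePi fun _ : ℕ => (P : Measure (Vec q))) ≤ s.card * (3 * K) ^ 2 :=
  integral_sum_pairs_sq_le (measurable_kernelRest hj) (fun x y => norm_kernelRest_le (P := P) (j := j) hK x y)
    (integral_kernelRest_right hj hK h0)
    (fun y => by simpa only [kernelRest_comm heven _ y] using integral_kernelRest_right hj hK h0 y)
    s hD.ne hD.injOn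

/-- Squaring a sum costs a factor 2. The linear part contributes 2·4·K²/n and the degenerate part
2·9·K² over the number of pairs, at most 36 K²/n because the number of pairs is at least n/2; hence
44. -/
lemma integral_integral_pairEmpirical_sq_le {j : Vec q → ℝ} (hj : Measurable j) {K : ℝ}
    (hK : ∀ y, |j y| ≤ K) (heven : ∀ y, j (-y) = j y)
    (h0 : ∫ y, j y ∂(symmetrized P : Measure (Vec q)) = 0) (hD : IsBalancedDesign n s a b) :
    ∫ x, (∫ y, j y ∂(pairEmpirical s a b x)) ^ 2
      ∂(Measure.infinitePi fun _ : ℕ => (P : Measure (Vec q))) ≤ 44 * K ^ 2 / n := by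
  have hn : (0 : ℝ) < n := Nat.cast_pos.2 hD.pos
  have hsn : (n : ℝ) ≤ 2 * s.card := by exact_mod_cast hD.le_card
  have hs : (0 : ℝ) < s.card := by linarith
  set ν := Measure.infinitePi fun _ : ℕ => (P : Measure (Vec q))
  set A : (ℕ → Vec q) → ℝ := fun x => ∑ i ∈ Finset.range n, kernelProj P j (x i) with hA
  set B : (ℕ → Vec q) → ℝ := fun x => ∑ i ∈ s, kernelRest P j (x (a i)) (x (b i)) with hB
  have hmA : Measurable A := Finset.measurable_sum _ fun i _ =>
    (measurable_kernelProj hj).comp (measurable_pi_apply i)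
  have hmB : Measurable B := Finset.measurable_sum _ fun i _ => measurable_kernelRest_comp hj _ _
  have hbA : ∀ x, ‖A x‖ ≤ n * K := fun x => by
    refine (norm_sum_le _ _).trans ?_
    refine (Finset.sum_le_sum fun i _ => norm_kernelProj_le (P := P) (j := j) hK (x i)).trans ?_
    simp
  have hbB : ∀ x, ‖B x‖ ≤ s.card * (3 * K) := fun x => by
    refine (norm_sum_le _ _).trans ?_
    refine (Finset.sum_le_sum fun i _ => norm_kernelRest_le (P := P) (j := j) hK _ _).trans ?_
    simp
  have hiA : Integrable (fun x => A x ^ 2) ν := Integrable.of_bound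
    (hmA.pow_const 2).aestronglyMeasurable ((n * K) ^ 2) (ae_of_all _ fun x => by
      rw [norm_pow]; exact pow_le_pow_left₀ (norm_nonneg _) (hbA x) 2)
  have hiB : Integrable (fun x => B x ^ 2) ν := Integrable.of_bound
    (hmB.pow_const 2).aestronglyMeasurable ((s.card * (3 * K)) ^ 2) (ae_of_all _ fun x => by
      rw [norm_pow]; exact pow_le_pow_left₀ (norm_nonneg _) (hbB x) 2)
  have h1 : ∫ x, A x ^ 2 ∂ν ≤ n * K ^ 2 := integral_sum_kernelProj_sq_le hj hK h0 n
  have h2 : ∫ x, B x ^ 2 ∂ν ≤ s.card * (3 * K) ^ 2 :=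
    integral_sum_kernelRest_sq_le hj hK heven h0 hD
  calc _ ≤ ∫ x, (8 * ((n : ℝ)⁻¹) ^ 2 * A x ^ 2 + 2 * ((s.card : ℝ)⁻¹) ^ 2 * B x ^ 2) ∂ν := by
        refine integral_mono_of_nonneg (ae_of_all _ fun _ => sq_nonneg _)
          ((hiA.const_mul _).add (hiB.const_mul _)) (ae_of_all _ fun x => ?_)
        have hx : ∫ y, j y ∂(pairEmpirical s a b x)
            = 2 * ((n : ℝ)⁻¹ * A x) + (s.card : ℝ)⁻¹ * B x := integral_pairEmpirical_eq hD heven x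
        simp only [hx]
        nlinarith [sq_nonneg (2 * ((n : ℝ)⁻¹ * A x) - (s.card : ℝ)⁻¹ * B x)]
    _ = 8 * ((n : ℝ)⁻¹) ^ 2 * ∫ x, A x ^ 2 ∂ν + 2 * ((s.card : ℝ)⁻¹) ^ 2 * ∫ x, B x ^ 2 ∂ν := by
        rw [integral_add (hiA.const_mul _) (hiB.const_mul _), integral_const_mul,
          integral_const_mul]
    _ ≤ 8 * ((n : ℝ)⁻¹) ^ 2 * (n * K ^ 2) + 2 * ((s.card : ℝ)⁻¹) ^ 2 * (s.card * (3 * K) ^ 2) := by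
        gcongr
    _ = 8 * K ^ 2 / n + 36 * K ^ 2 * (2 * (s.card : ℝ))⁻¹ := by
        field_simp
        ring
    _ ≤ 8 * K ^ 2 / n + 36 * K ^ 2 * (n : ℝ)⁻¹ := by gcongr
    _ = _ := by ring

end Hoeffding

/-! ### Second moments of matrix-valued statistics. -/

section MatrixMoment

variable {q : ℕ}

lemma frobenius_norm_sq (A : Mat q) : ‖A‖ ^ 2 = ∑ k, ∑ l, A k l ^ 2 := by
  rw [Matrix.frobenius_norm_def, ← Real.sqrt_eq_rpow, Real.sq_sqrt]
  · simp
  · positivity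

lemma abs_entry_le_norm (A : Mat q) (k l : Fin q) : |A k l| ≤ ‖A‖ := by
  rw [← abs_of_nonneg (norm_nonneg A), ← sq_le_sq, frobenius_norm_sq]
  exact (Finset.single_le_sum (f := fun l => A k l ^ 2) (fun _ _ => sq_nonneg _)
    (Finset.mem_univ l)).trans (Finset.single_le_sum (f := fun k => ∑ l, A k l ^ 2)
      (fun _ _ => Finset.sum_nonneg fun _ _ => sq_nonneg _) (Finset.mem_univ k))

/-- The entry of a matrix as a continuous linear functional. -/
noncomputable def entryCLM (k l : Fin q) : Mat q →L[ℝ] ℝ :=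
  LinearMap.toContinuousLinearMap (Matrix.entryLinearMap ℝ ℝ k l)

@[simp]
lemma entryCLM_apply (k l : Fin q) (A : Mat q) : entryCLM k l A = A k l := rfl

lemma measurable_entry (k l : Fin q) : Measurable fun A : Mat q => A k l :=
  (entryCLM k l).continuous.measurable

/-- The squared Frobenius norm is the sum over the q² entries, which reduces matrix bounds to scalar
ones. -/
lemma integral_norm_sq_le {Ω : Type*} [MeasurableSpace Ω] {ν : Measure Ω} [IsProbabilityMeasure ν]
    {Z : Ω → Mat q} (hZ : Measurable Z) {C : ℝ} (hC : ∀ x, ‖Z x‖ ≤ C) {c : ℝ}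
    (h : ∀ k l, ∫ x, Z x k l ^ 2 ∂ν ≤ c) : ∫ x, ‖Z x‖ ^ 2 ∂ν ≤ q ^ 2 * c := by
  have hi : ∀ k l, Integrable (fun x => Z x k l ^ 2) ν := fun k l => by
    refine Integrable.of_bound (((measurable_entry k l).comp hZ).pow_const 2).aestronglyMeasurable
      (C ^ 2) (ae_of_all _ fun x => ?_)
    rw [norm_pow]
    exact pow_le_pow_left₀ (norm_nonneg _) ((abs_entry_le_norm _ k l).trans (hC x)) 2
  simp only [frobenius_norm_sq]
  rw [integral_finsetSum _ fun k _ => integrable_finsetSum _ fun l _ => hi k l]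
  calc _ ≤ ∑ k : Fin q, ∑ l : Fin q, c := by
        refine Finset.sum_le_sum fun k _ => ?_
        rw [integral_finsetSum _ fun l _ => hi k l]
        exact Finset.sum_le_sum fun l _ => h k l
    _ = _ := by simp; ring

variable {P : ProbabilityMeasure (Vec q)} {J : Vec q → Mat q} {K : ℝ}
  {ι : Type*} {n : ℕ} {s : Finset ι} {a b : ι → ℕ}

lemma integral_entry (hJ : Measurable J) (hK : ∀ y, ‖J y‖ ≤ K) (m : Measure (Vec q))
    [IsFiniteMeasure m] (k l : Fin q) : (∫ y, J y ∂m) k l = ∫ y, J y k l ∂m :=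
  ((entryCLM k l).integral_comp_comm (Integrable.of_bound hJ.aestronglyMeasurable K
    (ae_of_all _ hK))).symm

lemma integral_norm_integral_pairEmpirical_sq_le (hJ : Measurable J) (hK : ∀ y, ‖J y‖ ≤ K)
    (heven : ∀ y, J (-y) = J y) (h0 : ∫ y, J y ∂(symmetrized P : Measure (Vec q)) = 0)
    (hD : IsBalancedDesign n s a b) :
    ∫ x, ‖∫ y, J y ∂(pairEmpirical s a b x)‖ ^ 2
      ∂(Measure.infinitePi fun _ : ℕ => (P : Measure (Vec q))) ≤ q ^ 2 * (44 * K ^ 2 / n) := by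
  have hs : s.Nonempty := by
    have := hD.le_card
    have := hD.pos
    exact Finset.card_pos.1 (by omega)
  have hp := isProbabilityMeasure_pairEmpirical (q := q) hs a b
  refine integral_norm_sq_le (measurable_integral_pairEmpirical s a b hJ) (C := K) (fun x => ?_)
    fun k l => ?_
  · have := hp x
    simpa using norm_integral_le_of_norm_le_const (μ := pairEmpirical s a b x) (ae_of_all _ hK)
  · have h := integral_integral_pairEmpirical_sq_le (P := P) (j := fun y => J y k l)
      ((measurable_entry k l).comp hJ) (fun y => (abs_entry_le_norm _ k l).trans (hK y))
      (fun y => by rw [heven]) (by rw [← integral_entry hJ hK, h0]; rfl) hD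
    refine le_trans (le_of_eq ?_) h
    congr 1
    funext x
    have := hp x
    rw [integral_entry hJ hK]

lemma integral_norm_sum_kernelRest_sq_le (hJ : Measurable J) (hK : ∀ y, ‖J y‖ ≤ K)
    (heven : ∀ y, J (-y) = J y) (h0 : ∫ y, J y ∂(symmetrized P : Measure (Vec q)) = 0)
    (hD : IsBalancedDesign n s a b) :
    ∫ x, ‖∑ i ∈ s, kernelRest P J (x (a i)) (x (b i))‖ ^ 2
      ∂(Measure.infinitePi fun _ : ℕ => (P : Measure (Vec q)))
      ≤ q ^ 2 * (s.card * (3 * K) ^ 2) := by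
  refine integral_norm_sq_le (C := s.card * (3 * K)) ?_ (fun x => ?_) fun k l => ?_
  · exact Finset.measurable_sum _ fun i _ => measurable_kernelRest_comp hJ _ _
  · refine (norm_sum_le _ _).trans ?_
    refine (Finset.sum_le_sum fun i _ => norm_kernelRest_le (P := P) (j := J) hK _ _).trans ?_
    simp
  · have h := integral_sum_kernelRest_sq_le (P := P) (j := fun y => J y k l)
      ((measurable_entry k l).comp hJ) (fun y => (abs_entry_le_norm _ k l).trans (hK y))
      (fun y => by rw [heven]) (by rw [← integral_entry hJ hK, h0]; rfl) hD
    refine le_trans (le_of_eq ?_) h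
    congr 1
    funext x
    congr 1
    rw [Matrix.sum_apply]
    refine Finset.sum_congr rfl fun i _ => ?_
    exact (kernelRest_clm hJ hK (entryCLM k l) _ _).symm

end MatrixMoment

/-! ### Linear expansion of the functional at pairwise empirical distributions. -/

section PairAsymptotics

variable {q : ℕ}

/-- Exchanging the two independent observations changes the sign of their difference but not its
law. -/
lemma integral_neg_symmetrized (P : ProbabilityMeasure (Vec q)) {f : Vec q → ℝ}
    (hf : Measurable f) : ∫ y, f (-y) ∂(symmetrized P : Measure (Vec q))
      = ∫ y, f y ∂(symmetrized P : Measure (Vec q)) := by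
  have hm : Measurable fun p : Vec q × Vec q => p.1 - p.2 := measurable_fst.sub measurable_snd
  rw [symmetrized, ProbabilityMeasure.toMeasure_map, integral_map hm.aemeasurable
    hf.aestronglyMeasurable, integral_map hm.aemeasurable
    (f := fun y => f (-y)) (hf.comp measurable_neg).aestronglyMeasurable,
    ProbabilityMeasure.toMeasure_prod, ← integral_prod_swap]
  simp

open Classical in
/-- A measure regarded as a probability measure, with a default value if it is none. -/
noncomputable def toProb (m : Measure (Vec q)) : ProbabilityMeasure (Vec q) :=
  if h : IsProbabilityMeasure m then ⟨m, h⟩ else ⟨Measure.dirac 0, inferInstance⟩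

lemma toProb_of_isProbabilityMeasure (m : Measure (Vec q)) [h : IsProbabilityMeasure m] :
    toProb m = ⟨m, h⟩ := dif_pos h

lemma coe_toProb (m : Measure (Vec q)) [IsProbabilityMeasure m] :
    (toProb m : Measure (Vec q)) = m := by
  rw [toProb_of_isProbabilityMeasure]; rfl

lemma isDefinedAt_iff_toProb_mem (S : ScatterFunctional q) (m : Measure (Vec q))
    [h : IsProbabilityMeasure m] : S.IsDefinedAt m ↔ toProb m ∈ S.domain := by
  rw [toProb_of_isProbabilityMeasure]
  exact ⟨fun ⟨_, h'⟩ => h', fun h' => ⟨h, h'⟩⟩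

lemma eval_eq_toFun_toProb {S : ScatterFunctional q} {m : Measure (Vec q)}
    (h : S.IsDefinedAt m) : S.eval m = S.toFun (toProb m) := by
  have := h.1
  rw [ScatterFunctional.eval, dif_pos h, toProb_of_isProbabilityMeasure]

variable {Ω : Type*} [MeasurableSpace Ω] {μ : Measure Ω} [IsProbabilityMeasure μ]
  {P : ProbabilityMeasure (Vec q)} {X : ℕ → Ω → Vec q}

omit [IsProbabilityMeasure μ] in
lemma hasLaw_sequence (hX : ∀ i, HasLaw (X i) (P : Measure (Vec q)) μ) (hind : iIndepFun X μ) :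
    HasLaw (fun ω i => X i ω) (Measure.infinitePi fun _ : ℕ => (P : Measure (Vec q))) μ :=
  hind.hasLaw_infinitePi hX (aemeasurable_pi_iff.2 fun i => (hX i).aemeasurable)

omit [IsProbabilityMeasure μ] in
lemma integral_comp_sequence (hX : ∀ i, HasLaw (X i) (P : Measure (Vec q)) μ)
    (hind : iIndepFun X μ) {F : Type*} [NormedAddCommGroup F] [NormedSpace ℝ F]
    {g : (ℕ → Vec q) → F}
    (hg : AEStronglyMeasurable g (Measure.infinitePi fun _ : ℕ => (P : Measure (Vec q)))) :
    ∫ ω, g (X · ω) ∂μ = ∫ x, g x ∂(Measure.infinitePi fun _ : ℕ => (P : Measure (Vec q))) :=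
  (hasLaw_sequence hX hind).integral_comp hg

lemma hasLaw_sub (hX : ∀ i, HasLaw (X i) (P : Measure (Vec q)) μ) (hind : iIndepFun X μ) {a b : ℕ}
    (hab : a ≠ b) : HasLaw (fun ω => X a ω - X b ω) (symmetrized P : Measure (Vec q)) μ := by
  have hm : Measurable fun p : Vec q × Vec q => p.1 - p.2 := measurable_fst.sub measurable_snd
  refine ⟨((hX a).aemeasurable.sub (hX b).aemeasurable), ?_⟩
  have h := (hind.indepFun hab).map_prod_eq_prod_map_map (hX a).aemeasurable (hX b).aemeasurable
  rw [(hX a).map_eq, (hX b).map_eq] at h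
  rw [symmetrized, ProbabilityMeasure.toMeasure_map, ProbabilityMeasure.toMeasure_prod, ← h,
    AEMeasurable.map_map_of_aemeasurable hm.aemeasurable
      ((hX a).aemeasurable.prodMk (hX b).aemeasurable)]
  rfl

variable {ι : Type*} {s : ℕ → Finset ι} {a b : ℕ → ι → ℕ}

lemma IsBalancedDesign.nonempty {n : ℕ} {s : Finset ι} {a b : ι → ℕ}
    (hD : IsBalancedDesign n s a b) : s.Nonempty := by
  have := hD.le_card
  have := hD.pos
  exact Finset.card_pos.1 (by omega)

/-- Weak convergence along a filter may be tested on one bounded continuous function at a time, so a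
second moment bound of order 1/n for each of them suffices. -/
lemma tendsto_toProb_pairEmpirical (hX : ∀ i, HasLaw (X i) (P : Measure (Vec q)) μ)
    (hind : iIndepFun X μ) (hD : ∀ᶠ n in atTop, IsBalancedDesign n (s n) (a n) (b n)) :
    Tendsto (fun p : ℕ × Ω => toProb (pairEmpirical (s p.1) (a p.1) (b p.1) (X · p.2)))
      (probFilter μ) (𝓝 (symmetrized P)) := by
  rw [ProbabilityMeasure.tendsto_iff_forall_integral_tendsto]
  intro f
  set m := ∫ y, f y ∂(symmetrized P : Measure (Vec q)) with hm
  -- Symmetrizing f does not change its integral against symmetrized Dirac measures; after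
  -- centering, j is an even kernel of mean zero.
  let j : Vec q → ℝ := fun y => (2 : ℝ)⁻¹ * (f y + f (-y)) - m
  have hf : Measurable f := f.continuous.measurable
  have hfb : ∀ y, |f y| ≤ ‖f‖ := fun y => f.norm_coe_le_norm y
  have hj : Measurable j := ((hf.add (hf.comp measurable_neg)).const_mul _).sub_const _
  have hjb : ∀ y, |j y| ≤ ‖f‖ + |m| := fun y => by
    have h1 := hfb y
    have h2 := hfb (-y)
    have h3 := abs_sub ((2 : ℝ)⁻¹ * (f y + f (-y))) m
    have h4 := abs_add_le (f y) (f (-y))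
    rw [abs_mul, abs_of_pos (by norm_num : (0 : ℝ) < 2⁻¹)] at h3
    simp only [j]
    linarith
  have hje : ∀ y, j (-y) = j y := fun y => by simp only [j, neg_neg, add_comm]
  have hfi : Integrable (fun y => f y) (symmetrized P : Measure (Vec q)) :=
    Integrable.of_bound hf.aestronglyMeasurable ‖f‖ (ae_of_all _ hfb)
  have hfi' : Integrable (fun y => f (-y)) (symmetrized P : Measure (Vec q)) :=
    Integrable.of_bound (hf.comp measurable_neg).aestronglyMeasurable ‖f‖
      (ae_of_all _ fun y => hfb _)
  have hj0 : ∫ y, j y ∂(symmetrized P : Measure (Vec q)) = 0 := by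
    simp only [j]
    rw [integral_sub (f := fun y => (2 : ℝ)⁻¹ * (f y + f (-y))) ((hfi.add hfi').const_mul _)
      (integrable_const _), integral_const_mul,
      integral_add hfi hfi', integral_neg_symmetrized P hf, ← hm]
    simp
    ring
  have hlaw := hasLaw_sequence hX hind
  have hmeas : ∀ n, Measurable fun x : ℕ → Vec q => ∫ y, j y ∂(pairEmpirical (s n) (a n) (b n) x) :=
    fun n => measurable_integral_pairEmpirical _ _ _ hj
  have key : Tendsto (fun p : ℕ × Ω =>
      ∫ y, j y ∂(pairEmpirical (s p.1) (a p.1) (b p.1) (X · p.2))) (probFilter μ) (𝓝 0) := by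
    refine tendsto_probFilter_of_integral_sq
      (Z := fun n ω => ∫ y, j y ∂(pairEmpirical (s n) (a n) (b n) (X · ω)))
      (c := fun n => 44 * (‖f‖ + |m|) ^ 2 / n) ?_ ?_
      (tendsto_const_nhds.div_atTop tendsto_natCast_atTop_atTop)
    · filter_upwards [hD] with n hn
      refine Integrable.of_bound (((hmeas n).comp_aemeasurable hlaw.aemeasurable).pow_const
        2).aestronglyMeasurable ((‖f‖ + |m|) ^ 2) (ae_of_all _ fun ω => ?_)
      rw [norm_pow]
      refine pow_le_pow_left₀ (norm_nonneg _) ?_ 2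
      have := isProbabilityMeasure_pairEmpirical hn.nonempty (a n) (b n) (X · ω)
      simpa using norm_integral_le_of_norm_le_const
        (μ := pairEmpirical (s n) (a n) (b n) (X · ω)) (f := j) (ae_of_all _ hjb)
    · filter_upwards [hD] with n hn
      refine (integral_comp_sequence hX hind (g := fun x =>
        (∫ y, j y ∂(pairEmpirical (s n) (a n) (b n) x)) ^ 2)
        ((hmeas n).pow_const 2).aestronglyMeasurable).trans_le ?_
      exact integral_integral_pairEmpirical_sq_le hj hjb hje hj0 hn
  have key2 := key.add_const m
  rw [zero_add] at key2
  refine key2.congr' ?_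
  filter_upwards [eventually_probFilter_of_eventually hD] with p hp
  have hpr := isProbabilityMeasure_pairEmpirical hp.nonempty (a p.1) (b p.1) (X · p.2)
  have hne : ((s p.1).card : ℝ) ≠ 0 := by
    exact_mod_cast (Finset.card_pos.2 hp.nonempty).ne'
  rw [coe_toProb, integral_pairEmpirical_of_even _ _ _ _ hje, integral_pairEmpirical]
  simp only [j, smul_eq_mul]
  rw [Finset.sum_sub_distrib, Finset.sum_const, nsmul_eq_mul, mul_sub]
  field_simp
  rw [sub_add_cancel]
  congr 1
  funext i
  rw [neg_sub, neg_sub, add_comm]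

/-- The hypothesis on the domain has a proviso about atoms at zero in order to cover Tyler's
functional. If Q{0} = 0, the finitely many differences are almost surely nonzero, so the empirical
distribution meets the proviso. -/
lemma eventually_isDefinedAt_pairEmpirical {S : ScatterFunctional q}
    (hX : ∀ i, HasLaw (X i) (P : Measure (Vec q)) μ)
    (hind : iIndepFun X μ) (hD : ∀ᶠ n in atTop, IsBalancedDesign n (s n) (a n) (b n))
    (hdom : ∀ᶠ R : ProbabilityMeasure (Vec q) in 𝓝 (symmetrized P), ((symmetrized P : Measure (Vec q)) {0} = 0 →
      (R : Measure (Vec q)) {0} = 0) → R ∈ S.domain) :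
    ∀ᶠ p in probFilter μ, S.IsDefinedAt (pairEmpirical (s p.1) (a p.1) (b p.1) (X · p.2)) := by
  have h0 : ∀ᶠ p in probFilter μ, (symmetrized P : Measure (Vec q)) {0} = 0 →
      (pairEmpirical (s p.1) (a p.1) (b p.1) (X · p.2)) {0} = 0 := by
    refine eventually_probFilter_of_ae
      (p := fun p : ℕ × Ω => (symmetrized P : Measure (Vec q)) {0} = 0 →
        (pairEmpirical (s p.1) (a p.1) (b p.1) (X · p.2)) {0} = 0) ?_
    filter_upwards [hD] with n hn
    have h1 : ∀ i ∈ s n, ∀ᵐ ω ∂μ, (symmetrized P : Measure (Vec q)) {0} = 0 →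
        X (b n i) ω - X (a n i) ω ≠ 0 := by
      intro i hi
      by_cases hQ : (symmetrized P : Measure (Vec q)) {0} = 0
      · have hl := hasLaw_sub hX hind (hn.ne i hi).symm
        have h2 : ∀ᵐ y ∂(symmetrized P : Measure (Vec q)), y ≠ 0 := by
          rw [ae_iff]; simpa using hQ
        filter_upwards [(hl.ae_iff (p := fun y => y ≠ 0)
          (measurableSet_singleton (0 : Vec q)).compl.mem).2 h2] with ω hω _ using hω
      · exact ae_of_all _ fun ω h => absurd h hQ
    rw [← Filter.eventually_all_finset] at h1
    filter_upwards [h1] with ω hω hQ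
    simp only [pairEmpirical, Measure.smul_apply, Measure.finsetSum_apply, smul_eq_mul]
    rw [Finset.sum_eq_zero, mul_zero]
    intro i hi
    have hne := hω i hi hQ
    have hne' : -(X (b n i) ω - X (a n i) ω) ≠ 0 := neg_ne_zero.2 hne
    simp only [symDirac, Measure.smul_apply, Measure.add_apply, Measure.dirac_apply, smul_eq_mul]
    rw [Set.indicator_of_notMem (by simpa using hne), Set.indicator_of_notMem (by simpa using hne')]
    simp
  filter_upwards [h0, (tendsto_toProb_pairEmpirical hX hind hD).eventually hdom,
    eventually_probFilter_of_eventually hD] with p h1 h2 h3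
  have := isProbabilityMeasure_pairEmpirical h3.nonempty (a p.1) (b p.1) (X · p.2)
  rw [isDefinedAt_iff_toProb_mem]
  refine h2 fun h => ?_
  rw [coe_toProb]
  exact h1 h

/-- The remainder is o(‖∫ J dR̂‖) along the filter by composition with weak convergence, and √n ∫ J
dR̂ is bounded in probability by its second moment. -/
lemma tendsto_sqrt_smul_eval_sub {S : ScatterFunctional q} {J : Vec q → Mat q}
    (hX : ∀ i, HasLaw (X i) (P : Measure (Vec q)) μ)
    (hind : iIndepFun X μ) (hD : ∀ᶠ n in atTop, IsBalancedDesign n (s n) (a n) (b n))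
    (hdom : ∀ᶠ R : ProbabilityMeasure (Vec q) in 𝓝 (symmetrized P), ((symmetrized P : Measure (Vec q)) {0} = 0 →
      (R : Measure (Vec q)) {0} = 0) → R ∈ S.domain)
    (hJ : S.IsInfluenceFunction (symmetrized P) J) :
    Tendsto (fun p : ℕ × Ω => √(p.1 : ℝ) •
      (S.eval (pairEmpirical (s p.1) (a p.1) (b p.1) (X · p.2)) - S.toFun (symmetrized P)
        - ∫ y, J y ∂(pairEmpirical (s p.1) (a p.1) (b p.1) (X · p.2))))
      (probFilter μ) (𝓝 0) := by
  obtain ⟨K, hK⟩ := hJ.bounded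
  have hlaw := hasLaw_sequence hX hind
  have hdef := eventually_isDefinedAt_pairEmpirical (S := S) hX hind hD hdom
  have hpr : ∀ᶠ p in probFilter μ,
      IsProbabilityMeasure (pairEmpirical (s p.1) (a p.1) (b p.1) (X · p.2)) :=
    hdef.mono fun p hp => hp.1
  have ht : Tendsto (fun p : ℕ × Ω => toProb (pairEmpirical (s p.1) (a p.1) (b p.1) (X · p.2)))
      (probFilter μ) (𝓝[S.domain] (symmetrized P)) := by
    refine tendsto_nhdsWithin_iff.2 ⟨tendsto_toProb_pairEmpirical hX hind hD, ?_⟩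
    filter_upwards [hdef, hpr] with p hp hp'
    rwa [← isDefinedAt_iff_toProb_mem]
  have hlo := hJ.expansion.comp_tendsto ht
  have hlo2 : (fun p : ℕ × Ω =>
      S.eval (pairEmpirical (s p.1) (a p.1) (b p.1) (X · p.2)) - S.toFun (symmetrized P)
        - ∫ y, J y ∂(pairEmpirical (s p.1) (a p.1) (b p.1) (X · p.2))) =o[probFilter μ]
      fun p : ℕ × Ω => ∫ y, J y ∂(pairEmpirical (s p.1) (a p.1) (b p.1) (X · p.2)) := by
    refine hlo.congr' ?_ ?_
    · filter_upwards [hdef, hpr] with p hp hp'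
      simp only [Function.comp_def]
      rw [coe_toProb, eval_eq_toFun_toProb hp]
    · filter_upwards [hpr] with p hp'
      simp only [Function.comp_def]
      rw [coe_toProb]
  refine tendsto_smul_of_isLittleO_probFilter (b := fun n => √(n : ℝ))
    (R := fun n ω => S.eval (pairEmpirical (s n) (a n) (b n) (X · ω)) - S.toFun (symmetrized P)
        - ∫ y, J y ∂(pairEmpirical (s n) (a n) (b n) (X · ω)))
    (I := fun n ω => ∫ y, J y ∂(pairEmpirical (s n) (a n) (b n) (X · ω)))
    (C := q ^ 2 * (44 * K ^ 2)) hlo2 fun κ hκ => ?_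
  filter_upwards [hD] with n hn
  have hn0 : (0 : ℝ) < n := Nat.cast_pos.2 hn.pos
  have hmeas : Measurable fun x : ℕ → Vec q => ∫ y, J y ∂(pairEmpirical (s n) (a n) (b n) x) :=
    measurable_integral_pairEmpirical _ _ _ hJ.measurable
  have hi : Integrable (fun ω => (√(n : ℝ) *
      ‖∫ y, J y ∂(pairEmpirical (s n) (a n) (b n) (X · ω))‖) ^ 2) μ := by
    refine Integrable.of_bound (((hmeas.comp_aemeasurable hlaw.aemeasurable).norm.const_mul
      _).pow_const 2).aestronglyMeasurable ((√(n : ℝ) * K) ^ 2) (ae_of_all _ fun ω => ?_)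
    rw [norm_pow, norm_mul, norm_norm, Real.norm_of_nonneg (Real.sqrt_nonneg _)]
    have := isProbabilityMeasure_pairEmpirical hn.nonempty (a n) (b n) (X · ω)
    gcongr
    simpa using norm_integral_le_of_norm_le_const
      (μ := pairEmpirical (s n) (a n) (b n) (X · ω)) (ae_of_all _ hK)
  have hc : ∫ ω, (√(n : ℝ) *
      ‖∫ y, J y ∂(pairEmpirical (s n) (a n) (b n) (X · ω))‖) ^ 2 ∂μ ≤ q ^ 2 * (44 * K ^ 2) := by
    simp only [mul_pow, Real.sq_sqrt hn0.le]
    rw [integral_const_mul]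
    have h1 := integral_comp_sequence hX hind
      (g := fun x => ‖∫ y, J y ∂(pairEmpirical (s n) (a n) (b n) x)‖ ^ 2)
        (hmeas.norm.pow_const 2).aestronglyMeasurable
    rw [h1]
    calc _ ≤ n * (q ^ 2 * (44 * K ^ 2 / n)) := by
          gcongr
          exact integral_norm_integral_pairEmpirical_sq_le hJ.measurable hK hJ.even
            hJ.integral_eq_zero hn
      _ = _ := by field_simp
  have := measure_norm_ge_le_of_integral_sq_le hi hc hκ
  simpa [norm_smul, abs_of_nonneg (Real.sqrt_nonneg _)] using this

/-- The second moment of the degenerate mean is of order one over the number of pairs, so after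
scaling by √n it is of order n divided by that number. -/
lemma tendsto_sqrt_smul_rest {J : Vec q → Mat q} {K : ℝ}
    (hX : ∀ i, HasLaw (X i) (P : Measure (Vec q)) μ)
    (hind : iIndepFun X μ) (hD : ∀ᶠ n in atTop, IsBalancedDesign n (s n) (a n) (b n))
    (hJ : Measurable J) (hK : ∀ y, ‖J y‖ ≤ K)
    (heven : ∀ y, J (-y) = J y) (h0 : ∫ y, J y ∂(symmetrized P : Measure (Vec q)) = 0)
    (hlarge : Tendsto (fun n : ℕ => (n : ℝ) / (s n).card) atTop (𝓝 0)) :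
    Tendsto (fun p : ℕ × Ω => √(p.1 : ℝ) • (((s p.1).card : ℝ)⁻¹ •
      ∑ i ∈ s p.1, kernelRest P J (X (a p.1 i) p.2) (X (b p.1 i) p.2)))
      (probFilter μ) (𝓝 0) := by
  have hlaw := hasLaw_sequence hX hind
  rw [tendsto_zero_iff_norm_tendsto_zero]
  have hmeas : ∀ n, Measurable fun x : ℕ → Vec q =>
      ∑ i ∈ s n, kernelRest P J (x (a n i)) (x (b n i)) := fun n =>
    Finset.measurable_sum _ fun i _ => measurable_kernelRest_comp hJ _ _
  simp only [norm_smul, norm_inv, RCLike.norm_natCast, Real.norm_of_nonneg (Real.sqrt_nonneg _)]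
  refine tendsto_probFilter_of_integral_sq (Z := fun n ω => √(n : ℝ) * (((s n).card : ℝ)⁻¹ *
      ‖∑ i ∈ s n, kernelRest P J (X (a n i) ω) (X (b n i) ω)‖))
      (c := fun n => (n : ℝ) / (s n).card * (q ^ 2 * (3 * K) ^ 2)) ?_ ?_ ?_
  · refine Eventually.of_forall fun n => ?_
    have hm1 : AEMeasurable (fun ω => ∑ i ∈ s n, kernelRest P J (X (a n i) ω) (X (b n i) ω)) μ := by
      have h := (hmeas n).comp_aemeasurable hlaw.aemeasurable
      simpa only [Function.comp_def] using h
    refine Integrable.of_bound (((hm1.norm.const_mul _).const_mul _).pow_const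
      2).aestronglyMeasurable
      ((√(n : ℝ) * (((s n).card : ℝ)⁻¹ * ((s n).card * (3 * K)))) ^ 2) (ae_of_all _ fun ω => ?_)
    rw [norm_pow, norm_mul, norm_mul, norm_norm, norm_inv, RCLike.norm_natCast,
      Real.norm_of_nonneg (Real.sqrt_nonneg _)]
    gcongr
    refine (norm_sum_le _ _).trans ?_
    refine (Finset.sum_le_sum fun i _ => norm_kernelRest_le (P := P) (j := J) hK _ _).trans ?_
    simp
  · filter_upwards [hD] with n hn
    have hn0 : (0 : ℝ) < n := Nat.cast_pos.2 hn.pos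
    have hs0 : (0 : ℝ) < (s n).card := Nat.cast_pos.2 (Finset.card_pos.2 hn.nonempty)
    simp only [mul_pow, Real.sq_sqrt hn0.le]
    have h1 := integral_comp_sequence hX hind
      (g := fun x => ‖∑ i ∈ s n, kernelRest P J (x (a n i)) (x (b n i))‖ ^ 2)
        ((hmeas n).norm.pow_const 2).aestronglyMeasurable
    rw [integral_const_mul, integral_const_mul, h1]
    calc _ ≤ n * (((s n).card : ℝ)⁻¹ ^ 2 * (q ^ 2 * ((s n).card * (3 * K) ^ 2))) := by
          gcongr
          exact integral_norm_sum_kernelRest_sq_le hJ hK heven h0 hn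
      _ = _ := by field_simp
  · simpa using hlarge.mul_const _

end PairAsymptotics

/-! ### Scalar limit theorem for a linear plus a cyclic quadratic part. -/

section CyclicCLT

variable {E : Type*} [MeasurableSpace E] {P : Measure E} [IsProbabilityMeasure P]

lemma integral_sum_sq_eq {Ω : Type*} [MeasurableSpace Ω] {ν : Measure Ω} [IsFiniteMeasure ν]
    {ι : Type*} (s : Finset ι) {f : ι → Ω → ℝ} {K : ℝ}
    (hf : ∀ i ∈ s, Measurable (f i)) (hK : ∀ i ∈ s, ∀ x, |f i x| ≤ K)
    (h : ∀ i ∈ s, ∀ j ∈ s, i ≠ j → ∫ x, f i x * f j x ∂ν = 0) :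
    ∫ x, (∑ i ∈ s, f i x) ^ 2 ∂ν = ∑ i ∈ s, ∫ x, f i x ^ 2 ∂ν := by
  have hi : ∀ i ∈ s, ∀ j ∈ s, Integrable (fun x => f i x * f j x) ν := fun i hi j hj => by
    refine Integrable.of_bound ((hf i hi).mul (hf j hj)).aestronglyMeasurable (K * K)
      (ae_of_all _ fun x => ?_)
    rw [norm_mul]
    exact mul_le_mul (hK i hi x) (hK j hj x) (norm_nonneg _) ((abs_nonneg _).trans (hK i hi x))
  simp only [sq, Finset.sum_mul_sum]
  rw [integral_finsetSum _ fun i h' => integrable_finsetSum _ fun j hj => hi i h' j hj]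
  refine Finset.sum_congr rfl fun i h' => ?_
  rw [integral_finsetSum _ fun j hj => hi i h' j hj]
  exact Finset.sum_eq_single_of_mem i h' fun j hj hij => h i h' j hj hij.symm

variable {h₁ : E → ℝ} {h₂ : E → E → ℝ} {K : ℝ}

/-- The function of `d + 1` consecutive observations whose moving sum is the linear combination of
the linear and the cyclic quadratic part. -/
noncomputable def cyclicKernel (h₁ : E → ℝ) (h₂ : E → E → ℝ) (d : ℕ) (y : Fin (d + 1) → E) : ℝ :=
  h₁ (y 0) + (√(d : ℝ))⁻¹ * ∑ k : Fin d, h₂ (y 0) (y k.succ)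

omit [MeasurableSpace E] in
lemma windowFun_cyclicKernel (d i : ℕ) (x : ℕ → E) :
    windowFun (cyclicKernel h₁ h₂ d) i x
      = h₁ (x i) + (√(d : ℝ))⁻¹ * ∑ k ∈ Finset.Icc 1 d, h₂ (x i) (x (i + k)) := by
  have h : ∑ k ∈ Finset.Icc 1 d, h₂ (x i) (x (i + k))
      = ∑ k : Fin d, h₂ (x i) (x (i + (k + 1))) := by
    rw [Fin.sum_univ_eq_sum_range (fun k => h₂ (x i) (x (i + (k + 1)))) d,
      Finset.range_eq_Ico, Finset.sum_Ico_add' (fun k => h₂ (x i) (x (i + k)))]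
    rfl
  rw [h]
  simp [windowFun, cyclicKernel]

lemma measurable_comp_pair (hm₂ : Measurable (Function.uncurry h₂)) {X : Type*} [MeasurableSpace X]
    {f g : X → E} (hf : Measurable f) (hg : Measurable g) : Measurable fun x => h₂ (f x) (g x) :=
  hm₂.comp (f := fun x => (f x, g x)) (hf.prodMk hg)

lemma measurable_cyclicKernel (hm₁ : Measurable h₁) (hm₂ : Measurable (Function.uncurry h₂))
    (d : ℕ) : Measurable (cyclicKernel h₁ h₂ d) :=
  (hm₁.comp (measurable_pi_apply 0)).add ((Finset.measurable_sum _ fun k _ =>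
    measurable_comp_pair hm₂ (measurable_pi_apply 0) (measurable_pi_apply k.succ)).const_mul _)

omit [MeasurableSpace E] in
lemma abs_cyclicKernel_le (hK₁ : ∀ x, |h₁ x| ≤ K) (hK₂ : ∀ x y, |h₂ x y| ≤ K) (d : ℕ)
    (y : Fin (d + 1) → E) : |cyclicKernel h₁ h₂ d y| ≤ K + (√(d : ℝ))⁻¹ * (d * K) := by
  refine (abs_add_le _ _).trans (add_le_add (hK₁ _) ?_)
  rw [abs_mul, abs_of_nonneg (inv_nonneg.2 (Real.sqrt_nonneg _))]
  gcongr
  refine (Finset.abs_sum_le_sum_abs _ _).trans ((Finset.sum_le_sum fun k _ => hK₂ _ _).trans ?_)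
  simp

/-- The first variable of the window occurs in every summand, so integrating it out kills h₁ by
centering and each h₂ by degeneracy. This is the reverse martingale property. -/
lemma integral_cyclicKernel_update (hm₁ : Measurable h₁) (hm₂ : Measurable (Function.uncurry h₂))
    (hK₁ : ∀ x, |h₁ x| ≤ K) (hK₂ : ∀ x y, |h₂ x y| ≤ K) (h0 : ∫ x, h₁ x ∂P = 0)
    (hl : ∀ y, ∫ x, h₂ x y ∂P = 0) (d : ℕ) (y : Fin (d + 1) → E) :
    ∫ v, cyclicKernel h₁ h₂ d (Function.update y 0 v) ∂P = 0 := by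
  have hi : ∀ z, Integrable (fun v => h₂ v z) P := fun z => Integrable.of_bound
    (measurable_comp_pair hm₂ measurable_id measurable_const).aestronglyMeasurable K
    (ae_of_all _ fun v => hK₂ v z)
  simp only [cyclicKernel, Function.update_self, ne_eq, Fin.succ_ne_zero, not_false_eq_true,
    Function.update_of_ne]
  rw [integral_add (Integrable.of_bound hm₁.aestronglyMeasurable K (ae_of_all _ hK₁))
    ((integrable_finsetSum _ fun k _ => hi _).const_mul _), h0, integral_const_mul,
    integral_finsetSum _ fun k _ => hi _]
  simp [hl]

/-- The summands are orthogonal: integrate over the larger of the two indices, which occurs in only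
one factor. The d quadratic terms have equal second moments, each weighted by 1/d, so d drops out.
-/
lemma integral_sq_windowFun_cyclicKernel (hm₁ : Measurable h₁)
    (hm₂ : Measurable (Function.uncurry h₂))
    (hK₁ : ∀ x, |h₁ x| ≤ K) (hK₂ : ∀ x y, |h₂ x y| ≤ K)
    (hr : ∀ x, ∫ y, h₂ x y ∂P = 0) {d : ℕ} (hd : 1 ≤ d) :
    ∫ x, windowFun (cyclicKernel h₁ h₂ d) 0 x ^ 2 ∂(Measure.infinitePi fun _ : ℕ => P)
      = ∫ x, h₁ (x 0) ^ 2 ∂(Measure.infinitePi fun _ : ℕ => P)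
        + ∫ x, h₂ (x 0) (x 1) ^ 2 ∂(Measure.infinitePi fun _ : ℕ => P) := by
  set ν := Measure.infinitePi fun _ : ℕ => P with hν
  let f : ℕ → (ℕ → E) → ℝ := fun k x =>
    if k = 0 then h₁ (x 0) else (√(d : ℝ))⁻¹ * h₂ (x 0) (x k)
  have hd1 : (1 : ℝ) ≤ √(d : ℝ) := Real.one_le_sqrt.2 (by exact_mod_cast hd)
  have hs : (√(d : ℝ))⁻¹ ≤ 1 := inv_le_one_of_one_le₀ hd1
  have hK0 : 0 ≤ K := (abs_nonneg _).trans (hK₁ (Classical.choice (nonempty_of_isProbabilityMeasure P)))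
  have hfm : ∀ k, Measurable (f k) := fun k => by
    simp only [f]
    split_ifs
    · exact hm₁.comp (measurable_pi_apply 0)
    · exact (measurable_comp_pair hm₂ (measurable_pi_apply 0) (measurable_pi_apply k)).const_mul _
  have hfK : ∀ k x, |f k x| ≤ K := fun k x => by
    simp only [f]
    split_ifs
    · exact hK₁ _
    · rw [abs_mul, abs_of_nonneg (inv_nonneg.2 (Real.sqrt_nonneg _))]
      calc _ ≤ 1 * K := mul_le_mul hs (hK₂ _ _) (abs_nonneg _) zero_le_one
        _ = K := one_mul K
  have hw : ∀ x, windowFun (cyclicKernel h₁ h₂ d) 0 x = ∑ k ∈ Finset.range (d + 1), f k x := by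
    intro x
    rw [windowFun_cyclicKernel, Finset.sum_range_succ', Finset.mul_sum, add_comm]
    congr 1
    rw [Finset.range_eq_Ico, Finset.sum_Ico_add' (fun k => f k x)]
    refine Finset.sum_congr rfl fun k hk => ?_
    have hk0 : k ≠ 0 := by
      have := (Finset.mem_Icc.1 hk).1; omega
    simp [f, hk0]
  have hcross : ∀ i j, i < j → ∫ x, f i x * f j x ∂ν = 0 := by
    intro i j hij
    refine integral_infinitePi_eq_zero_of_update (K := K * K) ((hfm i).mul (hfm j)) (fun x => ?_)
      j fun x => ?_
    · rw [norm_mul]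
      exact mul_le_mul (hfK i x) (hfK j x) (norm_nonneg _) hK0
    · have hj0 : j ≠ 0 := by omega
      have h1 : ∀ v, f i (Function.update x j v) = f i x := fun v => by
        simp only [f, Function.update_of_ne hj0.symm, Function.update_of_ne hij.ne]
      have h2 : ∀ v, f j (Function.update x j v) = (√(d : ℝ))⁻¹ * h₂ (x 0) v := fun v => by
        simp only [f, Function.update_of_ne hj0.symm, Function.update_self, if_neg hj0]
      simp only [h1, h2]
      rw [integral_const_mul, integral_const_mul, hr]
      simp
  simp only [hw]
  rw [integral_sum_sq_eq _ (fun k _ => hfm k) (fun k _ => hfK k) fun i _ j _ hij => by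
    rcases lt_or_gt_of_ne hij with h | h
    · exact hcross i j h
    · simpa only [mul_comm] using hcross j i h]
  rw [Finset.sum_range_succ', add_comm]
  congr 1
  have hterm : ∀ k ∈ Finset.range d, ∫ x, f (k + 1) x ^ 2 ∂ν
      = (d : ℝ)⁻¹ * ∫ x, h₂ (x 0) (x 1) ^ 2 ∂ν := by
    intro k _
    simp only [f, Nat.succ_ne_zero, if_false, mul_pow, inv_pow, Real.sq_sqrt (Nat.cast_nonneg d)]
    rw [integral_const_mul]
    congr 1
    -- This reindexing keeps coordinate 0 and sends 1 to k + 1, so invariance of the product measure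
    -- identifies the laws of (x 0, x (k+1)) and (x 0, x 1).
    have hinj : Function.Injective fun i : ℕ => if i = 0 then 0 else i + k := by
      intro i j hij
      simp only at hij
      split_ifs at hij <;> omega
    rw [hν]
    conv_rhs => rw [← Measure.map_infinitePi_infinitePi_of_inj (P := fun _ : ℕ => P) hinj]
    rw [integral_map]
    · simp [add_comm]
    · exact (measurable_pi_lambda _ fun i => measurable_pi_apply _).aemeasurable
    · exact ((measurable_comp_pair hm₂ (measurable_pi_apply 0)
        (measurable_pi_apply 1)).pow_const 2).aestronglyMeasurable
  rw [Finset.sum_congr rfl hterm, Finset.sum_const, Finset.card_range, nsmul_eq_mul]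
  have : (d : ℝ) ≠ 0 := by positivity
  field_simp

omit [MeasurableSpace E] in
-- Only windows starting among the last d indices can wrap around. These are at most d² terms, each
-- changed by at most 2K.
lemma abs_cyclic_sum_sub_le (hK₂ : ∀ x y, |h₂ x y| ≤ K) (n d : ℕ) (x : ℕ → E) :
    |∑ i ∈ Finset.range n, ∑ k ∈ Finset.Icc 1 d, h₂ (x i) (x ((i + k) % n))
      - ∑ i ∈ Finset.range n, ∑ k ∈ Finset.Icc 1 d, h₂ (x i) (x (i + k))| ≤ d * (d * (2 * K)) := by
  have hK0 : 0 ≤ K := (abs_nonneg _).trans (hK₂ (x 0) (x 0))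
  rw [← Finset.sum_sub_distrib]
  have hz : ∀ i ∈ Finset.range n, i ∉ Finset.Ico (n - d) n →
      (∑ k ∈ Finset.Icc 1 d, h₂ (x i) (x ((i + k) % n))
        - ∑ k ∈ Finset.Icc 1 d, h₂ (x i) (x (i + k))) = 0 := by
    intro i hi hi'
    rw [sub_eq_zero]
    refine Finset.sum_congr rfl fun k hk => ?_
    rw [Nat.mod_eq_of_lt]
    have := Finset.mem_Icc.1 hk
    rw [Finset.mem_range] at hi
    rw [Finset.mem_Ico] at hi'
    omega
  rw [← Finset.sum_subset (s₁ := Finset.Ico (n - d) n) (fun i hi => by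
    rw [Finset.mem_range]; exact (Finset.mem_Ico.1 hi).2) hz]
  refine (Finset.abs_sum_le_sum_abs _ _).trans ?_
  have hb : ∀ i ∈ Finset.Ico (n - d) n, |∑ k ∈ Finset.Icc 1 d, h₂ (x i) (x ((i + k) % n))
        - ∑ k ∈ Finset.Icc 1 d, h₂ (x i) (x (i + k))| ≤ d * (2 * K) := by
    intro i _
    rw [← Finset.sum_sub_distrib]
    refine (Finset.abs_sum_le_sum_abs _ _).trans ?_
    calc _ ≤ ∑ k ∈ Finset.Icc 1 d, 2 * K := Finset.sum_le_sum fun k _ =>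
          (abs_sub _ _).trans (by linarith [hK₂ (x i) (x ((i + k) % n)), hK₂ (x i) (x (i + k))])
      _ = _ := by simp
  refine (Finset.sum_le_sum hb).trans ?_
  rw [Finset.sum_const, Nat.card_Ico, nsmul_eq_mul]
  have : ((n - (n - d) : ℕ) : ℝ) ≤ d := by exact_mod_cast (by omega : n - (n - d) ≤ d)
  gcongr

lemma norm_exp_mul_I_sub_le (a b : ℝ) :
    ‖Complex.exp (a * Complex.I) - Complex.exp (b * Complex.I)‖ ≤ |a - b| := by
  have h : Complex.exp (a * Complex.I) - Complex.exp (b * Complex.I)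
      = Complex.exp (b * Complex.I) * (Complex.exp (Complex.I * (a - b : ℝ)) - 1) := by
    rw [mul_sub, ← Complex.exp_add, mul_one]
    congr 2
    push_cast
    ring
  rw [h, norm_mul, Complex.norm_exp_ofReal_mul_I, one_mul]
  simpa using Real.norm_exp_I_mul_ofReal_sub_one_le (x := a - b)

/-- Characteristic functions in the central limit theorem for the sum of a linear and a cyclic
degenerate quadratic part. -/
lemma tendsto_integral_exp_cyclic_sum (hm₁ : Measurable h₁) (hm₂ : Measurable (Function.uncurry h₂))
    (hK₁ : ∀ x, |h₁ x| ≤ K) (hK₂ : ∀ x y, |h₂ x y| ≤ K) (h0 : ∫ x, h₁ x ∂P = 0)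
    (hr : ∀ x, ∫ y, h₂ x y ∂P = 0) (hl : ∀ y, ∫ x, h₂ x y ∂P = 0) {d : ℕ} (hd : 1 ≤ d) :
    Tendsto (fun n : ℕ => ∫ x, Complex.exp
        (((√(n : ℝ))⁻¹ * ∑ i ∈ Finset.range n, h₁ (x i) + (√((n * d : ℕ) : ℝ))⁻¹ *
          ∑ i ∈ Finset.range n, ∑ k ∈ Finset.Icc 1 d, h₂ (x i) (x ((i + k) % n)) : ℝ) * Complex.I)
        ∂(Measure.infinitePi fun _ : ℕ => P)) atTop
      (𝓝 (Real.exp (-(∫ x, h₁ (x 0) ^ 2 ∂(Measure.infinitePi fun _ : ℕ => P)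
        + ∫ x, h₂ (x 0) (x 1) ^ 2 ∂(Measure.infinitePi fun _ : ℕ => P)) / 2))) := by
  have hφ := measurable_cyclicKernel hm₁ hm₂ d
  have hlim := tendsto_integral_exp_sum_windowFun (P := P) hφ (abs_cyclicKernel_le hK₁ hK₂ d)
    (integral_cyclicKernel_update hm₁ hm₂ hK₁ hK₂ h0 hl d)
  rw [integral_sq_windowFun_cyclicKernel hm₁ hm₂ hK₁ hK₂ hr hd] at hlim
  refine tendsto_of_tendsto_of_dist hlim ?_
  set ν := Measure.infinitePi fun _ : ℕ => P with hν
  -- The wrap-around error is bounded for fixed d, hence negligible after division by √(nd).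
  have hsq : Tendsto (fun n : ℕ => (√((n * d : ℕ) : ℝ))⁻¹ * (d * (d * (2 * K)))) atTop (𝓝 0) := by
    have h1 : Tendsto (fun n : ℕ => √((n * d : ℕ) : ℝ)) atTop atTop := by
      refine Real.tendsto_sqrt_atTop.comp (tendsto_natCast_atTop_atTop.comp ?_)
      exact tendsto_id.atTop_mul_const' (by omega)
    simpa using (tendsto_inv_atTop_zero.comp h1).mul_const _
  refine squeeze_zero (fun _ => dist_nonneg) (fun n => ?_) hsq
  have hmexp : ∀ g : (ℕ → E) → ℝ, Measurable g →
      Integrable (fun x => Complex.exp (g x * Complex.I)) ν := fun g hg =>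
    Integrable.of_bound (by fun_prop) 1
      (ae_of_all _ fun x => (Complex.norm_exp_ofReal_mul_I _).le)
  rw [dist_eq_norm, ← integral_sub (hmexp _ ?_) (hmexp _ ?_)]
  · refine (norm_integral_le_of_norm_le_const (C := (√((n * d : ℕ) : ℝ))⁻¹ * (d * (d * (2 * K))))
      (ae_of_all _ fun x => (norm_exp_mul_I_sub_le _ _).trans ?_)).trans (by simp)
    have hsplit : (√(n : ℝ))⁻¹ * ∑ i ∈ Finset.range n, windowFun (cyclicKernel h₁ h₂ d) i x
        = (√(n : ℝ))⁻¹ * ∑ i ∈ Finset.range n, h₁ (x i) + (√((n * d : ℕ) : ℝ))⁻¹ *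
          ∑ i ∈ Finset.range n, ∑ k ∈ Finset.Icc 1 d, h₂ (x i) (x (i + k)) := by
      simp only [windowFun_cyclicKernel]
      rw [Finset.sum_add_distrib, ← Finset.mul_sum, mul_add, ← mul_assoc]
      congr 2
      rw [Nat.cast_mul, Real.sqrt_mul (Nat.cast_nonneg n), mul_inv]
    rw [hsplit, add_sub_add_left_eq_sub, ← mul_sub, abs_mul,
      abs_of_nonneg (inv_nonneg.2 (Real.sqrt_nonneg _)), abs_sub_comm]
    gcongr
    exact abs_cyclic_sum_sub_le hK₂ n d x
  · exact (Finset.measurable_sum _ fun i _ => measurable_windowFun hφ i).const_mul _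
  · refine ((Finset.measurable_sum _ fun i _ => hm₁.comp (measurable_pi_apply i)).const_mul _).add
      ((Finset.measurable_sum _ fun i _ => Finset.measurable_sum _ fun k _ => ?_).const_mul _)
    exact measurable_comp_pair hm₂ (measurable_pi_apply _) (measurable_pi_apply _)

end CyclicCLT

/-! ### Joint limit of the linear and quadratic matrix parts. -/

section JointCLT

variable {q : ℕ}

lemma frob_eq_sum (A B : Mat q) : frob A B = ∑ k, ∑ l, A k l * B k l := by
  simp only [frob, Matrix.trace, Matrix.diag, Matrix.mul_apply, Matrix.transpose_apply]
  exact Finset.sum_comm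

/-- Second moments of the Gaussian matrices are prescribed only in symmetric directions.
Symmetrizing the coefficients of L does not change its values on symmetric matrices. -/
lemma exists_isSymm_forall_eq_frob (L : StrongDual ℝ (Mat q)) :
    ∃ A : Mat q, A.IsSymm ∧ ∀ B : Mat q, B.IsSymm → L B = frob A B := by
  let e : Fin q → Fin q → ℝ := fun k l => L (Matrix.single k l 1)
  refine ⟨Matrix.of fun k l => 2⁻¹ * (e k l + e l k), ?_, fun B hB => ?_⟩
  · ext k l
    simp [Matrix.transpose_apply, add_comm]
  · have h1 : L B = ∑ k, ∑ l, e k l * B k l := by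
      conv_lhs => rw [Matrix.matrix_eq_sum_single B]
      simp only [map_sum]
      refine Finset.sum_congr rfl fun k _ => Finset.sum_congr rfl fun l _ => ?_
      have : Matrix.single k l (B k l) = B k l • Matrix.single k l (1 : ℝ) := by
        rw [Matrix.smul_single, smul_eq_mul, mul_one]
      rw [this, map_smul, smul_eq_mul, mul_comm]
    have h2 : ∑ k, ∑ l, e l k * B k l = ∑ k, ∑ l, e k l * B k l := by
      rw [Finset.sum_comm]
      exact Finset.sum_congr rfl fun k _ => Finset.sum_congr rfl fun l _ => by rw [hB.apply]
    rw [frob_eq_sum, h1]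
    simp only [Matrix.of_apply, mul_assoc, add_mul, mul_add, Finset.sum_add_distrib,
      ← Finset.mul_sum]
    rw [h2]
    ring

lemma SymScatter.IsCenteredGaussian.integral_dual {Ω' : Type*} [MeasurableSpace Ω'] {μ' : Measure Ω'}
    [IsProbabilityMeasure μ'] {G : Ω' → Mat q} {v : Mat q → ℝ} (h : IsCenteredGaussian μ' G v)
    (L : StrongDual ℝ (Mat q)) : ∫ ω, L (G ω) ∂μ' = 0 := by
  rw [L.integral_comp_comm h.gaussian.integrable, h.mean, map_zero]

lemma SymScatter.IsCenteredGaussian.variance_dual {Ω' : Type*} [MeasurableSpace Ω'] {μ' : Measure Ω'}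
    [IsProbabilityMeasure μ'] {G : Ω' → Mat q} {v : Mat q → ℝ} (h : IsCenteredGaussian μ' G v)
    {L : StrongDual ℝ (Mat q)} {A : Mat q} (hA : A.IsSymm)
    (hL : ∀ B : Mat q, B.IsSymm → L B = frob A B) : Var[fun ω => L (G ω); μ'] = v A := by
  rw [variance_of_integral_eq_zero (h.gaussian.map_fun L).aemeasurable (h.integral_dual L),
    ← h.second_moment A hA]
  refine integral_congr_ae ?_
  filter_upwards [h.symm] with ω hω
  rw [hL _ hω]

variable {P : ProbabilityMeasure (Vec q)} {J : Vec q → Mat q} {K : ℝ}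

lemma isSymm_kernelProj (hJ : Measurable J) (hK : ∀ y, ‖J y‖ ≤ K) (hsymm : ∀ y, (J y).IsSymm)
    (x : Vec q) : (kernelProj P J x).IsSymm := by
  ext k l
  have h := fun k l => kernelProj_clm (P := P) hJ hK (entryCLM k l) x
  simp only [entryCLM_apply] at h
  rw [Matrix.transpose_apply, ← h, ← h]
  congr 1
  funext y
  exact ((hsymm y).apply k l)

lemma isSymm_kernelRest (hJ : Measurable J) (hK : ∀ y, ‖J y‖ ≤ K) (hsymm : ∀ y, (J y).IsSymm)
    (x y : Vec q) : (kernelRest P J x y).IsSymm :=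
  ((hsymm _).sub (isSymm_kernelProj hJ hK hsymm x)).sub (isSymm_kernelProj hJ hK hsymm y)

lemma sqrt_mul_inv_natCast (m : ℕ) : √(m : ℝ) * (m : ℝ)⁻¹ = (√(m : ℝ))⁻¹ := by
  rcases Nat.eq_zero_or_pos m with rfl | hm
  · simp
  · have h0 : (0 : ℝ) < m := Nat.cast_pos.2 hm
    have h1 : 0 < √(m : ℝ) := Real.sqrt_pos.2 h0
    field_simp
    exact Real.sq_sqrt h0.le

variable {Ω Ω' : Type*} [MeasurableSpace Ω] {μ : Measure Ω} [IsProbabilityMeasure μ]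
  {X : ℕ → Ω → Vec q} [MeasurableSpace Ω'] {μ' : Measure Ω'} [IsProbabilityMeasure μ']
  {G₁ G₂ : Ω' → Mat q}

/-- Joint asymptotic normality of the linear and the cyclic quadratic part. -/
theorem tendstoInDistribution_linear_quadratic
    (hX : ∀ i, HasLaw (X i) (P : Measure (Vec q)) μ) (hind : iIndepFun X μ)
    (hJ : Measurable J) (hK : ∀ y, ‖J y‖ ≤ K) (heven : ∀ y, J (-y) = J y)
    (hsymm : ∀ y, (J y).IsSymm) (h0 : ∫ y, J y ∂(symmetrized P : Measure (Vec q)) = 0)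
    (hG : IndepFun G₁ G₂ μ')
    (hG₁ : IsCenteredGaussian μ' G₁ (fun A => ∫ ω, (frob A (H₁ P J (X 0 ω))) ^ 2 ∂μ))
    (hG₂ : IsCenteredGaussian μ' G₂ (fun A => ∫ ω, (frob A (H₂ P J (X 0 ω) (X 1 ω))) ^ 2 ∂μ))
    {d : ℕ} (hd : 1 ≤ d) :
    TendstoInDistribution (fun (n : ℕ) ω =>
          (√(n : ℝ) • ∫ x, H₁ P J x ∂(empirical n (X · ω)),
            √((n * d : ℕ) : ℝ) • M P J n d (X · ω)))
        atTop (fun ω' => (G₁ ω', G₂ ω')) (fun _ => μ) μ' := by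
  have hlaw := hasLaw_sequence hX hind
  have hjoint := IndepFun.hasGaussianLaw hG₁.gaussian hG₂.gaussian hG
  have hform : ∀ (n : ℕ) (x : ℕ → Vec q), (√(n : ℝ) • ∫ z, H₁ P J z ∂(empirical n x),
      √((n * d : ℕ) : ℝ) • M P J n d x)
      = ((√(n : ℝ))⁻¹ • ∑ i ∈ Finset.range n, kernelProj P J (x i),
        (√((n * d : ℕ) : ℝ))⁻¹ • ∑ i ∈ Finset.range n, ∑ k ∈ Finset.Icc 1 d,
          kernelRest P J (x i) (x ((i + k) % n))) := by
    intro n x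
    rw [integral_empirical, M, smul_smul, smul_smul, sqrt_mul_inv_natCast, sqrt_mul_inv_natCast]
    rfl
  simp only [hform]
  have hmeas : ∀ n : ℕ, Measurable fun x : ℕ → Vec q =>
      ((√(n : ℝ))⁻¹ • ∑ i ∈ Finset.range n, kernelProj P J (x i),
        (√((n * d : ℕ) : ℝ))⁻¹ • ∑ i ∈ Finset.range n, ∑ k ∈ Finset.Icc 1 d,
          kernelRest P J (x i) (x ((i + k) % n))) := fun n => by
    have m1 : Measurable fun x : ℕ → Vec q => ∑ i ∈ Finset.range n, kernelProj P J (x i) :=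
      Finset.measurable_sum _ fun i _ => (measurable_kernelProj hJ).comp (measurable_pi_apply i)
    have m2 : Measurable fun x : ℕ → Vec q => ∑ i ∈ Finset.range n, ∑ k ∈ Finset.Icc 1 d,
        kernelRest P J (x i) (x ((i + k) % n)) :=
      Finset.measurable_sum _ fun i _ => Finset.measurable_sum _ fun k _ =>
        measurable_kernelRest_comp hJ _ _
    exact (m1.const_smul (√(n : ℝ))⁻¹).prodMk (m2.const_smul (√((n * d : ℕ) : ℝ))⁻¹)
  refine tendstoInDistribution_of_forall_dual (fun n => ?_) hjoint.aemeasurable fun L => ?_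
  · have h := (hmeas n).comp_aemeasurable hlaw.aemeasurable
    simpa only [Function.comp_def] using h
  -- A functional on the pair is a sum of functionals of the components; each is applied to J,
  -- giving two different scalar kernels.
  set L₁ : StrongDual ℝ (Mat q) := L.comp (ContinuousLinearMap.inl ℝ (Mat q) (Mat q)) with hL₁
  set L₂ : StrongDual ℝ (Mat q) := L.comp (ContinuousLinearMap.inr ℝ (Mat q) (Mat q)) with hL₂
  have hL : ∀ A B : Mat q, L (A, B) = L₁ A + L₂ B := fun A B => by
    simp [hL₁, hL₂, ← map_add]
  obtain ⟨A₁, hA₁, hLA₁⟩ := exists_isSymm_forall_eq_frob L₁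
  obtain ⟨A₂, hA₂, hLA₂⟩ := exists_isSymm_forall_eq_frob L₂
  let j₁ : Vec q → ℝ := fun y => L₁ (J y)
  let j₂ : Vec q → ℝ := fun y => L₂ (J y)
  have hjm : ∀ L' : StrongDual ℝ (Mat q), Measurable fun y => L' (J y) := fun L' =>
    L'.continuous.measurable.comp hJ
  have hK0 : 0 ≤ K := (norm_nonneg _).trans (hK 0)
  have hjK : ∀ L' : StrongDual ℝ (Mat q), ∀ y, |L' (J y)| ≤ ‖L'‖ * K := fun L' y =>
    (L'.le_opNorm _).trans (by gcongr; exact hK y)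
  have hj0 : ∀ L' : StrongDual ℝ (Mat q), ∫ y, L' (J y) ∂(symmetrized P : Measure (Vec q)) = 0 :=
    fun L' => by
      rw [L'.integral_comp_comm (Integrable.of_bound hJ.aestronglyMeasurable K (ae_of_all _ hK)),
        h0, map_zero]
  have hje : ∀ y, j₂ (-y) = j₂ y := fun y => by simp only [j₂, heven]
  -- A common bound for both kernels; subtracting two projections from j₂ accounts for the factor 3.
  set C := max (‖L₁‖ * K) (3 * (‖L₂‖ * K)) with hC
  have hclt := tendsto_integral_exp_cyclic_sum (P := (P : Measure (Vec q)))
    (h₁ := kernelProj P j₁) (h₂ := kernelRest P j₂) (K := C)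
    (measurable_kernelProj (hjm L₁)) (measurable_kernelRest (hjm L₂))
    (fun x => (norm_kernelProj_le (P := P) (j := j₁) (hjK L₁) x).trans (le_max_left _ _))
    (fun x y => (norm_kernelRest_le (P := P) (j := j₂) (hjK L₂) x y).trans (le_max_right _ _))
    (integral_kernelProj_eq_zero (hjm L₁) (hjK L₁) (hj0 L₁))
    (integral_kernelRest_right (hjm L₂) (hjK L₂) (hj0 L₂))
    (fun y => by
      simpa only [kernelRest_comm hje _ y] using
        integral_kernelRest_right (hjm L₂) (hjK L₂) (hj0 L₂) y) hd
  have hproj : ∀ x, kernelProj P j₁ x = L₁ (kernelProj P J x) := kernelProj_clm hJ hK L₁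
  have hrest : ∀ x y, kernelRest P j₂ x y = L₂ (kernelRest P J x y) := kernelRest_clm hJ hK L₂
  convert! hclt using 2
  · rename_i n
    have h := integral_comp_sequence hX hind (g := fun x => Complex.exp
      ((L ((√(n : ℝ))⁻¹ • ∑ i ∈ Finset.range n, kernelProj P J (x i),
        (√((n * d : ℕ) : ℝ))⁻¹ • ∑ i ∈ Finset.range n, ∑ k ∈ Finset.Icc 1 d,
          kernelRest P J (x i) (x ((i + k) % n))) : ℝ) * Complex.I)) (by
      have h1 := L.continuous.measurable.comp (hmeas n)
      exact ((Complex.measurable_ofReal.comp h1).mul_const _).cexp.aestronglyMeasurable)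
    refine h.trans ?_
    congr 1
    funext x
    rw [hL]
    simp only [map_smul, map_sum, smul_eq_mul, hproj, hrest]
  -- The joint law is centered Gaussian and, by independence, the variance of L is the sum of the
  -- two variances, which matches the limit in the scalar theorem.
  · have h1 := hjoint.charFunDual_map_eq_fun L
    rw [charFunDual_apply, integral_map hjoint.aemeasurable (by fun_prop)] at h1
    rw [h1]
    simp only [hL]
    have hi₁ := (hG₁.gaussian.map_fun L₁)
    have hi₂ := (hG₂.gaussian.map_fun L₂)
    rw [integral_add hi₁.integrable hi₂.integrable, hG₁.integral_dual, hG₂.integral_dual]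
    have hind' : IndepFun (fun ω => L₁ (G₁ ω)) (fun ω => L₂ (G₂ ω)) μ' :=
      hG.comp L₁.continuous.measurable L₂.continuous.measurable
    have hv := hind'.variance_add hi₁.memLp_two hi₂.memLp_two
    have hv' : Var[fun ω => L₁ (G₁ ω) + L₂ (G₂ ω); μ']
        = Var[fun ω => L₁ (G₁ ω); μ'] + Var[fun ω => L₂ (G₂ ω); μ'] := hv
    rw [hv', hG₁.variance_dual hA₁ hLA₁, hG₂.variance_dual hA₂ hLA₂]
    have e1 : ∫ ω, frob A₁ (H₁ P J (X 0 ω)) ^ 2 ∂μ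
        = ∫ x, kernelProj P j₁ (x 0) ^ 2
          ∂(Measure.infinitePi fun _ : ℕ => (P : Measure (Vec q))) := by
      rw [← integral_comp_sequence hX hind (g := fun x => kernelProj P j₁ (x 0) ^ 2)
        ((((measurable_kernelProj (hjm L₁)).comp (measurable_pi_apply 0))).pow_const
          2).aestronglyMeasurable]
      simp only [hproj, hLA₁ _ (isSymm_kernelProj hJ hK hsymm _)]
      rfl
    have e2 : ∫ ω, frob A₂ (H₂ P J (X 0 ω) (X 1 ω)) ^ 2 ∂μ
        = ∫ x, kernelRest P j₂ (x 0) (x 1) ^ 2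
          ∂(Measure.infinitePi fun _ : ℕ => (P : Measure (Vec q))) := by
      rw [← integral_comp_sequence hX hind (g := fun x => kernelRest P j₂ (x 0) (x 1) ^ 2)
        ((measurable_kernelRest_comp (hjm L₂) 0 1).pow_const 2).aestronglyMeasurable]
      simp only [hrest, hLA₂ _ (isSymm_kernelRest hJ hK hsymm _ _)]
      rfl
    rw [e1, e2, Complex.ofReal_exp]
    congr 1
    push_cast
    ring

end JointCLT

/-! ### The three asymptotic statements for a general functional. -/

section Asymptotics

variable {q : ℕ} {Ω Ω' : Type*} [MeasurableSpace Ω] {μ : Measure Ω} [IsProbabilityMeasure μ]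
  {P : ProbabilityMeasure (Vec q)} {X : ℕ → Ω → Vec q} [MeasurableSpace Ω'] {μ' : Measure Ω'}
  [IsProbabilityMeasure μ'] {G₁ G₂ : Ω' → Mat q} {S : ScatterFunctional q} {J : Vec q → Mat q}
  {ι : Type*} {s : ℕ → Finset ι} {a b : ℕ → ι → ℕ}

lemma tendsto_sqrt_smul_eval_sub_decomposition
    (hX : ∀ i, HasLaw (X i) (P : Measure (Vec q)) μ)
    (hind : iIndepFun X μ) (hD : ∀ᶠ n in atTop, IsBalancedDesign n (s n) (a n) (b n))
    (hdom : ∀ᶠ R : ProbabilityMeasure (Vec q) in 𝓝 (symmetrized P),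
      ((symmetrized P : Measure (Vec q)) {0} = 0 → (R : Measure (Vec q)) {0} = 0) → R ∈ S.domain)
    (hJ : S.IsInfluenceFunction (symmetrized P) J) :
    Tendsto (fun p : ℕ × Ω => √(p.1 : ℝ) •
      (S.eval (pairEmpirical (s p.1) (a p.1) (b p.1) (X · p.2)) - S.toFun (symmetrized P)
        - ((2 : ℝ) • ∫ x, H₁ P J x ∂(empirical p.1 (X · p.2)) + ((s p.1).card : ℝ)⁻¹ •
          ∑ i ∈ s p.1, kernelRest P J (X (a p.1 i) p.2) (X (b p.1 i) p.2))))
      (probFilter μ) (𝓝 0) := by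
  refine (tendsto_sqrt_smul_eval_sub hX hind hD hdom hJ).congr' ?_
  filter_upwards [eventually_probFilter_of_eventually hD] with p hp
  rw [integral_pairEmpirical_eq (P := P) hp hJ.even, integral_empirical]
  rfl

lemma tendsto_measure_isDefinedAt_pairEmpirical
    (hX : ∀ i, HasLaw (X i) (P : Measure (Vec q)) μ)
    (hind : iIndepFun X μ) (hD : ∀ᶠ n in atTop, IsBalancedDesign n (s n) (a n) (b n))
    (hdom : ∀ᶠ R : ProbabilityMeasure (Vec q) in 𝓝 (symmetrized P),
      ((symmetrized P : Measure (Vec q)) {0} = 0 → (R : Measure (Vec q)) {0} = 0) → R ∈ S.domain) :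
    Tendsto (fun n => μ {ω | S.IsDefinedAt (pairEmpirical (s n) (a n) (b n) (X · ω))}) atTop
      (𝓝 1) :=
  tendsto_measure_of_eventually_probFilter
    (p := fun n ω => S.IsDefinedAt (pairEmpirical (s n) (a n) (b n) (X · ω)))
    (eventually_isDefinedAt_pairEmpirical hX hind hD hdom)

/-- With many more pairs than observations the degenerate part is o_p(n^{-1/2}) and only the linear
part remains. -/
lemma isLittleOpInvSqrt_eval_sub_linear
    (hX : ∀ i, HasLaw (X i) (P : Measure (Vec q)) μ)
    (hind : iIndepFun X μ) (hD : ∀ᶠ n in atTop, IsBalancedDesign n (s n) (a n) (b n))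
    (hdom : ∀ᶠ R : ProbabilityMeasure (Vec q) in 𝓝 (symmetrized P),
      ((symmetrized P : Measure (Vec q)) {0} = 0 → (R : Measure (Vec q)) {0} = 0) → R ∈ S.domain)
    (hJ : S.IsInfluenceFunction (symmetrized P) J)
    (hlarge : Tendsto (fun n : ℕ => (n : ℝ) / (s n).card) atTop (𝓝 0)) :
    IsLittleOpInvSqrt μ (fun n ω =>
        S.eval (pairEmpirical (s n) (a n) (b n) (X · ω)) - (S.toFun (symmetrized P)
          + (2 : ℝ) • ∫ x, H₁ P J x ∂(empirical n (X · ω)))) := by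
  obtain ⟨K, hK⟩ := hJ.bounded
  rw [IsLittleOpInvSqrt, tendstoInMeasure_iff_probFilter]
  have h := (tendsto_sqrt_smul_eval_sub_decomposition hX hind hD hdom hJ).add
    (tendsto_sqrt_smul_rest hX hind hD hJ.measurable hK hJ.even hJ.integral_eq_zero hlarge)
  rw [add_zero] at h
  refine h.congr fun p => ?_
  rw [← smul_add]
  congr 1
  abel

/-- A sequence with the linear expansion of a scatter functional is asymptotically normal. -/
lemma tendstoInDistribution_of_isLittleOpInvSqrt {T : ℕ → Ω → Mat q} {A : Mat q} {W : Ω' → Mat q}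
    {V : ℕ → Ω → Mat q} (hT : ∀ n, AEMeasurable (T n) μ)
    (h : TendstoInMeasure μ (fun (n : ℕ) ω => √(n : ℝ) • (T n ω - A) - V n ω) atTop (fun _ => 0))
    (hV : TendstoInDistribution V atTop W (fun _ => μ) μ') :
    TendstoInDistribution (fun (n : ℕ) ω => √(n : ℝ) • (T n ω - A)) atTop W (fun _ => μ) μ' := by
  refine tendstoInDistribution_of_tendstoInMeasure_sub _ _ hV h fun n => ?_
  exact ((hT n).sub aemeasurable_const).const_smul (√(n : ℝ))

lemma tendstoInDistribution_of_linear {T : ℕ → Ω → Mat q} {A : Mat q}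
    (hT : ∀ n, AEMeasurable (T n) μ)
    (h : IsLittleOpInvSqrt μ (fun n ω => T n ω - (A
          + (2 : ℝ) • ∫ x, H₁ P J x ∂(empirical n (X · ω)))))
    {Z : ℕ → Ω → Mat q}
    (hV : TendstoInDistribution (fun (n : ℕ) ω =>
      (√(n : ℝ) • ∫ x, H₁ P J x ∂(empirical n (X · ω)), Z n ω)) atTop
        (fun ω' => (G₁ ω', G₂ ω')) (fun _ => μ) μ') :
    TendstoInDistribution (fun (n : ℕ) ω => √(n : ℝ) • (T n ω - A)) atTop
      (fun ω' => (2 : ℝ) • G₁ ω') (fun _ => μ) μ' := by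
  have h2 := hV.continuous_comp (g := fun p : Mat q × Mat q => (2 : ℝ) • p.1)
    (continuous_fst.const_smul (2 : ℝ))
  refine tendstoInDistribution_of_isLittleOpInvSqrt hT ?_ h2
  rw [IsLittleOpInvSqrt] at h
  convert h using 3 with n ω
  simp only [Function.comp_def, smul_sub, smul_add]
  rw [smul_comm, sub_sub]

lemma tendsto_natCast_div_choose_two :
    Tendsto (fun n : ℕ => (n : ℝ) / (n.choose 2 : ℕ)) atTop (𝓝 0) := by
  have h : Tendsto (fun n : ℕ => 2 / ((n : ℝ) - 1)) atTop (𝓝 0) :=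
    tendsto_const_nhds.div_atTop
      (tendsto_atTop_add_const_right _ (-1) tendsto_natCast_atTop_atTop)
  refine h.congr' ?_
  filter_upwards [eventually_ge_atTop 2] with n hn
  have h2 : (2 : ℝ) ≤ n := by exact_mod_cast hn
  have h3 : (n : ℝ) - 1 ≠ 0 := by linarith
  rw [Nat.cast_choose_two]
  field_simp

/-- The asymptotic results for a scatter functional with influence functions, whose domain contains
all distributions near that of the differences, except perhaps for those with an atom at zero. -/
theorem asymptotics_of_isInfluenceFunction (hGδ : IsGδ S.domain)
    (hinf : ∀ Q ∈ S.domain, ∃ J, S.IsInfluenceFunction Q J)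
    (hX : ∀ i, HasLaw (X i) (P : Measure (Vec q)) μ) (hind : iIndepFun X μ)
    (hdom : ∀ᶠ R : ProbabilityMeasure (Vec q) in 𝓝 (symmetrized P),
      ((symmetrized P : Measure (Vec q)) {0} = 0 → (R : Measure (Vec q)) {0} = 0) → R ∈ S.domain)
    (hJ : S.IsInfluenceFunction (symmetrized P) J)
    (hG : IndepFun G₁ G₂ μ')
    (hG₁ : IsCenteredGaussian μ' G₁ (fun A => ∫ ω, (frob A (H₁ P J (X 0 ω))) ^ 2 ∂μ))
    (hG₂ : IsCenteredGaussian μ' G₂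
      (fun A => ∫ ω, (frob A (H₂ P J (X 0 ω) (X 1 ω))) ^ 2 ∂μ)) :
    (Tendsto (fun n => μ {ω | S.IsDefinedAt (empiricalDiff n (X · ω))}) atTop (𝓝 1) ∧
      IsLittleOpInvSqrt μ (fun n ω =>
        S.eval (empiricalDiff n (X · ω)) - (S.toFun (symmetrized P)
          + (2 : ℝ) • ∫ x, H₁ P J x ∂(empirical n (X · ω)))) ∧
      TendstoInDistribution (fun (n : ℕ) ω =>
          √(n : ℝ) • (S.eval (empiricalDiff n (X · ω)) - S.toFun (symmetrized P)))
        atTop (fun ω' => (2 : ℝ) • G₁ ω') (fun _ => μ) μ') ∧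
    (∀ d : ℕ → ℕ, (∀ᶠ n in atTop, (d n : ℝ) ≤ ((n : ℝ) - 1) / 2) → Tendsto d atTop atTop →
      Tendsto (fun n => μ {ω | S.IsDefinedAt (empiricalDiffInc n (d n) (X · ω))})
        atTop (𝓝 1) ∧
      IsLittleOpInvSqrt μ (fun n ω =>
        S.eval (empiricalDiffInc n (d n) (X · ω)) - (S.toFun (symmetrized P)
          + (2 : ℝ) • ∫ x, H₁ P J x ∂(empirical n (X · ω)))) ∧
      TendstoInDistribution (fun (n : ℕ) ω =>
          √(n : ℝ) • (S.eval (empiricalDiffInc n (d n) (X · ω)) - S.toFun (symmetrized P)))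
        atTop (fun ω' => (2 : ℝ) • G₁ ω') (fun _ => μ) μ') ∧
    (∀ d : ℕ, 1 ≤ d →
      Tendsto (fun n => μ {ω | S.IsDefinedAt (empiricalDiffInc n d (X · ω))}) atTop (𝓝 1) ∧
      IsLittleOpInvSqrt μ (fun n ω =>
        S.eval (empiricalDiffInc n d (X · ω))
          - (S.eval (empiricalDiff n (X · ω)) + M P J n d (X · ω))) ∧
      TendstoInDistribution (fun (n : ℕ) ω =>
          (√(n : ℝ) • ∫ x, H₁ P J x ∂(empirical n (X · ω)),
            √((n * d : ℕ) : ℝ) • M P J n d (X · ω)))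
        atTop (fun ω' => (G₁ ω', G₂ ω')) (fun _ => μ) μ' ∧
      TendstoInDistribution (fun (n : ℕ) ω =>
          √(n : ℝ) • (S.eval (empiricalDiffInc n d (X · ω)) - S.toFun (symmetrized P)))
        atTop (fun ω' => (2 : ℝ) • G₁ ω' + (√(d : ℝ))⁻¹ • G₂ ω') (fun _ => μ) μ') := by
  obtain ⟨K, hK⟩ := hJ.bounded
  have hlaw := hasLaw_sequence hX hind
  have hjoint := fun (d : ℕ) (hd : 1 ≤ d) => tendstoInDistribution_linear_quadratic hX hind
    hJ.measurable hK hJ.even hJ.symm hJ.integral_eq_zero hG hG₁ hG₂ hd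
  have hmeas : ∀ {κ : Type} (s : Finset κ) (a b : κ → ℕ),
      AEMeasurable (fun ω => S.eval (pairEmpirical s a b (X · ω))) μ := fun s a b => by
    have h := (measurable_eval_pairEmpirical hGδ hinf s a b).comp_aemeasurable hlaw.aemeasurable
    simpa only [Function.comp_def] using h
  simp only [empiricalDiff_eq_pairEmpirical, empiricalDiffInc_eq_pairEmpirical]
  have hDc : ∀ᶠ n in atTop, IsBalancedDesign n ((Finset.range n).sigma fun j => Finset.range j)
      (fun p : (_ : ℕ) × ℕ => p.2) (fun p => p.1) := by
    filter_upwards [eventually_ge_atTop 2] with n hn using isBalancedDesign_complete hn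
  have hlin := isLittleOpInvSqrt_eval_sub_linear hX hind hDc hdom hJ
    (by simpa only [card_sigma_range] using tendsto_natCast_div_choose_two)
  refine ⟨⟨?_, hlin, ?_⟩, fun d hd1 hd2 => ?_, fun d hd => ?_⟩
  · exact tendsto_measure_isDefinedAt_pairEmpirical hX hind hDc hdom
  -- Only the linear component of the joint limit matters here, so any d may be inserted; 1 is
  -- taken.
  · exact tendstoInDistribution_of_linear (fun n => hmeas _ _ _) hlin (hjoint 1 le_rfl)
  · have hDi : ∀ᶠ n in atTop, IsBalancedDesign n (Finset.range n ×ˢ Finset.Icc 1 (d n))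
        (fun p : ℕ × ℕ => p.1) (fun p => (p.1 + p.2) % n) := by
      filter_upwards [hd1, hd2.eventually_ge_atTop 1] with n h1 h2
      refine isBalancedDesign_cyclic h2 ?_
      have : (2 * d n + 1 : ℝ) ≤ n := by linarith
      exact_mod_cast this
    have hl : Tendsto (fun n : ℕ => (n : ℝ) / (Finset.range n ×ˢ Finset.Icc 1 (d n)).card) atTop
        (𝓝 0) := by
      have h : Tendsto (fun n : ℕ => ((d n : ℕ) : ℝ)⁻¹) atTop (𝓝 0) :=
        tendsto_inv_atTop_zero.comp (tendsto_natCast_atTop_atTop.comp hd2)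
      refine h.congr' ?_
      filter_upwards [eventually_ge_atTop 1] with n hn
      have hn0 : (n : ℝ) ≠ 0 := by positivity
      simp only [Finset.card_product, Finset.card_range, Nat.card_Icc, Nat.add_sub_cancel,
        Nat.cast_mul]
      rw [div_mul_eq_div_div, div_self hn0, one_div]
    have hlin' := isLittleOpInvSqrt_eval_sub_linear hX hind hDi hdom hJ hl
    exact ⟨tendsto_measure_isDefinedAt_pairEmpirical hX hind hDi hdom, hlin',
      tendstoInDistribution_of_linear (fun n => hmeas _ _ _) hlin' (hjoint 1 le_rfl)⟩
  · have hDi : ∀ᶠ n in atTop, IsBalancedDesign n (Finset.range n ×ˢ Finset.Icc 1 d)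
        (fun p : ℕ × ℕ => p.1) (fun p => (p.1 + p.2) % n) := by
      filter_upwards [eventually_ge_atTop (2 * d + 1)] with n hn
      exact isBalancedDesign_cyclic hd hn
    have hdec := tendsto_sqrt_smul_eval_sub_decomposition hX hind hDi hdom hJ
    have hM : ∀ (n : ℕ) (ω : Ω), ((Finset.range n ×ˢ Finset.Icc 1 d).card : ℝ)⁻¹ •
          ∑ i ∈ Finset.range n ×ˢ Finset.Icc 1 d, kernelRest P J (X i.1 ω) (X ((i.1 + i.2) % n) ω)
        = M P J n d (X · ω) := fun n ω => by
      rw [M, Finset.sum_product, Finset.card_product]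
      simp only [Finset.card_range, Nat.card_Icc, Nat.add_sub_cancel]
      rfl
    simp only [hM] at hdec
    refine ⟨tendsto_measure_isDefinedAt_pairEmpirical hX hind hDi hdom, ?_, hjoint d hd, ?_⟩
    -- The complete and incomplete estimators share the same linear part, so subtracting their
    -- expansions leaves M.
    · rw [IsLittleOpInvSqrt, tendstoInMeasure_iff_probFilter] at hlin ⊢
      have h := hdec.sub hlin
      rw [sub_zero] at h
      refine h.congr fun p => ?_
      rw [← smul_sub]
      congr 1
      abel
    · have h2 := (hjoint d hd).continuous_comp
        (g := fun p : Mat q × Mat q => (2 : ℝ) • p.1 + (√(d : ℝ))⁻¹ • p.2)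
        ((continuous_fst.const_smul (2 : ℝ)).add (continuous_snd.const_smul (√(d : ℝ))⁻¹))
      refine tendstoInDistribution_of_isLittleOpInvSqrt (fun n => hmeas _ _ _) ?_ h2
      rw [tendstoInMeasure_iff_probFilter]
      refine hdec.congr fun p => ?_
      have hd0 : √(d : ℝ) ≠ 0 := (Real.sqrt_pos.2 (by exact_mod_cast hd)).ne'
      -- The limit theorem normalizes M by √(nd), the estimator by √n; this produces the factor
      -- d^{-1/2} before G₂.
      have h3 : (√(d : ℝ))⁻¹ * √((p.1 * d : ℕ) : ℝ) = √(p.1 : ℝ) := by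
        rw [Nat.cast_mul, Real.sqrt_mul (Nat.cast_nonneg _)]
        field_simp
      simp only [Function.comp_def]
      rw [smul_smul (√(d : ℝ))⁻¹, h3, smul_comm (2 : ℝ), ← smul_add, ← smul_sub]

end Asymptotics

/-! ### Quadratic forms and sorted spectral decompositions. -/

section QuadForm

variable {q : ℕ}

lemma quadForm_eq_sum (A : Mat q) (y : Vec q) : quadForm A y = ∑ k, ∑ l, A k l * (y k * y l) := by
  simp only [quadForm, dotProduct, Matrix.mulVec, Finset.mul_sum]
  exact Finset.sum_congr rfl fun k _ => Finset.sum_congr rfl fun l _ => by ring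

lemma quadForm_one (y : Vec q) : quadForm 1 y = ‖y‖ ^ 2 := by
  rw [EuclideanSpace.real_norm_sq_eq, quadForm, Matrix.one_mulVec, dotProduct]
  exact Finset.sum_congr rfl fun k _ => (sq _).symm

@[simp]
lemma quadForm_zero_right (A : Mat q) : quadForm A 0 = 0 := by simp [quadForm]

lemma quadForm_add (A B : Mat q) (y : Vec q) :
    quadForm (A + B) y = quadForm A y + quadForm B y := by
  simp [quadForm, Matrix.add_mulVec, dotProduct_add]

lemma quadForm_sub (A B : Mat q) (y : Vec q) :
    quadForm (A - B) y = quadForm A y - quadForm B y := by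
  simp [quadForm, Matrix.sub_mulVec, dotProduct_sub]

lemma quadForm_smul (c : ℝ) (A : Mat q) (y : Vec q) : quadForm (c • A) y = c * quadForm A y := by
  simp [quadForm, Matrix.smul_mulVec, dotProduct_smul]

lemma quadForm_smul_right (c : ℝ) (A : Mat q) (y : Vec q) :
    quadForm A (c • y) = c ^ 2 * quadForm A y := by
  simp only [quadForm, WithLp.ofLp_smul, Matrix.mulVec_smul, dotProduct_smul, smul_dotProduct, smul_eq_mul]
  ring

lemma continuous_quadForm (A : Mat q) : Continuous (quadForm A) := by
  unfold quadForm
  simp only [dotProduct, Matrix.mulVec]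
  fun_prop

lemma continuous_entry (k l : Fin q) : Continuous fun A : Mat q => A k l :=
  (entryCLM k l).continuous

lemma continuous_quadForm_left (y : Vec q) : Continuous fun A : Mat q => quadForm A y := by
  simp only [quadForm_eq_sum]
  exact continuous_finsetSum _ fun k _ => continuous_finsetSum _ fun l _ =>
    (continuous_entry k l).mul continuous_const

/-- The Cauchy–Schwarz inequality for the Frobenius product of A and y yᵀ, the latter having norm
‖y‖². -/
lemma abs_quadForm_le (A : Mat q) (y : Vec q) : |quadForm A y| ≤ ‖A‖ * ‖y‖ ^ 2 := by
  rw [← abs_of_nonneg (by positivity : 0 ≤ ‖A‖ * ‖y‖ ^ 2), ← sq_le_sq, quadForm_eq_sum, mul_pow,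
    frobenius_norm_sq, ← Finset.sum_product', ← Finset.sum_product']
  refine (Finset.sum_mul_sq_le_sq_mul_sq _ _ _).trans (le_of_eq ?_)
  congr 1
  rw [EuclideanSpace.real_norm_sq_eq, sq (∑ i, y i ^ 2), Finset.sum_mul_sum, Finset.sum_product]
  exact Finset.sum_congr rfl fun k _ => Finset.sum_congr rfl fun l _ => mul_pow _ _ _

lemma posDef_iff_quadForm {A : Mat q} :
    A.PosDef ↔ A.IsSymm ∧ ∀ y : Vec q, y ≠ 0 → 0 < quadForm A y := by
  constructor
  · intro h
    refine ⟨by simpa [Matrix.IsHermitian, Matrix.IsSymm] using h.isHermitian, fun y hy => ?_⟩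
    have := h.dotProduct_mulVec_pos (x := y.ofLp) (by simpa using hy)
    simpa [quadForm] using this
  · rintro ⟨h1, h2⟩
    refine Matrix.PosDef.of_dotProduct_mulVec_pos
      (by simpa [Matrix.IsHermitian, Matrix.IsSymm] using h1) fun x hx => ?_
    have := h2 (WithLp.toLp 2 x) (by simpa using hx)
    simpa [quadForm] using this

lemma quadForm_eq_sum_eigenvalues {A : Mat q} (hA : A.IsHermitian) (y : Vec q) :
    quadForm A y = ∑ i, hA.eigenvalues i * inner ℝ (hA.eigenvectorBasis i) y ^ 2 := by
  have h1 : quadForm A y = inner ℝ y (WithLp.toLp 2 (A.mulVec y.ofLp)) := by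
    rw [quadForm, EuclideanSpace.inner_eq_star_dotProduct, dotProduct_comm]
    rfl
  rw [h1, ← hA.eigenvectorBasis.sum_inner_mul_inner]
  refine Finset.sum_congr rfl fun i _ => ?_
  have h2 : inner ℝ (hA.eigenvectorBasis i) (WithLp.toLp 2 (A.mulVec y.ofLp))
      = hA.eigenvalues i * inner ℝ (hA.eigenvectorBasis i) y := by
    rw [EuclideanSpace.inner_eq_star_dotProduct, EuclideanSpace.inner_eq_star_dotProduct]
    simp only [star_trivial]
    have hs : A.transpose = A := by simpa [Matrix.IsHermitian] using hA
    rw [dotProduct_comm, Matrix.dotProduct_mulVec, ← Matrix.mulVec_transpose, hs,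
      hA.mulVec_eigenvectorBasis, smul_dotProduct, smul_eq_mul, dotProduct_comm]
  rw [h2, real_inner_comm]
  ring

/-- Spectral representation of a positive definite matrix of determinant one, with sorted
eigenvalues. -/
lemma exists_sorted_spectral {A : Mat q} (hA : A.PosDef) (hdet : A.det = 1) :
    ∃ (v : Fin q → Vec q) (a : Fin q → ℝ), Orthonormal ℝ v ∧ Antitone a ∧ ∑ i, a i = 0 ∧
      ∀ y, quadForm A y = ∑ i, Real.exp (a i) * inner ℝ (v i) y ^ 2 := by
  -- Sorting increasingly after negation lists the logarithms of the eigenvalues in decreasing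
  -- order.
  let σ : Equiv.Perm (Fin q) := Tuple.sort fun i => -Real.log (hA.isHermitian.eigenvalues i)
  refine ⟨fun i => hA.isHermitian.eigenvectorBasis (σ i),
    fun i => Real.log (hA.isHermitian.eigenvalues (σ i)),
    hA.isHermitian.eigenvectorBasis.orthonormal.comp _ σ.injective, ?_, ?_, fun y => ?_⟩
  · intro i j hij
    have := Tuple.monotone_sort (fun i => -Real.log (hA.isHermitian.eigenvalues i)) hij
    simpa using this
  · rw [Equiv.sum_comp σ fun i => Real.log (hA.isHermitian.eigenvalues i),
      ← Real.log_prod fun i _ => (hA.eigenvalues_pos i).ne']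
    have := hA.isHermitian.det_eq_prod_eigenvalues
    rw [hdet] at this
    simp only [RCLike.ofReal_real_eq_id, id_eq] at this
    rw [← this, Real.log_one]
  · rw [quadForm_eq_sum_eigenvalues hA.isHermitian]
    simp only [Real.exp_log (hA.eigenvalues_pos _)]
    exact (Equiv.sum_comp σ fun i => hA.isHermitian.eigenvalues i *
      inner ℝ (hA.isHermitian.eigenvectorBasis i) y ^ 2).symm

end QuadForm

/-! ### Uniform bounds for the masses of cones around subspaces. -/

section Concentration

variable {q : ℕ}

/-- The cone around the span of the vectors `v i`, `i ∈ s`, with aperture `ε`. -/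
def coneAround (v : Fin q → Vec q) (s : Finset (Fin q)) (ε : ℝ) : Set (Vec q) :=
  {y | (1 - ε) * ‖y‖ ^ 2 ≤ ∑ i ∈ s, inner ℝ (v i) y ^ 2}

lemma isClosed_coneAround (v : Fin q → Vec q) (s : Finset (Fin q)) (ε : ℝ) :
    IsClosed (coneAround v s ε) :=
  isClosed_le (by fun_prop) (by fun_prop)

lemma coneAround_mono {v : Fin q → Vec q} {s : Finset (Fin q)} {ε ε' : ℝ} (h : ε ≤ ε') :
    coneAround v s ε ⊆ coneAround v s ε' := fun y hy => by
  have : (1 - ε') * ‖y‖ ^ 2 ≤ (1 - ε) * ‖y‖ ^ 2 := by gcongr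
  exact this.trans hy

/-- Equality in Bessel's inequality: the distance of y to its projection is zero. -/
lemma mem_span_of_mem_coneAround_zero {v : Fin q → Vec q} (hv : Orthonormal ℝ v)
    {s : Finset (Fin q)} {y : Vec q} (hy : ‖y‖ ^ 2 ≤ ∑ i ∈ s, inner ℝ (v i) y ^ 2) :
    y ∈ Submodule.span ℝ (v '' s) := by
  set p := ∑ i ∈ s, inner ℝ (v i) y • v i with hp
  have h1 : inner ℝ y p = ∑ i ∈ s, inner ℝ (v i) y ^ 2 := by
    rw [hp, inner_sum]
    exact Finset.sum_congr rfl fun i _ => by rw [real_inner_smul_right, real_inner_comm, sq]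
  have h2 : inner ℝ p p = ∑ i ∈ s, inner ℝ (v i) y ^ 2 := by
    rw [hp, hv.inner_sum]
    exact Finset.sum_congr rfl fun i _ => by simp [sq]
  have h3 : ‖y - p‖ ^ 2 ≤ 0 := by
    rw [@norm_sub_sq_real, h1, ← real_inner_self_eq_norm_sq p, h2]
    linarith
  have h4 : y = p := by
    rw [← sub_eq_zero, ← norm_eq_zero]
    exact pow_eq_zero_iff two_ne_zero |>.1 (le_antisymm h3 (sq_nonneg _))
  rw [h4, hp]
  exact Submodule.sum_mem _ fun i hi => Submodule.smul_mem _ _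
    (Submodule.subset_span (Set.mem_image_of_mem v hi))

lemma mem_coneAround_of_mem_span {v : Fin q → Vec q} (hv : Orthonormal ℝ v)
    {s : Finset (Fin q)} {y : Vec q} (hy : y ∈ Submodule.span ℝ (v '' s)) {ε : ℝ} (hε : 0 ≤ ε) :
    y ∈ coneAround v s ε := by
  have hy' : y ∈ Submodule.span ℝ (Set.range fun i : s => v i) := by
    convert hy using 2
    ext z
    simp
  obtain ⟨c, rfl⟩ := (Submodule.mem_span_range_iff_exists_fun ℝ).1 hy'
  have hv' : Orthonormal ℝ fun i : s => v i := hv.comp _ Subtype.val_injective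
  refine coneAround_mono hε ?_
  simp only [coneAround, sub_zero, one_mul, Set.mem_ofPred_eq]
  rw [← real_inner_self_eq_norm_sq, hv'.inner_sum]
  refine le_of_eq ?_
  rw [← Finset.sum_coe_sort s fun i => inner ℝ (v i) (∑ i, c i • v i) ^ 2]
  refine Finset.sum_congr rfl fun i _ => ?_
  have := hv'.inner_right_fintype c i
  rw [this]
  simp [sq]

/-- Squared coefficients of y change by at most 2 dist(w i, v i)‖y‖², so moving the frame is
absorbed by a larger aperture. -/
lemma coneAround_subset_of_dist_le {v w : Fin q → Vec q} (hv : Orthonormal ℝ v)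
    (hw : Orthonormal ℝ w) {s : Finset (Fin q)} {ε δ : ℝ} (h : ∑ i, 2 * dist (w i) (v i) ≤ δ) :
    coneAround w s ε ⊆ coneAround v s (ε + δ) := by
  intro y hy
  have h1 : ∀ i, inner ℝ (w i) y ^ 2 ≤ inner ℝ (v i) y ^ 2 + 2 * dist (w i) (v i) * ‖y‖ ^ 2 := by
    intro i
    have e1 : |inner ℝ (w i) y| ≤ ‖y‖ := by
      simpa [hw.1 i] using abs_real_inner_le_norm (w i) y
    have e2 : |inner ℝ (v i) y| ≤ ‖y‖ := by
      simpa [hv.1 i] using abs_real_inner_le_norm (v i) y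
    have e3 : |inner ℝ (w i) y - inner ℝ (v i) y| ≤ dist (w i) (v i) * ‖y‖ := by
      rw [← inner_sub_left, dist_eq_norm]
      exact abs_real_inner_le_norm _ _
    have e4 : inner ℝ (w i) y ^ 2 - inner ℝ (v i) y ^ 2
        ≤ |inner ℝ (w i) y - inner ℝ (v i) y| * |inner ℝ (w i) y + inner ℝ (v i) y| := by
      rw [← abs_mul]
      refine le_trans (le_of_eq ?_) (le_abs_self _)
      ring
    have e5 : |inner ℝ (w i) y + inner ℝ (v i) y| ≤ 2 * ‖y‖ :=
      (abs_add_le _ _).trans (by linarith)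
    have e6 := mul_le_mul e3 e5 (abs_nonneg _) (by positivity)
    nlinarith
  have h2 : ∑ i ∈ s, 2 * dist (w i) (v i) * ‖y‖ ^ 2 ≤ δ * ‖y‖ ^ 2 := by
    rw [← Finset.sum_mul]
    gcongr
    exact (Finset.sum_le_sum_of_subset_of_nonneg (Finset.subset_univ s)
      fun i _ _ => by positivity).trans h
  have h3 := Finset.sum_le_sum fun i (_ : i ∈ s) => h1 i
  rw [Finset.sum_add_distrib] at h3
  have h4 : (1 - ε) * ‖y‖ ^ 2 ≤ ∑ i ∈ s, inner ℝ (w i) y ^ 2 := hy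
  show (1 - (ε + δ)) * ‖y‖ ^ 2 ≤ _
  linarith

lemma isCompact_setOf_orthonormal : IsCompact {v : Fin q → Vec q | Orthonormal ℝ v} := by
  refine Metric.isCompact_of_isClosed_isBounded ?_ ?_
  · simp only [orthonormal_iff_ite, Set.ofPred_forall]
    exact isClosed_iInter fun i => isClosed_iInter fun j =>
      isClosed_eq (by fun_prop) continuous_const
  · refine (Metric.isBounded_closedBall (x := (0 : Fin q → Vec q)) (r := 1)).subset fun v hv => ?_
    rw [mem_closedBall_zero_iff, pi_norm_le_iff_of_nonneg zero_le_one]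
    exact fun i => (hv.1 i).le

/-- Portmanteau theorem: the mass of a closed set is upper semicontinuous. -/
lemma eventually_measureReal_closed_lt {Q : ProbabilityMeasure (Vec q)} {F : Set (Vec q)}
    (hF : IsClosed F) {c : ℝ} (h : (Q : Measure (Vec q)).real F < c) :
    ∀ᶠ R : ProbabilityMeasure (Vec q) in 𝓝 Q, (R : Measure (Vec q)).real F < c := by
  have h0 : (Q : Measure (Vec q)) F < ENNReal.ofReal c := by
    rw [← ofReal_measureReal (measure_ne_top _ _)]
    exact (ENNReal.ofReal_lt_ofReal_iff (measureReal_nonneg.trans_lt h)).2 h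
  have h1 := (ProbabilityMeasure.limsup_measure_closed_le_of_tendsto
    (tendsto_id (x := 𝓝 Q)) hF).trans_lt h0
  filter_upwards [eventually_lt_of_limsup_lt h1] with R hR
  exact (ENNReal.lt_ofReal_iff_toReal_lt (measure_ne_top _ _)).1 hR

/-- As the aperture shrinks, the cones decrease to the subspace, whose mass is strictly below the
allowed value. The aperture 2ε leaves room for a later perturbation of the frame by ε. -/
lemma exists_measureReal_coneAround_lt {Q : ProbabilityMeasure (Vec q)} (hQ : Q ∈ tylerDomain q)
    {v : Fin q → Vec q} (hv : Orthonormal ℝ v) {s : Finset (Fin q)} (hs : 1 ≤ s.card)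
    (hs' : s.card < q) :
    ∃ ε : ℝ, 0 < ε ∧ (Q : Measure (Vec q)).real (coneAround v s (2 * ε))
      < (s.card : ℝ) / q - ε := by
  set W := Submodule.span ℝ (v '' s) with hW
  have hrank : Module.finrank ℝ W = s.card := by
    classical
    have h1 := finrank_span_eq_card (R := ℝ) (b := fun i : s => v i)
      (hv.linearIndependent.comp _ Subtype.val_injective)
    have h2 : (Set.range fun i : s => v i) = v '' s := by ext z; simp
    rw [h2, Fintype.card_coe] at h1
    exact h1
  have hlt := hQ.2 W (by omega) (by omega)
  rw [hrank] at hlt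
  have hlim : Tendsto (fun n : ℕ => (Q : Measure (Vec q)) (coneAround v s (2 / ((n : ℝ) + 1))))
      atTop (𝓝 ((Q : Measure (Vec q)) (⋂ n : ℕ, coneAround v s (2 / ((n : ℝ) + 1))))) := by
    refine tendsto_measure_iInter_atTop
      (fun n => (isClosed_coneAround _ _ _).measurableSet.nullMeasurableSet) (fun n m hnm => ?_)
      ⟨0, measure_ne_top _ _⟩
    exact coneAround_mono (by gcongr)
  have hlim0 : Tendsto (fun n : ℕ => 2 / ((n : ℝ) + 1)) atTop (𝓝 0) :=
    tendsto_const_nhds.div_atTop (tendsto_atTop_add_const_right _ 1 tendsto_natCast_atTop_atTop)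
  have hle : (⋂ n : ℕ, coneAround v s (2 / ((n : ℝ) + 1))) ⊆ (W : Set (Vec q)) := by
    intro y hy
    refine mem_span_of_mem_coneAround_zero hv ?_
    have h1 : Tendsto (fun n : ℕ => (1 - 2 / ((n : ℝ) + 1)) * ‖y‖ ^ 2) atTop
        (𝓝 ((1 - 0) * ‖y‖ ^ 2)) := (hlim0.const_sub 1).mul_const _
    rw [sub_zero, one_mul] at h1
    exact le_of_tendsto' h1 fun n => Set.mem_iInter.1 hy n
  have hlim2 : Tendsto (fun n : ℕ =>
      (Q : Measure (Vec q)).real (coneAround v s (2 / ((n : ℝ) + 1)))) atTop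
      (𝓝 ((Q : Measure (Vec q)).real (⋂ n : ℕ, coneAround v s (2 / ((n : ℝ) + 1))))) :=
    (ENNReal.tendsto_toReal (measure_ne_top _ _)).comp hlim
  have h3 := hlim2.add (tendsto_one_div_add_atTop_nhds_zero_nat (𝕜 := ℝ))
  rw [add_zero] at h3
  obtain ⟨n, hn⟩ := (h3.eventually_lt_const
    ((measureReal_mono hle (measure_ne_top _ _)).trans_lt hlt)).exists
  refine ⟨1 / ((n : ℝ) + 1), by positivity, ?_⟩
  rw [mul_one_div]
  linarith

/-- Near a distribution in the domain of Tyler's functional, the masses of cones around subspaces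
are uniformly bounded. -/
lemma eventually_measureReal_coneAround_le {Q : ProbabilityMeasure (Vec q)}
    (hQ : Q ∈ tylerDomain q) :
    ∃ ε : ℝ, 0 < ε ∧ ε < 1 ∧ ∀ᶠ R : ProbabilityMeasure (Vec q) in 𝓝 Q,
      ∀ s : Finset (Fin q), 1 ≤ s.card → s.card < q → ∀ v : Fin q → Vec q, Orthonormal ℝ v →
        (R : Measure (Vec q)).real (coneAround v s ε) ≤ (s.card : ℝ) / q - ε := by
  -- The aperture is treated as a second variable tending to zero, so that one compactness argument
  -- yields both the neighbourhood of Q and a common ε.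
  have key : ∀ᶠ p : ProbabilityMeasure (Vec q) × ℝ in 𝓝 (Q, 0),
      ∀ s : Finset (Fin q), 1 ≤ s.card → s.card < q → ∀ v ∈ {v : Fin q → Vec q | Orthonormal ℝ v},
        Orthonormal ℝ v →
        (p.1 : Measure (Vec q)).real (coneAround v s p.2) ≤ (s.card : ℝ) / q - p.2 := by
    rw [eventually_all]
    intro s
    by_cases hs : 1 ≤ s.card ∧ s.card < q
    swap
    · exact Eventually.of_forall fun p h1 h2 => absurd ⟨h1, h2⟩ hs
    -- Neighbourhoods of a frame contain non-orthonormal families, so orthonormality is kept as a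
    -- premise of the local property.
    refine (isCompact_setOf_orthonormal.eventually_forall_of_forall_eventually
      (P := fun (p : ProbabilityMeasure (Vec q) × ℝ) v => Orthonormal ℝ v →
        (p.1 : Measure (Vec q)).real (coneAround v s p.2) ≤ (s.card : ℝ) / q - p.2)
      fun v hv => ?_).mono fun p hp _ _ => hp
    obtain ⟨ε, hε, hlt⟩ := exists_measureReal_coneAround_lt hQ hv hs.1 hs.2
    have h1 : ∀ᶠ z : (ProbabilityMeasure (Vec q) × ℝ) × (Fin q → Vec q) in 𝓝 ((Q, 0), v),
        (z.1.1 : Measure (Vec q)).real (coneAround v s (2 * ε)) < (s.card : ℝ) / q - ε :=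
      (continuous_fst.fst.tendsto ((Q, (0 : ℝ)), v)).eventually
        (eventually_measureReal_closed_lt (isClosed_coneAround _ _ _) hlt)
    have h2 : ∀ᶠ z : (ProbabilityMeasure (Vec q) × ℝ) × (Fin q → Vec q) in 𝓝 ((Q, 0), v),
        z.1.2 < ε :=
      (continuous_fst.snd.tendsto ((Q, (0 : ℝ)), v)).eventually_lt_const hε
    have h3 : ∀ᶠ z : (ProbabilityMeasure (Vec q) × ℝ) × (Fin q → Vec q) in 𝓝 ((Q, 0), v),
        ∑ i, 2 * dist (z.2 i) (v i) < ε := by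
      have hc : Continuous fun z : (ProbabilityMeasure (Vec q) × ℝ) × (Fin q → Vec q) =>
          ∑ i, 2 * dist (z.2 i) (v i) := by fun_prop
      exact (hc.tendsto ((Q, (0 : ℝ)), v)).eventually_lt_const (by simpa using hε)
    filter_upwards [h1, h2, h3] with z h1 h2 h3 hz
    have hsub : coneAround z.2 s z.1.2 ⊆ coneAround v s (2 * ε) :=
      (coneAround_subset_of_dist_le hv hz h3.le).trans (coneAround_mono (by linarith))
    have h4 := measureReal_mono (μ := (z.1.1 : Measure (Vec q))) hsub (measure_ne_top _ _)
    linarith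
  rw [nhds_prod_eq] at key
  obtain ⟨p, hp, r, hr, h⟩ := eventually_prod_iff.1 key
  have hr' : ∀ᶠ ε in 𝓝[>] (0 : ℝ), r ε ∧ 0 < ε ∧ ε < 1 :=
    (hr.filter_mono nhdsWithin_le_nhds).and (eventually_mem_nhdsWithin.and
      ((tendsto_id.eventually_lt_const one_pos).filter_mono nhdsWithin_le_nhds))
  obtain ⟨ε, hε, hε0, hε1⟩ := hr'.exists
  exact ⟨ε, hε0, hε1, hp.mono fun R hR s h1 h2 v hv => h hR hε s h1 h2 v hv hv⟩

end Concentration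

/-! ### Coercivity of Tyler's criterion. -/

section TylerLogForm

variable {q : ℕ}

/-- The integrand `log (yᵀ C y / yᵀ y)` of Tyler's criterion as a function of `C = A⁻¹`. -/
noncomputable def tylerLog (C : Mat q) (y : Vec q) : ℝ := Real.log (quadForm C y / quadForm 1 y)

/-- The symmetric matrices of determinant one whose spectrum lies in `[exp (-B), exp B]`. -/
def tylerBox (q : ℕ) (B : ℝ) : Set (Mat q) :=
  {C | C.IsSymm ∧ C.det = 1 ∧ ∀ y, Real.exp (-B) * ‖y‖ ^ 2 ≤ quadForm C y ∧
    quadForm C y ≤ Real.exp B * ‖y‖ ^ 2}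

lemma sum_sq_inner_of_orthonormal {v : Fin q → Vec q} (hv : Orthonormal ℝ v) (y : Vec q) :
    ∑ i, inner ℝ (v i) y ^ 2 = ‖y‖ ^ 2 := by
  obtain ⟨b, hb⟩ := Orthonormal.exists_orthonormalBasis_extension_of_card_eq (𝕜 := ℝ)
    (E := Vec q) (ι := Fin q) (by simp) (v := v) (s := Set.univ)
    (hv.comp _ Subtype.val_injective)
  rw [← b.sum_sq_inner_right y]
  exact Finset.sum_congr rfl fun i _ => by rw [hb i (Set.mem_univ i)]

/-- Summation by parts; if the a j sum to zero, only (N + 1) a 0 is left, which cancels the leading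
term in the coercivity bound. -/
lemma sum_sub_succ_mul (a : ℕ → ℝ) (N : ℕ) :
    ∑ j ∈ Finset.range N, (a j - a (j + 1)) * ((N : ℝ) - j)
      = (N + 1) * a 0 - ∑ j ∈ Finset.range (N + 1), a j := by
  induction N with
  | zero => simp
  | succ N ih =>
    have h : ∑ j ∈ Finset.range N, (a j - a (j + 1)) * (((N + 1 : ℕ) : ℝ) - j)
        = ∑ j ∈ Finset.range N, (a j - a (j + 1)) * ((N : ℝ) - j)
          + ∑ j ∈ Finset.range N, (a j - a (j + 1)) := by
      rw [← Finset.sum_add_distrib]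
      exact Finset.sum_congr rfl fun j _ => by push_cast; ring
    rw [Finset.sum_range_succ, h, ih, Finset.sum_range_sub', Finset.sum_range_succ _ (N + 1)]
    push_cast
    ring

open Classical in
-- The events are nested, so the sum telescopes up to the last index J at which p holds.
lemma exists_sum_sub_succ_ite (a : ℕ → ℝ) {p : ℕ → Prop} (hp : Antitone p) (N : ℕ) :
    ∃ J ≤ N, (J = N ∨ ¬ p (J + 1)) ∧
      ∑ j ∈ Finset.range N, (a j - a (j + 1)) * (if p (j + 1) then 1 else 0) = a 0 - a J := by
  induction N with
  | zero => exact ⟨0, le_rfl, Or.inl rfl, by simp⟩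
  | succ N ih =>
    obtain ⟨J, hJ, h1, h2⟩ := ih
    rw [Finset.sum_range_succ, h2]
    by_cases hN : p (N + 1)
    · have hJN : J = N := h1.resolve_right fun h => h (hp (by omega) hN)
      subst hJN
      exact ⟨J + 1, le_rfl, Or.inl rfl, by rw [if_pos hN]; ring⟩
    · rcases h1 with rfl | h1
      · exact ⟨J, by omega, Or.inr hN, by rw [if_neg hN]; ring⟩
      · exact ⟨J, by omega, Or.inr h1, by rw [if_neg hN]; ring⟩

lemma measurable_tylerLog (C : Mat q) : Measurable (tylerLog C) :=
  ((continuous_quadForm C).measurable.div (continuous_quadForm 1).measurable).log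

lemma posDef_of_mem_tylerBox {B : ℝ} {C : Mat q} (h : C ∈ tylerBox q B) : C.PosDef := by
  refine posDef_iff_quadForm.2 ⟨h.1, fun y hy => lt_of_lt_of_le ?_ (h.2.2 y).1⟩
  have := norm_pos_iff.2 hy
  positivity

lemma one_mem_tylerBox {B : ℝ} (hB : 0 ≤ B) : (1 : Mat q) ∈ tylerBox q B := by
  refine ⟨Matrix.transpose_one, Matrix.det_one, fun y => ?_⟩
  rw [quadForm_one]
  have h1 : Real.exp (-B) ≤ 1 := Real.exp_le_one_iff.2 (by linarith)
  have h2 : 1 ≤ Real.exp B := Real.one_le_exp hB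
  have h3 := sq_nonneg ‖y‖
  constructor <;> nlinarith

lemma abs_tylerLog_le {B : ℝ} (hB : 0 ≤ B) {C : Mat q} (h : C ∈ tylerBox q B) (y : Vec q) :
    |tylerLog C y| ≤ B := by
  rcases eq_or_ne y 0 with rfl | hy
  · simpa [tylerLog] using hB
  have hy2 : 0 < ‖y‖ ^ 2 := by have := norm_pos_iff.2 hy; positivity
  have hb := h.2.2 y
  have h1 : Real.exp (-B) ≤ quadForm C y / ‖y‖ ^ 2 := (le_div_iff₀ hy2).2 hb.1
  have h2 : quadForm C y / ‖y‖ ^ 2 ≤ Real.exp B := (div_le_iff₀ hy2).2 hb.2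
  have h0 : 0 < quadForm C y / ‖y‖ ^ 2 := (Real.exp_pos _).trans_le h1
  rw [tylerLog, quadForm_one, abs_le]
  exact ⟨(Real.le_log_iff_exp_le h0).2 h1, (Real.log_le_iff_le_exp h0).2 h2⟩

lemma exists_mem_tylerBox {C : Mat q} (hC : C.PosDef) (hdet : C.det = 1) :
    ∃ B, 0 ≤ B ∧ C ∈ tylerBox q B := by
  obtain ⟨v, a, hv, -, -, hrep⟩ := exists_sorted_spectral hC hdet
  obtain ⟨B, hB⟩ := (Set.finite_range fun i => |a i|).bddAbove
  refine ⟨max B 0, le_max_right _ _, (posDef_iff_quadForm.1 hC).1, hdet, fun y => ?_⟩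
  have ha : ∀ i, |a i| ≤ max B 0 := fun i => (hB ⟨i, rfl⟩).trans (le_max_left _ _)
  rw [hrep, ← sum_sq_inner_of_orthonormal hv y, Finset.mul_sum, Finset.mul_sum]
  constructor <;> refine Finset.sum_le_sum fun i _ => ?_ <;> gcongr
  · linarith [(abs_le.1 (ha i)).1]
  · exact (abs_le.1 (ha i)).2

lemma integrable_tylerLog {C : Mat q} (hC : C.PosDef) (hdet : C.det = 1)
    (R : ProbabilityMeasure (Vec q)) : Integrable (tylerLog C) (R : Measure (Vec q)) := by
  obtain ⟨B, hB, h⟩ := exists_mem_tylerBox hC hdet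
  exact Integrable.of_bound (measurable_tylerLog C).aestronglyMeasurable B
    (ae_of_all _ (abs_tylerLog_le hB h))

open Classical in
-- Let J be the last index for which y lies in the cone around the span of v i, i ≥ J. Then at least
-- ε‖y‖² of its squared norm is carried by v 0, …, v J, where the eigenvalues are at least exp (a
-- J). The telescoping sum of indicators equals a 0 - a J.
lemma le_tylerLog_of_sorted {C : Mat q} {v : Fin q → Vec q} {a : ℕ → ℝ} (hv : Orthonormal ℝ v)
    (ha : Antitone a) (hrep : ∀ y, quadForm C y = ∑ i : Fin q, Real.exp (a i) * inner ℝ (v i) y ^ 2)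
    {ε : ℝ} (hε : 0 < ε) (hε1 : ε < 1) {y : Vec q} (hy : y ≠ 0) :
    Real.log ε + a 0 - ∑ j ∈ Finset.range (q - 1), (a j - a (j + 1)) *
      (if y ∈ coneAround v {i : Fin q | j + 1 ≤ i} ε then 1 else 0) ≤ tylerLog C y := by
  have hy2 : 0 < ‖y‖ ^ 2 := by have := norm_pos_iff.2 hy; positivity
  obtain ⟨J, hJ, h1, h2⟩ := exists_sum_sub_succ_ite a
    (p := fun j => y ∈ coneAround v {i : Fin q | j ≤ i} ε) (fun i j hij h => by
      refine le_trans (show (1 - ε) * ‖y‖ ^ 2 ≤ _ from h) ?_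
      refine Finset.sum_le_sum_of_subset_of_nonneg (fun k hk => ?_) fun _ _ _ => sq_nonneg _
      simp only [Finset.mem_filter, Finset.mem_univ, true_and] at hk ⊢
      omega) (q - 1)
  rw [h2]
  have h3 : y ∉ coneAround v {i : Fin q | J + 1 ≤ i} ε := by
    rcases h1 with rfl | h1
    · have : ({i : Fin q | q - 1 + 1 ≤ i} : Finset (Fin q)) = ∅ := by
        ext i; simp; omega
      rw [this]
      simp only [coneAround, Finset.sum_empty, Set.mem_ofPred_eq, not_le]
      have : 0 < 1 - ε := by linarith
      positivity
    · exact h1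
  have h4 : ∑ i ∈ {i : Fin q | J + 1 ≤ i}, inner ℝ (v i) y ^ 2 < (1 - ε) * ‖y‖ ^ 2 := by
    simpa only [coneAround, Set.mem_ofPred_eq, not_le] using h3
  have h5 := Finset.sum_filter_add_sum_filter_not Finset.univ (fun i : Fin q => J + 1 ≤ (i : ℕ))
    fun i => inner ℝ (v i) y ^ 2
  rw [sum_sq_inner_of_orthonormal hv] at h5
  have h6 : Real.exp (a J) * (ε * ‖y‖ ^ 2) ≤ quadForm C y := by
    rw [hrep]
    calc _ ≤ Real.exp (a J) * ∑ i ∈ {i : Fin q | ¬ (J + 1 ≤ i)}, inner ℝ (v i) y ^ 2 := by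
          gcongr
          linarith
      _ ≤ ∑ i ∈ {i : Fin q | ¬ (J + 1 ≤ i)}, Real.exp (a i) * inner ℝ (v i) y ^ 2 := by
          rw [Finset.mul_sum]
          refine Finset.sum_le_sum fun i hi => ?_
          simp only [Finset.mem_filter, Finset.mem_univ, true_and] at hi
          gcongr
          exact ha (by omega)
      _ ≤ _ := Finset.sum_le_sum_of_subset_of_nonneg (Finset.filter_subset _ _)
          fun _ _ _ => by positivity
  have h7 : Real.exp (Real.log ε + a J) ≤ quadForm C y / quadForm 1 y := by
    rw [quadForm_one, le_div_iff₀ hy2, Real.exp_add, Real.exp_log hε]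
    linarith
  have h8 := (Real.le_log_iff_exp_le ((Real.exp_pos _).trans_le h7)).2 h7
  rw [tylerLog]
  linarith

/-- Tyler's criterion is coercive, with constants depending only on bounds for the masses of
cones. -/
lemma le_integral_tylerLog {R : ProbabilityMeasure (Vec q)} (hR : (R : Measure (Vec q)) {0} = 0)
    {ε : ℝ} (hε : 0 < ε) (hε1 : ε < 1)
    (hcone : ∀ s : Finset (Fin q), 1 ≤ s.card → s.card < q → ∀ v : Fin q → Vec q, Orthonormal ℝ v →
        (R : Measure (Vec q)).real (coneAround v s ε) ≤ (s.card : ℝ) / q - ε)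
    (hq : 1 ≤ q) {C : Mat q} (hC : C.PosDef) (hdet : C.det = 1) {v : Fin q → Vec q} {a : ℕ → ℝ}
    (hv : Orthonormal ℝ v) (ha : Antitone a) (ha0 : ∑ i ∈ Finset.range q, a i = 0)
    (hrep : ∀ y, quadForm C y = ∑ i : Fin q, Real.exp (a i) * inner ℝ (v i) y ^ 2) :
    Real.log ε + ε * (a 0 - a (q - 1)) ≤ ∫ y, tylerLog C y ∂(R : Measure (Vec q)) := by
  classical
  set F : ℕ → Set (Vec q) := fun j => coneAround v {i : Fin q | j + 1 ≤ i} ε with hF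
  have hFm : ∀ j, MeasurableSet (F j) := fun j => (isClosed_coneAround _ _ _).measurableSet
  have hint : ∀ j, ∫ y, (if y ∈ F j then (1 : ℝ) else 0) ∂(R : Measure (Vec q))
      = (R : Measure (Vec q)).real (F j) := fun j => by
    rw [← integral_indicator_one (hFm j)]
    rfl
  have hi : ∀ j, Integrable (fun y => if y ∈ F j then (1 : ℝ) else 0) (R : Measure (Vec q)) :=
    fun j => (integrable_const (1 : ℝ)).indicator (hFm j)
  have hi2 : Integrable (fun y => ∑ j ∈ Finset.range (q - 1), (a j - a (j + 1)) *
      (if y ∈ F j then (1 : ℝ) else 0)) (R : Measure (Vec q)) :=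
    integrable_finsetSum _ fun j _ => (hi j).const_mul _
  have h1 : ∫ y, (Real.log ε + a 0 - ∑ j ∈ Finset.range (q - 1), (a j - a (j + 1)) *
      (if y ∈ F j then (1 : ℝ) else 0)) ∂(R : Measure (Vec q))
      ≤ ∫ y, tylerLog C y ∂(R : Measure (Vec q)) := by
    refine integral_mono_ae ((integrable_const _).sub hi2) (integrable_tylerLog hC hdet R) ?_
    have h0 : ∀ᵐ y ∂(R : Measure (Vec q)), y ≠ 0 := by rw [ae_iff]; simpa using hR
    filter_upwards [h0] with y hy
    exact le_tylerLog_of_sorted hv ha hrep hε hε1 hy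
  refine le_trans ?_ h1
  rw [integral_sub (integrable_const _) hi2, integral_finsetSum _ fun j _ => (hi j).const_mul _]
  simp only [integral_const_mul, hint, integral_const, probReal_univ, one_smul]
  -- The j-th cone surrounds a subspace of dimension q - 1 - j. The main parts of these bounds sum
  -- to a 0 and cancel it; the margins ε telescope to ε (a 0 - a (q - 1)).
  have h2 : ∀ j ∈ Finset.range (q - 1), (a j - a (j + 1)) * (R : Measure (Vec q)).real (F j)
      ≤ (a j - a (j + 1)) * (((q - 1 : ℕ) : ℝ) - j) / q - ε * (a j - a (j + 1)) := by
    intro j hj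
    rw [Finset.mem_range] at hj
    have hcard : ({i : Fin q | j + 1 ≤ i} : Finset (Fin q)).card = q - 1 - j := by
      have : ({i : Fin q | j + 1 ≤ i} : Finset (Fin q)) = Finset.Ici ⟨j + 1, by omega⟩ := by
        ext i
        simp [Fin.le_def]
      rw [this, Fin.card_Ici]
      simp
      omega
    have h3 := hcone {i : Fin q | j + 1 ≤ i} (by omega) (by omega) v hv
    rw [hcard, Nat.cast_sub (by omega)] at h3
    have h4 : 0 ≤ a j - a (j + 1) := sub_nonneg.2 (ha (Nat.le_succ j))
    calc _ ≤ (a j - a (j + 1)) * ((((q - 1 : ℕ) : ℝ) - j) / q - ε) :=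
          mul_le_mul_of_nonneg_left h3 h4
      _ = _ := by ring
  have h3 := Finset.sum_le_sum h2
  rw [Finset.sum_sub_distrib, ← Finset.sum_div, sum_sub_succ_mul, ← Finset.mul_sum,
    Finset.sum_range_sub', Nat.sub_add_cancel hq, ha0, sub_zero, Nat.cast_sub hq, Nat.cast_one,
    sub_add_cancel, mul_div_cancel_left₀ _ (by positivity : (q : ℝ) ≠ 0)] at h3
  linarith

/-- Coercivity bounds the spread of the logarithmic eigenvalues by -log ε / ε. Since they sum to
zero, the smallest is nonpositive and the largest nonnegative, so each is bounded by the spread. -/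
lemma mem_tylerBox_of_integral_nonpos {R : ProbabilityMeasure (Vec q)}
    (hR : (R : Measure (Vec q)) {0} = 0)
    {ε : ℝ} (hε : 0 < ε) (hε1 : ε < 1)
    (hcone : ∀ s : Finset (Fin q), 1 ≤ s.card → s.card < q → ∀ v : Fin q → Vec q, Orthonormal ℝ v →
        (R : Measure (Vec q)).real (coneAround v s ε) ≤ (s.card : ℝ) / q - ε)
    (hq : 1 ≤ q) {C : Mat q} (hC : C.PosDef) (hdet : C.det = 1)
    (hf : ∫ y, tylerLog C y ∂(R : Measure (Vec q)) ≤ 0) : C ∈ tylerBox q (-Real.log ε / ε) := by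
  obtain ⟨v, a, hv, ha, ha0, hrep⟩ := exists_sorted_spectral hC hdet
  -- Extension to all natural numbers by the last value, which preserves monotonicity.
  let α : ℕ → ℝ := fun j => a ⟨min j (q - 1), by omega⟩
  have hαa : ∀ i : Fin q, α i = a i := fun i => by
    simp only [α]
    congr 1
    ext
    simp
    omega
  have hα : Antitone α := fun i j hij => ha (by
    rw [Fin.le_def]
    exact min_le_min_right _ hij)
  have hα0 : ∑ i ∈ Finset.range q, α i = 0 := by
    rw [← Fin.sum_univ_eq_sum_range α q, ← ha0]
    exact Finset.sum_congr rfl fun i _ => hαa i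
  have h1 := (le_integral_tylerLog hR hε hε1 hcone hq hC hdet hv hα hα0
    (by simpa only [hαa] using hrep)).trans hf
  have h2 : α 0 - α (q - 1) ≤ -Real.log ε / ε := by
    rw [le_div_iff₀ hε]
    linarith
  have h3 : ∀ i ∈ Finset.range q, α (q - 1) ≤ α i := fun i hi => hα (by
    rw [Finset.mem_range] at hi; omega)
  have h4 : ∀ i ∈ Finset.range q, α i ≤ α 0 := fun i _ => hα (Nat.zero_le i)
  have hq0 : (0 : ℝ) < q := by exact_mod_cast hq
  have h5 : α (q - 1) ≤ 0 := by
    have := Finset.card_nsmul_le_sum _ _ _ h3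
    rw [hα0, Finset.card_range, nsmul_eq_mul] at this
    by_contra hc
    nlinarith [not_le.1 hc]
  have h6 : 0 ≤ α 0 := by
    have := Finset.sum_le_card_nsmul _ _ _ h4
    rw [hα0, Finset.card_range, nsmul_eq_mul] at this
    by_contra hc
    nlinarith [not_le.1 hc]
  refine ⟨(posDef_iff_quadForm.1 hC).1, hdet, fun y => ?_⟩
  rw [hrep, ← sum_sq_inner_of_orthonormal hv y, Finset.mul_sum, Finset.mul_sum]
  constructor <;> refine Finset.sum_le_sum fun i _ => ?_ <;> gcongr <;> rw [← hαa]
  · have := h3 i (Finset.mem_range.2 i.2)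
    linarith
  · have := h4 i (Finset.mem_range.2 i.2)
    linarith

end TylerLogForm

/-! ### The derivative of the determinant at the identity. -/

section Determinant

variable {q : ℕ}

lemma tendsto_of_forall_entry {α : Type*} {l : Filter α} {f : α → Mat q} {A : Mat q}
    (h : ∀ i j, Tendsto (fun x => f x i j) l (𝓝 (A i j))) : Tendsto f l (𝓝 A) := by
  have h1 : ∀ B : Mat q, B = ∑ i, ∑ j, B i j • Matrix.single i j (1 : ℝ) := fun B => by
    conv_lhs => rw [Matrix.matrix_eq_sum_single B]
    simp [Matrix.smul_single]
  rw [h1 A, show f = fun x => ∑ i, ∑ j, f x i j • Matrix.single i j (1 : ℝ) from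
    funext fun x => h1 (f x)]
  exact tendsto_finsetSum _ fun i _ => tendsto_finsetSum _ fun j _ => (h i j).smul_const _

lemma continuous_of_forall_entry {α : Type*} [TopologicalSpace α] {f : α → Mat q}
    (h : ∀ i j, Continuous fun x => f x i j) : Continuous f :=
  continuous_iff_continuousAt.2 fun x => tendsto_of_forall_entry fun i j => (h i j).tendsto x

lemma contDiff_det : ContDiff ℝ 1 fun A : Mat q => A.det := by
  simp only [Matrix.det_apply']
  refine ContDiff.sum fun σ _ => contDiff_const.mul (contDiff_prod fun i _ => ?_)
  exact (entryCLM (σ i) i).contDiff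

/-- The trace of the product with a fixed matrix, as a continuous linear functional. -/
noncomputable def traceMulCLM (E : Mat q) : Mat q →L[ℝ] ℝ :=
  LinearMap.toContinuousLinearMap (Matrix.traceLinearMap (Fin q) ℝ ℝ ∘ₗ LinearMap.mulLeft ℝ E)

@[simp]
lemma traceMulCLM_apply (E A : Mat q) : traceMulCLM E A = (E * A).trace := rfl

/-- The determinant is polynomial, hence differentiable, and its directional derivatives are read
off from det(1 + tX) = 1 + t tr X + t² p(t). -/
lemma hasFDerivAt_det_one : HasFDerivAt (fun A : Mat q => A.det) (traceMulCLM 1) 1 := by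
  have h := ((contDiff_det (q := q)).differentiable one_ne_zero 1).hasFDerivAt
  convert! h using 1
  ext X
  have h1 : HasDerivAt (fun t : ℝ => ((1 : Mat q) + t • X).det)
      (fderiv ℝ (fun A : Mat q => A.det) 1 X) 0 := by
    have h2 : HasDerivAt (fun t : ℝ => (1 : Mat q) + t • X) X 0 := by
      simpa using ((hasDerivAt_id (0 : ℝ)).smul_const X).const_add (1 : Mat q)
    have h3 : HasFDerivAt (fun A : Mat q => A.det) (fderiv ℝ (fun A : Mat q => A.det) 1)
        ((1 : Mat q) + (0 : ℝ) • X) := by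
      rwa [zero_smul, add_zero]
    exact h3.comp_hasDerivAt (f := fun t : ℝ => (1 : Mat q) + t • X) 0 h2
  set p : Polynomial ℝ := (1 + (Polynomial.X : Polynomial ℝ) • X.map Polynomial.C).det.divX.divX
  have h3 : HasDerivAt (fun t : ℝ => 1 + X.trace * t + p.eval t * t ^ 2)
      (X.trace + ((p.derivative.eval 0) * 0 ^ 2 + p.eval 0 * (2 * 0))) 0 := by
    have e1 : HasDerivAt (fun t : ℝ => 1 + X.trace * t) X.trace 0 := by
      simpa using ((hasDerivAt_id (0 : ℝ)).const_mul X.trace).const_add 1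
    have e2 : HasDerivAt (fun t : ℝ => t ^ 2) (2 * 0) (0 : ℝ) := by
      simpa using hasDerivAt_pow 2 (0 : ℝ)
    exact e1.add ((p.hasDerivAt 0).mul e2)
  have h4 : (fun t : ℝ => ((1 : Mat q) + t • X).det)
      = fun t : ℝ => 1 + X.trace * t + p.eval t * t ^ 2 := by
    funext t
    exact Matrix.det_one_add_smul t X
  rw [h4] at h1
  have := h1.unique h3
  simp only [traceMulCLM_apply, one_mul]
  rw [this]
  ring

end Determinant

/-! ### Existence of Tyler's minimizer. -/

section TylerExistence

variable {q : ℕ}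

/-- Polarization: the forms at e_k ± e_l differ by 4 A k l, and each is at most 4c in absolute
value. -/
lemma abs_entry_le_of_forall_quadForm_le {A : Mat q} (hA : A.IsSymm) {c : ℝ}
    (h : ∀ y, |quadForm A y| ≤ c * ‖y‖ ^ 2) (k l : Fin q) : |A k l| ≤ 2 * c := by
  have hc : 0 ≤ c := by
    have := (abs_nonneg _).trans (h (EuclideanSpace.single k 1))
    simpa using this
  have hq : ∀ s : ℝ, quadForm A (EuclideanSpace.single k 1 + s • EuclideanSpace.single l 1)
      = A k k + 2 * s * A k l + s ^ 2 * A l l := by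
    intro s
    have := hA.apply k l
    simp only [quadForm, WithLp.ofLp_add, WithLp.ofLp_smul, Matrix.mulVec_add, Matrix.mulVec_smul,
      add_dotProduct, dotProduct_add, smul_dotProduct, dotProduct_smul, PiLp.ofLp_single,
      Matrix.mulVec_single_one, single_one_dotProduct, Matrix.col_apply, smul_eq_mul]
    rw [this]
    ring
  have hn : ∀ s : ℝ, |s| = 1 →
      ‖(EuclideanSpace.single k 1 + s • EuclideanSpace.single l 1 : Vec q)‖ ^ 2 ≤ 4 := by
    intro s hs
    have h1 : ‖(EuclideanSpace.single k 1 + s • EuclideanSpace.single l 1 : Vec q)‖ ≤ 2 := by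
      refine (norm_add_le _ _).trans ?_
      rw [norm_smul, Real.norm_eq_abs, hs]
      simp
      norm_num
    nlinarith [norm_nonneg (EuclideanSpace.single k 1 + s • EuclideanSpace.single l 1 : Vec q)]
  have h1 := (h _).trans (mul_le_mul_of_nonneg_left (hn 1 (by simp)) hc)
  have h2 := (h _).trans (mul_le_mul_of_nonneg_left (hn (-1) (by simp)) hc)
  rw [hq] at h1 h2
  have h1' := abs_le.1 h1
  have h2' := abs_le.1 h2
  rw [abs_le]
  constructor <;> linarith

lemma isCompact_tylerBox (B : ℝ) : IsCompact (tylerBox q B) := by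
  have := FiniteDimensional.proper ℝ (Mat q)
  refine Metric.isCompact_of_isClosed_isBounded ?_ ?_
  · have h1 : IsClosed {C : Mat q | C.IsSymm} := by
      have : {C : Mat q | C.IsSymm} = ⋂ i, ⋂ j, {C : Mat q | C j i = C i j} := by
        ext C
        simp only [Set.mem_ofPred_eq, Set.mem_iInter]
        exact ⟨fun h i j => h.apply i j, fun h => Matrix.IsSymm.ext fun i j => h i j⟩
      rw [this]
      exact isClosed_iInter fun i => isClosed_iInter fun j =>
        isClosed_eq (continuous_entry j i) (continuous_entry i j)
    have h2 : IsClosed {C : Mat q | C.det = 1} :=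
      isClosed_eq contDiff_det.continuous continuous_const
    have h3 : IsClosed {C : Mat q | ∀ y, Real.exp (-B) * ‖y‖ ^ 2 ≤ quadForm C y ∧
        quadForm C y ≤ Real.exp B * ‖y‖ ^ 2} := by
      rw [Set.ofPred_forall]
      exact isClosed_iInter fun y =>
        (isClosed_le continuous_const (continuous_quadForm_left y)).inter
          (isClosed_le (continuous_quadForm_left y) continuous_const)
    exact h1.inter (h2.inter h3)
  · rw [isBounded_iff_forall_norm_le]
    refine ⟨√(∑ _k : Fin q, ∑ _l : Fin q, (2 * Real.exp B) ^ 2), fun C hC => ?_⟩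
    refine Real.le_sqrt_of_sq_le ?_
    rw [frobenius_norm_sq]
    refine Finset.sum_le_sum fun k _ => Finset.sum_le_sum fun l _ => ?_
    rw [← sq_abs]
    refine pow_le_pow_left₀ (abs_nonneg _)
      (abs_entry_le_of_forall_quadForm_le hC.1 (fun y => ?_) k l) 2
    rw [abs_of_nonneg ((by positivity : (0 : ℝ) ≤ Real.exp (-B) * ‖y‖ ^ 2).trans (hC.2.2 y).1)]
    exact (hC.2.2 y).2

lemma continuousOn_integral_tylerLog {B : ℝ} (hB : 0 ≤ B) (R : ProbabilityMeasure (Vec q)) :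
    ContinuousOn (fun C => ∫ y, tylerLog C y ∂(R : Measure (Vec q))) (tylerBox q B) := by
  refine continuousOn_of_dominated (bound := fun _ => B)
    (fun C _ => (measurable_tylerLog C).aestronglyMeasurable)
    (fun C hC => ae_of_all _ (abs_tylerLog_le hB hC)) (integrable_const B) (ae_of_all _ fun y => ?_)
  rcases eq_or_ne y 0 with rfl | hy
  · simp [tylerLog, continuousOn_const]
  · refine ContinuousOn.log ((continuous_quadForm_left y).div_const _).continuousOn fun C hC => ?_
    have h1 := (posDef_iff_quadForm.1 (posDef_of_mem_tylerBox hC)).2 y hy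
    have h2 := norm_pos_iff.2 hy
    rw [quadForm_one]
    positivity

/-- `C` minimizes `∫ log (yᵀ C y / yᵀ y) R(dy)` over the positive definite matrices of determinant
one. -/
def IsPrecisionMinimizer (R : ProbabilityMeasure (Vec q)) (C : Mat q) : Prop :=
  (C.PosDef ∧ C.det = 1) ∧ ∀ C' : Mat q, C'.PosDef → C'.det = 1 →
    ∫ y, tylerLog C y ∂(R : Measure (Vec q)) ≤ ∫ y, tylerLog C' y ∂(R : Measure (Vec q))

lemma integral_tylerLog_one (R : ProbabilityMeasure (Vec q)) :
    ∫ y, tylerLog 1 y ∂(R : Measure (Vec q)) = 0 := by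
  have : ∀ y : Vec q, tylerLog 1 y = 0 := fun y => by
    rw [tylerLog]
    by_cases h : quadForm 1 y = 0
    · simp [h]
    · rw [div_self h, Real.log_one]
  simp [this]

/-- Outside the compact box the criterion is positive, while at the identity it is zero. A minimizer
over the box is therefore a global one. -/
lemma exists_isPrecisionMinimizer (hq : 1 ≤ q) {R : ProbabilityMeasure (Vec q)}
    (hR : R ∈ tylerDomain q) : ∃ C, IsPrecisionMinimizer R C := by
  obtain ⟨ε, hε, hε1, hcone⟩ := eventually_measureReal_coneAround_le hR
  have hbox := fun {C : Mat q} => mem_tylerBox_of_integral_nonpos hR.1 hε hε1 hcone.self_of_nhds hq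
    (C := C)
  set B := -Real.log ε / ε
  have hB : 0 ≤ B := div_nonneg (neg_nonneg.2 (Real.log_nonpos hε.le hε1.le)) hε.le
  obtain ⟨C, hC, hmin⟩ := (isCompact_tylerBox B).exists_isMinOn ⟨1, one_mem_tylerBox hB⟩
    (continuousOn_integral_tylerLog hB R)
  refine ⟨C, ⟨posDef_of_mem_tylerBox hC, hC.2.1⟩, fun C' hC' hdet => ?_⟩
  rcases le_total (∫ y, tylerLog C' y ∂(R : Measure (Vec q))) 0 with h | h
  · exact hmin (hbox hC' hdet h)
  · have h1 := hmin (one_mem_tylerBox hB)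
    simp only [Set.mem_ofPred_eq, integral_tylerLog_one] at h1
    exact h1.trans h

lemma det_inv_eq_one {A : Mat q} (h : A.det = 1) : (A⁻¹).det = 1 := by
  rw [Matrix.det_nonsing_inv, h]
  simp

/-- On matrices of determinant one the log det term vanishes, and inversion is a bijection. The
inverse C = A⁻¹ enters the criterion linearly inside the logarithm and is used from here on. -/
lemma isTylerMinimizer_iff (hq : 1 ≤ q) {R : ProbabilityMeasure (Vec q)} {A : Mat q} :
    IsTylerMinimizer R A ↔ IsPrecisionMinimizer R A⁻¹ := by
  have hq0 : (0 : ℝ) < q := by exact_mod_cast hq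
  have hcrit : ∀ B : Mat q, B.det = 1 → tylerCriterion B R
      = q * ∫ y, tylerLog B⁻¹ y ∂(R : Measure (Vec q)) := fun B hB => by
    rw [tylerCriterion, hB, Real.log_one, add_zero]
    rfl
  constructor
  · rintro ⟨⟨h1, h2⟩, h3⟩
    refine ⟨⟨h1.inv, det_inv_eq_one h2⟩, fun C hC hdet => ?_⟩
    have := h3 C⁻¹ hC.inv (det_inv_eq_one hdet)
    rw [hcrit _ h2, hcrit _ (det_inv_eq_one hdet), Matrix.nonsing_inv_nonsing_inv _
      (by rw [hdet]; exact isUnit_one)] at this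
    exact le_of_mul_le_mul_left this hq0
  · rintro ⟨⟨h1, h2⟩, h3⟩
    have hu : IsUnit A.det := by
      by_contra h
      have : Nonempty (Fin q) := ⟨⟨0, hq⟩⟩
      rw [Matrix.nonsing_inv_apply_not_isUnit _ h, Matrix.det_zero] at h2
      exact zero_ne_one h2
    have hA : A.PosDef := by
      have := h1.inv
      rwa [Matrix.nonsing_inv_nonsing_inv _ hu] at this
    have hd : A.det = 1 := by
      have := det_inv_eq_one h2
      rwa [Matrix.nonsing_inv_nonsing_inv _ hu] at this
    refine ⟨⟨hA, hd⟩, fun B hB hdet => ?_⟩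
    rw [hcrit _ hd, hcrit _ hdet]
    exact mul_le_mul_of_nonneg_left (h3 _ hB.inv (det_inv_eq_one hdet)) hq0.le

lemma isPrecisionMinimizer_inv_tylerMatrix (hq : 1 ≤ q) {R : ProbabilityMeasure (Vec q)}
    (hR : R ∈ tylerDomain q) : IsPrecisionMinimizer R (tylerMatrix R)⁻¹ := by
  obtain ⟨C, hC⟩ := exists_isPrecisionMinimizer hq hR
  have h : ∃ A : Mat q, IsTylerMinimizer R A := by
    refine ⟨C⁻¹, (isTylerMinimizer_iff hq).2 ?_⟩
    rwa [Matrix.nonsing_inv_nonsing_inv _ (by rw [hC.1.2]; exact isUnit_one)]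
  rw [← isTylerMinimizer_iff hq, tylerMatrix, dif_pos h]
  exact h.choose_spec

end TylerExistence

/-! ### The estimating equation. -/

section TylerEquation

variable {q : ℕ}

/-- The matrix `y yᵀ`. -/
noncomputable def outer (y : Vec q) : Mat q := Matrix.vecMulVec y.ofLp y.ofLp

/-- The matrix `q y yᵀ / (yᵀ C y)`. -/
noncomputable def tylerScore (C : Mat q) (y : Vec q) : Mat q := (q / quadForm C y) • outer y

@[simp]
lemma outer_apply (y : Vec q) (k l : Fin q) : outer y k l = y k * y l := rfl

lemma isSymm_outer (y : Vec q) : (outer y).IsSymm := Matrix.IsSymm.ext fun k l => by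
  simp [mul_comm]

lemma continuous_outer : Continuous (outer : Vec q → Mat q) :=
  continuous_of_forall_entry fun k l => by simp only [outer_apply]; fun_prop

lemma trace_mul_outer (E : Mat q) (y : Vec q) : (E * outer y).trace = quadForm E y := by
  rw [quadForm_eq_sum]
  simp only [Matrix.trace, Matrix.diag, Matrix.mul_apply, outer_apply]
  exact Finset.sum_congr rfl fun k _ => Finset.sum_congr rfl fun l _ => by ring

lemma norm_outer (y : Vec q) : ‖outer y‖ = ‖y‖ ^ 2 := by
  rw [← sq_eq_sq₀ (norm_nonneg _) (sq_nonneg _), frobenius_norm_sq,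
    EuclideanSpace.real_norm_sq_eq, sq (∑ i, y i ^ 2), Finset.sum_mul_sum]
  exact Finset.sum_congr rfl fun k _ => Finset.sum_congr rfl fun l _ => by
    rw [outer_apply, mul_pow]

lemma quadForm_outer (x y : Vec q) : quadForm (outer y) x = inner ℝ x y ^ 2 := by
  rw [quadForm, outer, Matrix.vecMulVec_mulVec, EuclideanSpace.inner_eq_star_dotProduct]
  simp [dotProduct_smul, dotProduct_comm, sq]

lemma measurable_tylerScore (C : Mat q) : Measurable (tylerScore C) :=
  (measurable_const.div (continuous_quadForm C).measurable).smul continuous_outer.measurable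

lemma trace_mul_tylerScore (E C : Mat q) (y : Vec q) :
    (E * tylerScore C y).trace = q * (quadForm E y / quadForm C y) := by
  rw [tylerScore, Matrix.mul_smul, Matrix.trace_smul, trace_mul_outer, smul_eq_mul]
  ring

lemma quadForm_tylerScore (C : Mat q) (x y : Vec q) :
    quadForm (tylerScore C y) x = q / quadForm C y * inner ℝ x y ^ 2 := by
  rw [tylerScore, quadForm_smul, quadForm_outer]

lemma norm_tylerScore_le {B : ℝ} {C : Mat q} (hC : C ∈ tylerBox q B) (y : Vec q) :
    ‖tylerScore C y‖ ≤ q * Real.exp B := by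
  rcases eq_or_ne y 0 with rfl | hy
  · simp only [tylerScore, quadForm_zero_right, div_zero, zero_smul, norm_zero]
    positivity
  have hy2 : 0 < ‖y‖ ^ 2 := by have := norm_pos_iff.2 hy; positivity
  have h0 : 0 < quadForm C y := (posDef_iff_quadForm.1 (posDef_of_mem_tylerBox hC)).2 y hy
  rw [tylerScore, norm_smul, norm_outer, Real.norm_of_nonneg (by positivity), div_mul_eq_mul_div,
    div_le_iff₀ h0]
  have h1 := (hC.2.2 y).1
  have h2 : Real.exp B * Real.exp (-B) = 1 := by rw [← Real.exp_add]; simp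
  calc (q : ℝ) * ‖y‖ ^ 2 = q * Real.exp B * (Real.exp (-B) * ‖y‖ ^ 2) := by
        rw [← mul_assoc, mul_assoc (q : ℝ), h2, mul_one]
    _ ≤ _ := by gcongr

lemma integrable_tylerScore {C : Mat q} (hC : C.PosDef) (hdet : C.det = 1)
    (R : ProbabilityMeasure (Vec q)) : Integrable (tylerScore C) (R : Measure (Vec q)) := by
  obtain ⟨B, -, h⟩ := exists_mem_tylerBox hC hdet
  exact Integrable.of_bound (measurable_tylerScore C).aestronglyMeasurable _
    (ae_of_all _ (norm_tylerScore_le h))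

/-- The quadratic form at a vector, as a continuous linear functional. -/
noncomputable def quadFormCLM (x : Vec q) : Mat q →L[ℝ] ℝ :=
  LinearMap.toContinuousLinearMap
    { toFun := fun A => quadForm A x
      map_add' := fun A B => quadForm_add A B x
      map_smul' := fun c A => quadForm_smul c A x }

@[simp]
lemma quadFormCLM_apply (x : Vec q) (A : Mat q) : quadFormCLM x A = quadForm A x := rfl

lemma integrable_quadForm_div {C : Mat q} (hC : C.PosDef) (hdet : C.det = 1) (hq : 1 ≤ q)
    (E : Mat q) (R : ProbabilityMeasure (Vec q)) :
    Integrable (fun y => quadForm E y / quadForm C y) (R : Measure (Vec q)) := by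
  have h := ((traceMulCLM E).integrable_comp (integrable_tylerScore hC hdet R)).const_mul
    ((q : ℝ)⁻¹)
  refine h.congr (ae_of_all _ fun y => ?_)
  have hq0 : (q : ℝ) ≠ 0 := by positivity
  simp only [traceMulCLM_apply, trace_mul_tylerScore]
  field_simp

lemma hasDerivAt_log_det {C : Mat q} (hdet : C.det = 1) (E : Mat q) :
    HasDerivAt (fun t : ℝ => Real.log (C + t • E).det) (C⁻¹ * E).trace 0 := by
  have hu : IsUnit C.det := by rw [hdet]; exact isUnit_one
  have h1 : ∀ t : ℝ, (C + t • E).det = (1 + t • (C⁻¹ * E)).det := fun t => by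
    have : C + t • E = C * (1 + t • (C⁻¹ * E)) := by
      rw [mul_add, mul_one, Matrix.mul_smul, Matrix.mul_nonsing_inv_cancel_left _ _ hu]
    rw [this, Matrix.det_mul, hdet, one_mul]
  simp only [h1]
  have h2 : HasDerivAt (fun t : ℝ => (1 : Mat q) + t • (C⁻¹ * E)) (C⁻¹ * E) 0 := by
    simpa using ((hasDerivAt_id (0 : ℝ)).smul_const (C⁻¹ * E)).const_add (1 : Mat q)
  have h3 : HasFDerivAt (fun A : Mat q => A.det) (traceMulCLM 1)
      ((1 : Mat q) + (0 : ℝ) • (C⁻¹ * E)) := by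
    rw [zero_smul, add_zero]
    exact hasFDerivAt_det_one
  have h4 := (h3.comp_hasDerivAt (f := fun t : ℝ => (1 : Mat q) + t • (C⁻¹ * E)) 0 h2).log
    (by simp)
  simpa using h4

/-- First order condition without differentiating under the integral: log u ≤ u - 1 bounds the
criterion at a perturbation of C by an expression affine in t plus a log det term. Minimality of C
gives this explicit function a local minimum at t = 0, and its derivative there must vanish. -/
lemma integral_quadForm_div_eq_trace (hq : 1 ≤ q) {R : ProbabilityMeasure (Vec q)}
    (hR : (R : Measure (Vec q)) {0} = 0) {C : Mat q} (hmin : IsPrecisionMinimizer R C)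
    {E : Mat q} (hE : E.IsSymm) :
    q * ∫ y, quadForm E y / quadForm C y ∂(R : Measure (Vec q)) = (C⁻¹ * E).trace := by
  obtain ⟨⟨hC, hdet⟩, hle⟩ := hmin
  obtain ⟨B, hB, hbox⟩ := exists_mem_tylerBox hC hdet
  have hq0 : (0 : ℝ) < q := by exact_mod_cast hq
  have hR' : ∀ᵐ y ∂(R : Measure (Vec q)), y ≠ 0 := by rw [ae_iff]; simpa using hR
  set I := ∫ y, quadForm E y / quadForm C y ∂(R : Measure (Vec q)) with hI
  have hpos : ∀ᶠ t : ℝ in 𝓝 0, ∀ y : Vec q, y ≠ 0 → 0 < quadForm (C + t • E) y := by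
    have h1 : ∀ᶠ t : ℝ in 𝓝 0, |t| * ‖E‖ < Real.exp (-B) :=
      (Continuous.tendsto (f := fun t : ℝ => |t| * ‖E‖) (by fun_prop) 0).eventually_lt_const
        (by simpa using Real.exp_pos _)
    filter_upwards [h1] with t ht y hy
    have hy2 : 0 < ‖y‖ ^ 2 := by have := norm_pos_iff.2 hy; positivity
    rw [quadForm_add, quadForm_smul]
    have h2 := (hbox.2.2 y).1
    have h3 := mul_le_mul_of_nonneg_left (abs_quadForm_le E y) (abs_nonneg t)
    rw [← abs_mul] at h3
    have h4 := neg_abs_le (t * quadForm E y)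
    nlinarith
  have hφ : IsLocalMin (fun t : ℝ => t * I - Real.log (C + t • E).det / q) 0 := by
    have hpos' : ∀ᶠ t : ℝ in 𝓝 0, 0 ≤ t * I - Real.log (C + t • E).det / q := by
      filter_upwards [hpos] with t ht
      have hCt : (C + t • E).PosDef :=
        posDef_iff_quadForm.2 ⟨(posDef_iff_quadForm.1 hC).1.add (hE.smul t), ht⟩
      set δ := (C + t • E).det with hδ
      have hδ0 : 0 < δ := hCt.det_pos
      -- The scaling δ^{-1/q} brings the perturbed matrix back to determinant one.
      set c := Real.exp (-(Real.log δ) / q) with hc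
      have hc0 : 0 < c := Real.exp_pos _
      have hC'd : (c • (C + t • E)).det = 1 := by
        rw [Matrix.det_smul, Fintype.card_fin, hc, ← Real.exp_nat_mul, mul_div_cancel₀ _ hq0.ne',
          Real.exp_neg, Real.exp_log hδ0, inv_mul_cancel₀ hδ0.ne']
      have hC' : (c • (C + t • E)).PosDef := hCt.smul hc0
      have h1 := hle _ hC' hC'd
      have h2 : ∫ y, tylerLog (c • (C + t • E)) y ∂(R : Measure (Vec q))
          ≤ ∫ y, ((-(Real.log δ) / q + tylerLog C y) + t * (quadForm E y / quadForm C y))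
            ∂(R : Measure (Vec q)) := by
        refine integral_mono_ae (integrable_tylerLog hC' hC'd R)
          (((integrable_const _).add (integrable_tylerLog hC hdet R)).add
            ((integrable_quadForm_div hC hdet hq E R).const_mul t)) ?_
        filter_upwards [hR'] with y hy
        have p1 := ht y hy
        have p2 := (posDef_iff_quadForm.1 hC).2 y hy
        have p3 : quadForm 1 y ≠ 0 := by
          rw [quadForm_one]
          have := norm_pos_iff.2 hy
          positivity
        rw [tylerLog, tylerLog, quadForm_smul, Real.log_div (by positivity) p3,
          Real.log_mul hc0.ne' p1.ne', hc, Real.log_exp, Real.log_div p2.ne' p3]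
        have h3 := Real.log_le_sub_one_of_pos (div_pos p1 p2)
        rw [Real.log_div p1.ne' p2.ne', quadForm_add, quadForm_smul, add_div, div_self p2.ne'] at h3
        have h4 : t * quadForm E y / quadForm C y = t * (quadForm E y / quadForm C y) :=
          mul_div_assoc _ _ _
        rw [quadForm_add, quadForm_smul]
        linarith
      rw [integral_add (f := fun y => -(Real.log δ) / q + tylerLog C y)
        ((integrable_const _).add (integrable_tylerLog hC hdet R))
        ((integrable_quadForm_div hC hdet hq E R).const_mul t),
        integral_add (integrable_const _) (integrable_tylerLog hC hdet R), integral_const_mul,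
        ← hI] at h2
      simp only [integral_const, probReal_univ, one_smul] at h2
      have h5 : -(Real.log δ) / q = -(Real.log δ / q) := neg_div _ _
      linarith
    filter_upwards [hpos'] with t ht
    simpa [hdet] using ht
  have hd : HasDerivAt (fun t : ℝ => t * I - Real.log (C + t • E).det / q)
      (1 * I - (C⁻¹ * E).trace / q) 0 :=
    ((hasDerivAt_id (0 : ℝ)).mul_const I).sub ((hasDerivAt_log_det hdet E).div_const _)
  have h0 := hφ.hasDerivAt_eq_zero hd
  field_simp at h0
  linarith

lemma isSymm_integral {f : Vec q → Mat q} {R : ProbabilityMeasure (Vec q)}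
    (hf : Integrable f (R : Measure (Vec q))) (hs : ∀ y, (f y).IsSymm) :
    (∫ y, f y ∂(R : Measure (Vec q))).IsSymm := by
  refine Matrix.IsSymm.ext fun k l => ?_
  have h := fun k l => (entryCLM k l).integral_comp_comm hf
  simp only [entryCLM_apply] at h
  rw [← h, ← h]
  congr 1
  funext y
  exact (hs y).apply k l

lemma isSymm_tylerScore (C : Mat q) (y : Vec q) : (tylerScore C y).IsSymm :=
  (isSymm_outer y).smul _

/-- The estimating equation of Tyler's functional. -/
lemma integral_tylerScore_eq_inv (hq : 1 ≤ q) {R : ProbabilityMeasure (Vec q)}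
    (hR : (R : Measure (Vec q)) {0} = 0) {C : Mat q} (hmin : IsPrecisionMinimizer R C) :
    ∫ y, tylerScore C y ∂(R : Measure (Vec q)) = C⁻¹ := by
  have hi := integrable_tylerScore hmin.1.1 hmin.1.2 R
  set D := ∫ y, tylerScore C y ∂(R : Measure (Vec q)) - C⁻¹ with hD
  have hDs : D.IsSymm := (isSymm_integral hi (isSymm_tylerScore C)).sub
    (posDef_iff_quadForm.1 hmin.1.1.inv).1
  -- The weak form of the equation is tested in the direction D itself, which gives ‖D‖² = 0.
  have h1 : (D * D).trace = 0 := by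
    conv_lhs => arg 1; arg 2; rw [hD]
    rw [mul_sub, Matrix.trace_sub, ← traceMulCLM_apply D (∫ y, tylerScore C y ∂_),
      ← (traceMulCLM D).integral_comp_comm hi]
    simp only [traceMulCLM_apply, trace_mul_tylerScore]
    rw [integral_const_mul, integral_quadForm_div_eq_trace hq hR hmin hDs, Matrix.trace_mul_comm,
      sub_self]
  have h2 : ‖D‖ ^ 2 = 0 := by
    rw [frobenius_norm_sq, ← h1]
    simp only [Matrix.trace, Matrix.diag, Matrix.mul_apply]
    exact Finset.sum_congr rfl fun k _ => Finset.sum_congr rfl fun l _ => by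
      rw [sq, hDs.apply]
  exact sub_eq_zero.1 (norm_eq_zero.1 (pow_eq_zero_iff two_ne_zero |>.1 h2))

end TylerEquation

/-! ### The mass argument behind uniqueness and invertibility. -/

section Dichotomy

variable {q : ℕ}

lemma measureReal_submodule_le {R : ProbabilityMeasure (Vec q)} (hR : R ∈ tylerDomain q)
    {W : Submodule ℝ (Vec q)} (hW : Module.finrank ℝ W < q) :
    (R : Measure (Vec q)).real (W : Set (Vec q)) ≤ (Module.finrank ℝ W : ℝ) / q := by
  rcases Nat.eq_zero_or_pos (Module.finrank ℝ W) with h | h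
  · rw [Submodule.finrank_eq_zero.1 h]
    simp [measureReal_def, hR.1]
  · exact (hR.2 W h hW).le

lemma inner_toEuclideanLin (C : Mat q) (y : Vec q) :
    inner ℝ (Matrix.toEuclideanLin C y) y = quadForm C y := by
  rw [EuclideanSpace.inner_eq_star_dotProduct, quadForm]
  simp [Matrix.toLpLin_apply]

/-- cC - D is positive semidefinite, so zeros of its form are in its kernel. In particular the
maximizers of the ratio form a linear subspace. -/
lemma mulVec_eq_zero_iff_quadForm_eq {C D : Mat q} (hC : C.IsSymm) (hD : D.IsSymm) {c : ℝ}
    (hle : ∀ y, quadForm D y ≤ c * quadForm C y) (y : Vec q) :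
    (c • C - D).mulVec y.ofLp = 0 ↔ quadForm D y = c * quadForm C y := by
  have hNq : ∀ y, quadForm (c • C - D) y = c * quadForm C y - quadForm D y := fun y => by
    rw [quadForm_sub, quadForm_smul]
  have hNps : (c • C - D).PosSemidef := by
    refine Matrix.PosSemidef.of_dotProduct_mulVec_nonneg ?_ fun x => ?_
    · have : (c • C - D).IsSymm := (hC.smul c).sub hD
      simpa [Matrix.IsHermitian, Matrix.IsSymm] using this
    · have h1 := hle (WithLp.toLp 2 x)
      have h2 := hNq (WithLp.toLp 2 x)
      have h3 : 0 ≤ quadForm (c • C - D) (WithLp.toLp 2 x) := by linarith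
      simpa [quadForm] using h3
  have h1 := hNps.dotProduct_mulVec_zero_iff y.ofLp
  simp only [star_trivial] at h1
  rw [← h1]
  change quadForm (c • C - D) y = 0 ↔ _
  rw [hNq, sub_eq_zero, eq_comm]

/-- If, for all maximizers `e` of `yᵀ D y / yᵀ C y`, almost every `y` is orthogonal to `C e`
or itself a maximizer, then `D` is a multiple of `C`. -/
lemma eq_smul_of_ae_orthogonal {R : ProbabilityMeasure (Vec q)} (hR : R ∈ tylerDomain q)
    {C D : Mat q} (hC : C.PosDef) (hD : D.IsSymm) {c : ℝ}
    (hle : ∀ y, quadForm D y ≤ c * quadForm C y) {e : Vec q} (he : e ≠ 0)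
    (hce : quadForm D e = c * quadForm C e)
    (h : ∀ x, quadForm D x = c * quadForm C x → ∀ᵐ y ∂(R : Measure (Vec q)),
      inner ℝ (Matrix.toEuclideanLin C x) y = 0 ∨ quadForm D y = c * quadForm C y) :
    D = c • C := by
  have hCp := posDef_iff_quadForm.1 hC
  set N : Mat q := c • C - D with hN
  set E : Submodule ℝ (Vec q) := LinearMap.ker (Matrix.toEuclideanLin N) with hE
  have hEmem : ∀ y, y ∈ E ↔ quadForm D y = c * quadForm C y := by
    intro y
    rw [hE, LinearMap.mem_ker, Matrix.toLpLin_apply, WithLp.toLp_eq_zero, hN]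
    exact mulVec_eq_zero_iff_quadForm_eq hCp.1 hD hle y
  suffices hEtop : E = ⊤ by
    have h1 : N = 0 := by
      have h2 : Matrix.toEuclideanLin N = 0 := LinearMap.ker_eq_top.1 hEtop
      simpa using h2
    exact (sub_eq_zero.1 h1).symm
  by_contra hne
  have hEq : Module.finrank ℝ E < q := by
    have := Submodule.finrank_lt (K := ℝ) hne
    simpa using this
  have hE1 : 1 ≤ Module.finrank ℝ E := by
    rw [Nat.one_le_iff_ne_zero, Ne, Submodule.finrank_eq_zero]
    rintro h0
    have : e ∈ E := (hEmem e).2 hce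
    rw [h0, Submodule.mem_bot] at this
    exact he this
  -- F is the orthogonal complement of E for the inner product of C. Almost all mass lies on E ∪ F,
  -- whose dimensions add to at most q; the strict bound for E then makes the total mass less than
  -- one.
  set F : Submodule ℝ (Vec q) := (E.map (Matrix.toEuclideanLin C))ᗮ with hF
  have hdisj : Disjoint E F := by
    rw [Submodule.disjoint_def]
    intro y hy hy'
    by_contra hy0
    have h1 := (Submodule.mem_orthogonal _ _).1 hy' _ (Submodule.mem_map_of_mem hy)
    rw [inner_toEuclideanLin] at h1
    exact (hCp.2 y hy0).ne' h1
  have hsum : Module.finrank ℝ E + Module.finrank ℝ F ≤ q := by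
    simpa using Submodule.finrank_add_finrank_le_of_disjoint hdisj
  have hae : ∀ᵐ y ∂(R : Measure (Vec q)), y ∈ (E : Set (Vec q)) ∪ F := by
    -- The exceptional null set depends on x; a finite generating set of E leaves only finitely many
    -- of them.
    obtain ⟨T, hT⟩ := IsNoetherian.noetherian E
    have h1 : ∀ x ∈ T, ∀ᵐ y ∂(R : Measure (Vec q)),
        inner ℝ (Matrix.toEuclideanLin C x) y = 0 ∨ y ∈ E := fun x hx => by
      have hxE : x ∈ E := by rw [← hT]; exact Submodule.subset_span hx
      filter_upwards [h x ((hEmem x).1 hxE)] with y hy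
      rwa [hEmem]
    rw [← Filter.eventually_all_finset] at h1
    filter_upwards [h1] with y hy
    by_cases hyE : y ∈ E
    · exact Or.inl hyE
    · refine Or.inr ?_
      simp only [hF, SetLike.mem_coe]
      rw [← hT, Submodule.map_span, Submodule.mem_orthogonal]
      intro u hu
      induction hu using Submodule.span_induction with
      | mem u hu =>
        obtain ⟨x, hx, rfl⟩ := hu
        exact (hy x hx).resolve_right hyE
      | zero => simp
      | add u w _ _ hu hw => rw [inner_add_left, hu, hw, add_zero]
      | smul a u _ hu => rw [real_inner_smul_left, hu, mul_zero]
  have h1 : (R : Measure (Vec q)).real ((E : Set (Vec q)) ∪ F) = 1 := by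
    rw [← probReal_univ (μ := (R : Measure (Vec q)))]
    refine measureReal_congr ?_
    filter_upwards [hae] with y hy
    exact propext ⟨fun _ => trivial, fun _ => hy⟩
  have h2 := measureReal_union_le (μ := (R : Measure (Vec q))) (E : Set (Vec q)) F
  have h3 := hR.2 E hE1 hEq
  have h4 := measureReal_submodule_le hR (W := F) (by omega)
  have hq0 : (0 : ℝ) < q := by
    have : 0 < q := by omega
    exact_mod_cast this
  have h5 : (Module.finrank ℝ E : ℝ) / q + (Module.finrank ℝ F : ℝ) / q ≤ 1 := by
    rw [← add_div, div_le_one hq0]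
    exact_mod_cast hsum
  linarith

lemma exists_max_quadForm_ratio (hq : 1 ≤ q) {C : Mat q} (hC : C.PosDef) (D : Mat q) :
    ∃ (c : ℝ) (e : Vec q), e ≠ 0 ∧ quadForm D e = c * quadForm C e ∧
      ∀ y, quadForm D y ≤ c * quadForm C y := by
  have hCp := (posDef_iff_quadForm.1 hC).2
  have hne : (Metric.sphere (0 : Vec q) 1).Nonempty :=
    ⟨EuclideanSpace.single ⟨0, hq⟩ 1, by simp⟩
  have hs : ∀ y ∈ Metric.sphere (0 : Vec q) 1, y ≠ 0 := fun y hy h0 => by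
    simp [h0] at hy
  obtain ⟨e, he, hmax⟩ := (isCompact_sphere (0 : Vec q) 1).exists_isMaxOn hne
    (f := fun y => quadForm D y / quadForm C y)
    ((continuous_quadForm D).continuousOn.div (continuous_quadForm C).continuousOn
      fun y hy => (hCp y (hs y hy)).ne')
  refine ⟨quadForm D e / quadForm C e, e, hs e he, ?_, fun y => ?_⟩
  · rw [div_mul_cancel₀ _ (hCp e (hs e he)).ne']
  · rcases eq_or_ne y 0 with rfl | hy
    · simp
    have hn : 0 < ‖y‖ := norm_pos_iff.2 hy
    have h1 : ‖y‖⁻¹ • y ∈ Metric.sphere (0 : Vec q) 1 := by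
      simp [norm_smul, hn.ne']
    have h2 := hmax h1
    simp only [Set.mem_ofPred_eq, quadForm_smul_right] at h2
    rw [mul_div_mul_left _ _ (by positivity), div_le_iff₀ (hCp y hy)] at h2
    exact h2

end Dichotomy

/-! ### Uniqueness of the solution of the estimating equation. -/

section TylerUniqueness

variable {q : ℕ}

lemma integral_quadForm_tylerScore {R : ProbabilityMeasure (Vec q)} {C : Mat q} (hC : C.PosDef)
    (hdet : C.det = 1) (h : ∫ y, tylerScore C y ∂(R : Measure (Vec q)) = C⁻¹) (z : Vec q) :
    ∫ y, q / quadForm C y * inner ℝ z y ^ 2 ∂(R : Measure (Vec q)) = quadForm C⁻¹ z := by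
  rw [← h, ← quadFormCLM_apply, ← (quadFormCLM z).integral_comp_comm
    (integrable_tylerScore hC hdet R)]
  simp only [quadFormCLM_apply, quadForm_tylerScore]

lemma integrable_quadForm_tylerScore {C : Mat q} (hC : C.PosDef)
    (hdet : C.det = 1) (z : Vec q) (R : ProbabilityMeasure (Vec q)) :
    Integrable (fun y => q / quadForm C y * inner ℝ z y ^ 2) (R : Measure (Vec q)) := by
  have h := (quadFormCLM z).integrable_comp (integrable_tylerScore hC hdet R)
  simpa only [quadFormCLM_apply, quadForm_tylerScore] using h

/-- The estimating equation has at most one solution. -/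
lemma eq_of_integral_tylerScore_eq_inv (hq : 1 ≤ q) {R : ProbabilityMeasure (Vec q)}
    (hR : R ∈ tylerDomain q) {C D : Mat q} (hC : C.PosDef) (hCd : C.det = 1) (hD : D.PosDef)
    (hDd : D.det = 1) (hCe : ∫ y, tylerScore C y ∂(R : Measure (Vec q)) = C⁻¹)
    (hDe : ∫ y, tylerScore D y ∂(R : Measure (Vec q)) = D⁻¹) : D = C := by
  have hCp := posDef_iff_quadForm.1 hC
  have hDp := posDef_iff_quadForm.1 hD
  have hq0 : (0 : ℝ) < q := by exact_mod_cast hq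
  obtain ⟨c, e, he, hce, hle⟩ := exists_max_quadForm_ratio hq hC D
  have hc : 0 < c := by
    have h1 := hDp.2 e he
    rw [hce] at h1
    exact pos_of_mul_pos_left h1 (hCp.2 e he).le
  have hR' : ∀ᵐ y ∂(R : Measure (Vec q)), y ≠ 0 := by rw [ae_iff]; simpa using hR.1
  have key : D = c • C := by
    refine eq_smul_of_ae_orthogonal hR hC hDp.1 hle he hce fun x hx => ?_
    set z := Matrix.toEuclideanLin C x with hz
    have hzl : z.ofLp = C.mulVec x.ofLp := by rw [hz, Matrix.toLpLin_apply]
    -- At a maximizer x, D x = c C x = c z. Hence both inverses send z to multiples of x, and the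
    -- two estimating equations can be compared at z.
    have hker := (mulVec_eq_zero_iff_quadForm_eq hCp.1 hDp.1 hle x).2 hx
    rw [Matrix.sub_mulVec, Matrix.smul_mulVec, ← hzl, sub_eq_zero] at hker
    have huC : IsUnit C.det := by rw [hCd]; exact isUnit_one
    have huD : IsUnit D.det := by rw [hDd]; exact isUnit_one
    have h1 : quadForm C⁻¹ z = z.ofLp ⬝ᵥ x.ofLp := by
      rw [quadForm, hzl, Matrix.mulVec_mulVec, Matrix.nonsing_inv_mul _ huC, Matrix.one_mulVec]
    have h2 : quadForm D⁻¹ z = c⁻¹ * (z.ofLp ⬝ᵥ x.ofLp) := by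
      have : D⁻¹.mulVec z.ofLp = c⁻¹ • x.ofLp := by
        rw [eq_inv_smul_iff₀ hc.ne', ← Matrix.mulVec_smul, hker, Matrix.mulVec_mulVec,
          Matrix.nonsing_inv_mul _ huD, Matrix.one_mulVec]
      rw [quadForm, this, dotProduct_smul, smul_eq_mul]
    have hiC := integrable_quadForm_tylerScore hC hCd z R
    have hiD := integrable_quadForm_tylerScore hD hDd z R
    -- The integrand is nonnegative by maximality of c and has integral zero, so it vanishes almost
    -- everywhere; its factors give the required alternative.
    have h3 : ∫ y, (q / quadForm D y * inner ℝ z y ^ 2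
        - c⁻¹ * (q / quadForm C y * inner ℝ z y ^ 2)) ∂(R : Measure (Vec q)) = 0 := by
      rw [integral_sub hiD (hiC.const_mul _), integral_const_mul,
        integral_quadForm_tylerScore hC hCd hCe, integral_quadForm_tylerScore hD hDd hDe, h1, h2,
        sub_self]
    have h4 : ∀ y : Vec q, y ≠ 0 → q / quadForm D y * inner ℝ z y ^ 2
        - c⁻¹ * (q / quadForm C y * inner ℝ z y ^ 2)
        = q * inner ℝ z y ^ 2 / (quadForm D y * (c * quadForm C y))
          * (c * quadForm C y - quadForm D y) := fun y hy => by
      have := (hCp.2 y hy).ne'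
      have := (hDp.2 y hy).ne'
      field_simp
    have h5 : ∀ y : Vec q, 0 ≤ q / quadForm D y * inner ℝ z y ^ 2
        - c⁻¹ * (q / quadForm C y * inner ℝ z y ^ 2) := fun y => by
      rcases eq_or_ne y 0 with rfl | hy
      · simp
      rw [h4 y hy]
      have := hCp.2 y hy
      have := hDp.2 y hy
      exact mul_nonneg (by positivity) (sub_nonneg.2 (hle y))
    have h6 := (integral_eq_zero_iff_of_nonneg h5 (hiD.sub (hiC.const_mul _))).1 h3
    filter_upwards [h6, hR'] with y hy hy0
    rw [Pi.zero_apply, h4 y hy0] at hy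
    have p1 := hCp.2 y hy0
    have p2 := hDp.2 y hy0
    rcases mul_eq_zero.1 hy with h | h
    · left
      have p3 : quadForm D y * (c * quadForm C y) ≠ 0 := by positivity
      have h7 := (div_eq_zero_iff.1 h).resolve_right p3
      exact pow_eq_zero_iff two_ne_zero |>.1 ((mul_eq_zero.1 h7).resolve_left hq0.ne')
    · right
      linarith
  -- Equal determinants fix the scalar.
  have h1 : c ^ q = 1 := by
    have := hDd
    rwa [key, Matrix.det_smul, hCd, mul_one, Fintype.card_fin] at this
  rw [key, (pow_eq_one_iff_of_nonneg hc.le (by omega)).1 h1, one_smul]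

end TylerUniqueness

/-! ### Weak convergence for integrands discontinuous at zero. -/

section WeakConvergence

variable {q : ℕ} {Q : ProbabilityMeasure (Vec q)}

/-- The function `min (m ‖y‖) 1`. -/
noncomputable def cutoff (m : ℝ) (y : Vec q) : ℝ := min (m * ‖y‖) 1

lemma continuous_cutoff (m : ℝ) : Continuous (cutoff m : Vec q → ℝ) := by
  unfold cutoff; fun_prop

lemma cutoff_nonneg {m : ℝ} (hm : 0 ≤ m) (y : Vec q) : 0 ≤ cutoff m y :=
  le_min (by positivity) zero_le_one

lemma cutoff_le_one (m : ℝ) (y : Vec q) : cutoff m y ≤ 1 := min_le_right _ _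

lemma tendsto_integral_one_sub_cutoff (hQ : (Q : Measure (Vec q)) {0} = 0) :
    Tendsto (fun m : ℕ => ∫ y, (1 - cutoff m y) ∂(Q : Measure (Vec q))) atTop (𝓝 0) := by
  have h : Tendsto (fun m : ℕ => ∫ y, (1 - cutoff m y) ∂(Q : Measure (Vec q))) atTop
      (𝓝 (∫ _, (0 : ℝ) ∂(Q : Measure (Vec q)))) := by
    refine tendsto_integral_of_dominated_convergence (fun _ => 1)
      (fun m => (continuous_const.sub (continuous_cutoff m)).aestronglyMeasurable)
      (integrable_const 1) (fun m => ae_of_all _ fun y => ?_) ?_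
    · have h1 := cutoff_nonneg (q := q) (Nat.cast_nonneg m) y
      have h2 := cutoff_le_one m y
      rw [Real.norm_eq_abs, abs_of_nonneg (by linarith)]
      linarith
    · have hQ' : ∀ᵐ y ∂(Q : Measure (Vec q)), y ≠ 0 := by rw [ae_iff]; simpa using hQ
      filter_upwards [hQ'] with y hy
      refine tendsto_const_nhds.congr' ?_
      have hy0 := norm_pos_iff.2 hy
      filter_upwards [(tendsto_natCast_atTop_atTop (R := ℝ)).eventually_ge_atTop ‖y‖⁻¹] with m hm
      have : 1 ≤ m * ‖y‖ := by
        rw [inv_le_iff_one_le_mul₀ hy0] at hm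
        exact hm
      rw [cutoff, min_eq_right this, sub_self]
  simpa using h

/-- Weak convergence gives convergence of integrals of bounded functions which are continuous away
from zero, if the limit has no atom at zero. -/
lemma tendsto_integral_of_continuousOn_compl_zero (hQ : (Q : Measure (Vec q)) {0} = 0)
    {g : Vec q → ℝ} (hm : Measurable g) {K : ℝ} (hK : ∀ y, |g y| ≤ K)
    (hc : ContinuousOn g {0}ᶜ) :
    Tendsto (fun R : ProbabilityMeasure (Vec q) => ∫ y, g y ∂(R : Measure (Vec q))) (𝓝 Q)
      (𝓝 (∫ y, g y ∂(Q : Measure (Vec q)))) := by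
  have hK0 : 0 ≤ K := (abs_nonneg _).trans (hK 0)
  -- Multiplication by the cutoff restores continuity at zero because g is bounded.
  have hgc : ∀ m : ℕ, Continuous fun y => g y * cutoff m y := by
    intro m
    rw [continuous_iff_continuousAt]
    intro y
    rcases eq_or_ne y 0 with rfl | hy
    · have h0 : g 0 * cutoff m (0 : Vec q) = 0 := by simp [cutoff]
      rw [ContinuousAt, h0]
      refine squeeze_zero_norm (a := fun y => K * (m * ‖y‖)) (fun y => ?_) ?_
      · rw [norm_mul, Real.norm_of_nonneg (cutoff_nonneg (Nat.cast_nonneg m) y)]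
        exact mul_le_mul (hK y) (min_le_left _ _) (cutoff_nonneg (Nat.cast_nonneg m) y) hK0
      · have : Continuous fun y : Vec q => K * (m * ‖y‖) := by fun_prop
        simpa using this.tendsto 0
    · exact (hc.continuousAt (isOpen_compl_singleton.mem_nhds hy)).mul
        (continuous_cutoff m).continuousAt
  have hgb : ∀ (m : ℕ) (y : Vec q), ‖g y * cutoff m y‖ ≤ K := fun m y => by
    rw [norm_mul, Real.norm_of_nonneg (cutoff_nonneg (Nat.cast_nonneg m) y)]
    calc _ ≤ K * 1 := mul_le_mul (hK y) (cutoff_le_one _ y)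
          (cutoff_nonneg (Nat.cast_nonneg m) y) hK0
      _ = K := mul_one K
  have hcb : ∀ (m : ℕ) (y : Vec q), ‖1 - cutoff m y‖ ≤ 1 := fun m y => by
    have h1 := cutoff_nonneg (q := q) (Nat.cast_nonneg m) y
    have h2 := cutoff_le_one m y
    rw [Real.norm_eq_abs, abs_of_nonneg (by linarith)]
    linarith
  -- The cutoff error is dominated by the integral of a bounded continuous function, so smallness at
  -- Q carries over to R near Q.
  have hdiff : ∀ (m : ℕ) (R : ProbabilityMeasure (Vec q)),
      |∫ y, g y ∂(R : Measure (Vec q)) - ∫ y, g y * cutoff m y ∂(R : Measure (Vec q))|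
        ≤ K * ∫ y, (1 - cutoff m y) ∂(R : Measure (Vec q)) := by
    intro m R
    have i1 : Integrable g (R : Measure (Vec q)) :=
      Integrable.of_bound hm.aestronglyMeasurable K (ae_of_all _ hK)
    have i2 : Integrable (fun y => g y * cutoff m y) (R : Measure (Vec q)) :=
      Integrable.of_bound (hgc m).aestronglyMeasurable K (ae_of_all _ (hgb m))
    have i3 : Integrable (fun y => 1 - cutoff m y) (R : Measure (Vec q)) :=
      Integrable.of_bound (continuous_const.sub (continuous_cutoff m)).aestronglyMeasurable 1
        (ae_of_all _ (hcb m))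
    rw [← integral_sub i1 i2, ← integral_const_mul, ← Real.norm_eq_abs]
    refine norm_integral_le_of_norm_le (i3.const_mul K) (ae_of_all _ fun y => ?_)
    rw [← mul_one_sub, norm_mul]
    have h2 := cutoff_le_one m y
    rw [Real.norm_of_nonneg (by linarith : 0 ≤ 1 - cutoff (m : ℝ) y)]
    exact mul_le_mul_of_nonneg_right (hK y) (by linarith)
  have hweak := ProbabilityMeasure.tendsto_iff_forall_integral_tendsto.1
    (tendsto_id (x := 𝓝 Q))
  rw [Metric.tendsto_nhds]
  intro η hη
  have h0 := (tendsto_integral_one_sub_cutoff hQ).const_mul K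
  rw [mul_zero] at h0
  obtain ⟨m, hmη⟩ := (h0.eventually_lt_const (by positivity : 0 < η / 3)).exists
  have t1 := hweak (BoundedContinuousFunction.ofNormedAddCommGroup _ (hgc m) K (hgb m))
  have t2 := (hweak (BoundedContinuousFunction.ofNormedAddCommGroup _
    (continuous_const.sub (continuous_cutoff (q := q) m)) 1 (hcb m))).const_mul K
  simp only [BoundedContinuousFunction.coe_ofNormedAddCommGroup, id, Pi.sub_apply] at t1 t2
  filter_upwards [Metric.tendsto_nhds.1 t1 (η / 3) (by positivity),
    t2.eventually_lt_const hmη] with R h1 h2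
  have d1 := hdiff m R
  have d2 := hdiff m Q
  rw [Real.dist_eq] at h1 ⊢
  rw [abs_sub_comm] at d2
  have e1 := abs_add_three (∫ y, g y ∂(R : Measure (Vec q)) - ∫ y, g y * cutoff m y ∂(R : Measure (Vec q)))
    (∫ y, g y * cutoff m y ∂(R : Measure (Vec q)) - ∫ y, g y * cutoff m y ∂(Q : Measure (Vec q)))
    (∫ y, g y * cutoff m y ∂(Q : Measure (Vec q)) - ∫ y, g y ∂(Q : Measure (Vec q)))
  rw [sub_add_sub_cancel, sub_add_sub_cancel] at e1
  linarith

lemma tendsto_integral_mat_of_continuousOn_compl_zero (hQ : (Q : Measure (Vec q)) {0} = 0)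
    {g : Vec q → Mat q} (hm : Measurable g) {K : ℝ} (hK : ∀ y, ‖g y‖ ≤ K)
    (hc : ContinuousOn g {0}ᶜ) :
    Tendsto (fun R : ProbabilityMeasure (Vec q) => ∫ y, g y ∂(R : Measure (Vec q))) (𝓝 Q)
      (𝓝 (∫ y, g y ∂(Q : Measure (Vec q)))) := by
  refine tendsto_of_forall_entry fun k l => ?_
  simp only [integral_entry hm hK]
  exact tendsto_integral_of_continuousOn_compl_zero hQ ((measurable_entry k l).comp hm)
    (fun y => (abs_entry_le_norm _ k l).trans (hK y))
    ((continuous_entry k l).comp_continuousOn hc)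

/-- Allows integrand and measure to vary together, as they do when the score is evaluated at the
estimate itself. -/
lemma tendsto_integral_of_uniform (hQ : (Q : Measure (Vec q)) {0} = 0)
    {α : Type*} {l : Filter α} {R : α → ProbabilityMeasure (Vec q)} (hR : Tendsto R l (𝓝 Q))
    {f : α → Vec q → Mat q} {g : Vec q → Mat q} {r : α → ℝ} (hr : Tendsto r l (𝓝 0))
    (hfm : ∀ a, Measurable (f a)) (hgm : Measurable g) {K : ℝ} (hK : ∀ y, ‖g y‖ ≤ K)
    (hc : ContinuousOn g {0}ᶜ) (hfg : ∀ᶠ a in l, ∀ y, ‖f a y - g y‖ ≤ r a) :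
    Tendsto (fun a => ∫ y, f a y ∂(R a : Measure (Vec q))) l
      (𝓝 (∫ y, g y ∂(Q : Measure (Vec q)))) := by
  refine tendsto_of_tendsto_of_dist
    ((tendsto_integral_mat_of_continuousOn_compl_zero hQ hgm hK hc).comp hR)
    (squeeze_zero' (Eventually.of_forall fun _ => dist_nonneg) ?_ hr)
  filter_upwards [hfg] with a ha
  have i1 : Integrable g (R a : Measure (Vec q)) :=
    Integrable.of_bound hgm.aestronglyMeasurable K (ae_of_all _ hK)
  have i2 : Integrable (fun y => f a y - g y) (R a : Measure (Vec q)) :=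
    Integrable.of_bound ((hfm a).sub hgm).aestronglyMeasurable (r a) (ae_of_all _ ha)
  have i3 : Integrable (f a) (R a : Measure (Vec q)) := by
    have := i2.add i1
    refine this.congr (ae_of_all _ fun y => ?_)
    simp
  rw [Function.comp_apply, dist_comm, dist_eq_norm, ← integral_sub i3 i1]
  simpa using norm_integral_le_of_norm_le_const (μ := (R a : Measure (Vec q)))
    (f := fun y => f a y - g y) (ae_of_all _ ha)

end WeakConvergence

/-! ### Domain and continuity of Tyler's functional. -/

section TylerNeighbourhood

variable {q : ℕ} {Q : ProbabilityMeasure (Vec q)}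

/-- An orthonormal basis of W is padded and extended to a frame of the whole space. W lies in the
resulting cone, and the margin ε makes the inequality strict. -/
lemma mem_tylerDomain_of_cone {R : ProbabilityMeasure (Vec q)} (hR : (R : Measure (Vec q)) {0} = 0)
    {ε : ℝ} (hε : 0 < ε)
    (hcone : ∀ s : Finset (Fin q), 1 ≤ s.card → s.card < q → ∀ v : Fin q → Vec q, Orthonormal ℝ v →
        (R : Measure (Vec q)).real (coneAround v s ε) ≤ (s.card : ℝ) / q - ε) :
    R ∈ tylerDomain q := by
  classical
  refine ⟨hR, fun W hW1 hWq => ?_⟩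
  set k := Module.finrank ℝ W with hk
  let b := stdOrthonormalBasis ℝ W
  let v₀ : Fin q → Vec q := fun i => if h : (i : ℕ) < k then (b ⟨i, h⟩ : Vec q) else 0
  let s : Finset (Fin q) := {i : Fin q | (i : ℕ) < k}
  have hs : s.card = k := by
    rw [Fin.card_filter_val_lt]
    omega
  have hv₀ : Orthonormal ℝ ((s : Set (Fin q)).domRestrict v₀) := by
    have h1 : Orthonormal ℝ fun i : (s : Set (Fin q)) =>
        (b ⟨(i : Fin q), by have := i.2; simpa [s] using this⟩ : Vec q) := by
      have h2 := b.orthonormal.comp (fun i : (s : Set (Fin q)) =>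
        (⟨(i : Fin q), by have := i.2; simpa [s] using this⟩ : Fin k)) (fun i j hij => by
          exact Subtype.ext (Fin.ext (congrArg Fin.val hij :)))
      exact h2.comp_linearIsometry W.subtypeₗᵢ
    convert h1 using 1
    funext i
    have := i.2
    simp only [Set.domRestrict_apply, v₀]
    rw [dif_pos (by simpa [s] using this)]
  obtain ⟨v, hv⟩ := Orthonormal.exists_orthonormalBasis_extension_of_card_eq (𝕜 := ℝ)
    (E := Vec q) (ι := Fin q) (by simp) hv₀
  have hsub : (W : Set (Vec q)) ⊆ coneAround v s ε := by
    intro y hy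
    refine mem_coneAround_of_mem_span v.orthonormal ?_ hε.le
    have h1 := b.sum_repr ⟨y, hy⟩
    have h2 : y = ∑ i, b.repr ⟨y, hy⟩ i • (b i : Vec q) := by
      have := congrArg (Subtype.val) h1
      simpa using this.symm
    rw [h2]
    refine Submodule.sum_mem _ fun i _ => Submodule.smul_mem _ _ (Submodule.subset_span ?_)
    have hi : (⟨i, by omega⟩ : Fin q) ∈ (s : Set (Fin q)) := by simp [s, hk]
    refine ⟨⟨i, by omega⟩, hi, ?_⟩
    rw [hv _ hi]
    simp only [v₀]
    rw [dif_pos (by exact i.2)]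
  have h3 := hcone s (by omega) (by omega) v v.orthonormal
  rw [hs] at h3
  have h4 := measureReal_mono (μ := (R : Measure (Vec q))) hsub (measure_ne_top _ _)
  linarith

/-- One ε serves a whole neighbourhood of Q, so the estimates there lie in one compact box: the
minimal criterion is at most its value 0 at the identity. -/
lemma eventually_mem_tylerDomain_and_mem_tylerBox (hq : 1 ≤ q) (hQ : Q ∈ tylerDomain q) :
    ∃ B : ℝ, 0 ≤ B ∧ ∀ᶠ R : ProbabilityMeasure (Vec q) in 𝓝 Q, (R : Measure (Vec q)) {0} = 0 →
      R ∈ tylerDomain q ∧ (tylerMatrix R)⁻¹ ∈ tylerBox q B := by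
  obtain ⟨ε, hε, hε1, hcone⟩ := eventually_measureReal_coneAround_le hQ
  refine ⟨-Real.log ε / ε, div_nonneg (neg_nonneg.2 (Real.log_nonpos hε.le hε1.le)) hε.le, ?_⟩
  filter_upwards [hcone] with R hR hR0
  have hdom := mem_tylerDomain_of_cone hR0 hε hR
  have hmin := isPrecisionMinimizer_inv_tylerMatrix hq hdom
  refine ⟨hdom, mem_tylerBox_of_integral_nonpos hR0 hε hε1 hR hq hmin.1.1 hmin.1.2 ?_⟩
  have h := hmin.2 1 Matrix.PosDef.one Matrix.det_one
  rwa [integral_tylerLog_one] at h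

/-- The domain is the intersection of an open set with the distributions having no atom at zero; the
latter is a countable intersection of open sets, as the mass of {0} is upper semicontinuous. -/
lemma isGδ_tylerDomain (hq : 1 ≤ q) : IsGδ (tylerDomain q) := by
  have h1 : IsGδ {R : ProbabilityMeasure (Vec q) | (R : Measure (Vec q)) {0} = 0} := by
    have h2 : {R : ProbabilityMeasure (Vec q) | (R : Measure (Vec q)) {0} = 0}
        = ⋂ n : ℕ, {R : ProbabilityMeasure (Vec q) |
          (R : Measure (Vec q)).real {0} < 1 / ((n : ℝ) + 1)} := by
      ext R
      simp only [Set.mem_ofPred_eq, Set.mem_iInter]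
      constructor
      · intro h n
        rw [measureReal_def, h, ENNReal.toReal_zero]
        positivity
      · intro h
        rw [← measureReal_eq_zero_iff (measure_ne_top _ _)]
        refine le_antisymm (le_of_tendsto' (f := fun n : ℕ => (R : Measure (Vec q)).real {0})
          (x := atTop) tendsto_const_nhds fun n => ?_) measureReal_nonneg
        exact le_of_not_gt fun hpos => by
          obtain ⟨n, hn⟩ := exists_nat_one_div_lt hpos
          exact absurd (h n) (not_lt.2 hn.le)
    rw [h2]
    refine IsGδ.iInter_of_isOpen fun n => isOpen_iff_mem_nhds.2 fun R hR => ?_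
    exact eventually_measureReal_closed_lt isClosed_singleton hR
  have h3 : tylerDomain q = {R : ProbabilityMeasure (Vec q) | (R : Measure (Vec q)) {0} = 0} ∩
      interior {R : ProbabilityMeasure (Vec q) |
        (R : Measure (Vec q)) {0} = 0 → R ∈ tylerDomain q} := by
    ext R
    constructor
    · intro hR
      obtain ⟨B, -, hB⟩ := eventually_mem_tylerDomain_and_mem_tylerBox hq hR
      exact ⟨hR.1, mem_interior_iff_mem_nhds.2 (hB.mono fun R' h h0 => (h h0).1)⟩
    · rintro ⟨h0, h⟩
      exact interior_subset h h0
  rw [h3]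
  exact h1.inter isOpen_interior.isGδ

lemma tylerMatrix_spec (hq : 1 ≤ q) {R : ProbabilityMeasure (Vec q)} (hR : R ∈ tylerDomain q) :
    ∫ y, tylerScore (tylerMatrix R)⁻¹ y ∂(R : Measure (Vec q)) = tylerMatrix R ∧
      (tylerMatrix R).PosDef ∧ (tylerMatrix R).det = 1 := by
  have hmin := isPrecisionMinimizer_inv_tylerMatrix hq hR
  have h := (isTylerMinimizer_iff hq).2 hmin
  refine ⟨?_, h.1⟩
  rw [integral_tylerScore_eq_inv hq hR.1 hmin, Matrix.nonsing_inv_nonsing_inv]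
  rw [h.1.2]
  exact isUnit_one

/-- An exact difference formula that replaces a Taylor expansion; the only remainder is the mixing
of C and D on the right. -/
lemma tylerScore_sub {C D : Mat q} (hC : C.PosDef) (hD : D.PosDef) (y : Vec q) :
    tylerScore D y - tylerScore C y
      = (quadForm (C - D) y / quadForm C y) • tylerScore D y := by
  rcases eq_or_ne y 0 with rfl | hy
  · simp [tylerScore]
  have h1 := ((posDef_iff_quadForm.1 hC).2 y hy).ne'
  have h2 := ((posDef_iff_quadForm.1 hD).2 y hy).ne'
  rw [tylerScore, tylerScore, ← sub_smul, smul_smul, quadForm_sub]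
  congr 1
  field_simp

lemma abs_quadForm_div_le {B : ℝ} {C : Mat q} (hC : C ∈ tylerBox q B) (X : Mat q) (y : Vec q) :
    |quadForm X y / quadForm C y| ≤ ‖X‖ * Real.exp B := by
  rcases eq_or_ne y 0 with rfl | hy
  · simp only [quadForm_zero_right, div_zero, abs_zero]
    positivity
  have h0 : 0 < quadForm C y := (posDef_iff_quadForm.1 (posDef_of_mem_tylerBox hC)).2 y hy
  rw [abs_div, abs_of_pos h0, div_le_iff₀ h0]
  refine (abs_quadForm_le X y).trans ?_
  have h1 := (hC.2.2 y).1
  have h2 : Real.exp B * Real.exp (-B) = 1 := by rw [← Real.exp_add]; simp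
  calc ‖X‖ * ‖y‖ ^ 2 = ‖X‖ * Real.exp B * (Real.exp (-B) * ‖y‖ ^ 2) := by
        rw [← mul_assoc, mul_assoc ‖X‖, h2, mul_one]
    _ ≤ _ := by gcongr

lemma norm_tylerScore_sub_le {B : ℝ} {C D : Mat q} (hC : C ∈ tylerBox q B)
    (hD : D ∈ tylerBox q B) (y : Vec q) :
    ‖tylerScore D y - tylerScore C y‖ ≤ ‖D - C‖ * (Real.exp B * (q * Real.exp B)) := by
  rw [tylerScore_sub (posDef_of_mem_tylerBox hC) (posDef_of_mem_tylerBox hD), norm_smul,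
    norm_sub_rev, ← mul_assoc]
  exact mul_le_mul (abs_quadForm_div_le hC _ y) (norm_tylerScore_le hD y) (norm_nonneg _)
    (by positivity)

lemma continuousOn_tylerScore {C : Mat q} (hC : C.PosDef) :
    ContinuousOn (tylerScore C) {0}ᶜ :=
  (continuousOn_const.div (continuous_quadForm C).continuousOn fun y hy =>
    ((posDef_iff_quadForm.1 hC).2 y hy).ne').smul continuous_outer.continuousOn

lemma tendsto_matrix_mul {α : Type*} {l : Filter α} {f g : α → Mat q} {A B : Mat q}
    (hf : Tendsto f l (𝓝 A)) (hg : Tendsto g l (𝓝 B)) :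
    Tendsto (fun x => f x * g x) l (𝓝 (A * B)) := by
  refine tendsto_of_forall_entry fun i j => ?_
  simp only [Matrix.mul_apply]
  exact tendsto_finsetSum _ fun k _ => (((continuous_entry i k).tendsto _).comp hf).mul
    (((continuous_entry k j).tendsto _).comp hg)

lemma tendsto_integral_tylerScore {α : Type*} {l : Filter α} {R : α → ProbabilityMeasure (Vec q)}
    (hQ : (Q : Measure (Vec q)) {0} = 0) (hR : Tendsto R l (𝓝 Q)) {B : ℝ} {D : α → Mat q}
    {C : Mat q} (hC : C ∈ tylerBox q B) (hD : ∀ᶠ a in l, D a ∈ tylerBox q B)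
    (hDC : Tendsto D l (𝓝 C)) :
    Tendsto (fun a => ∫ y, tylerScore (D a) y ∂(R a : Measure (Vec q))) l
      (𝓝 (∫ y, tylerScore C y ∂(Q : Measure (Vec q)))) := by
  have hr : Tendsto (fun a => ‖D a - C‖ * (Real.exp B * (q * Real.exp B))) l (𝓝 0) := by
    have := (tendsto_iff_norm_sub_tendsto_zero.1 hDC).mul_const (Real.exp B * (q * Real.exp B))
    rwa [zero_mul] at this
  refine tendsto_integral_of_uniform hQ hR hr (fun a => measurable_tylerScore _)
    (measurable_tylerScore _) (norm_tylerScore_le hC)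
    (continuousOn_tylerScore (posDef_of_mem_tylerBox hC)) ?_
  filter_upwards [hD] with a ha
  exact norm_tylerScore_sub_le hC ha

lemma eventually_nhdsWithin_mem_tylerBox (hq : 1 ≤ q) (hQ : Q ∈ tylerDomain q) :
    ∃ B : ℝ, 0 ≤ B ∧ ∀ᶠ R : ProbabilityMeasure (Vec q) in 𝓝[tylerDomain q] Q,
      (tylerMatrix R)⁻¹ ∈ tylerBox q B := by
  obtain ⟨B, hB, h⟩ := eventually_mem_tylerDomain_and_mem_tylerBox hq hQ
  refine ⟨B, hB, ?_⟩
  rw [eventually_nhdsWithin_iff]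
  exact h.mono fun R hR hdom => (hR hdom.1).2

/-- The values stay in a compact box, and the estimating equation passes to the limit along
ultrafilters. Every cluster point thus solves the equation at Q, which has only one solution. -/
lemma tendsto_inv_tylerMatrix (hq : 1 ≤ q) (hQ : Q ∈ tylerDomain q) :
    Tendsto (fun R : ProbabilityMeasure (Vec q) => (tylerMatrix R)⁻¹) (𝓝[tylerDomain q] Q)
      (𝓝 (tylerMatrix Q)⁻¹) := by
  obtain ⟨B, -, hB⟩ := eventually_nhdsWithin_mem_tylerBox hq hQ
  refine (isCompact_tylerBox B).tendsto_nhds_of_unique_mapClusterPt hB fun C hC hcl => ?_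
  obtain ⟨U, hU, hUC⟩ := mapClusterPt_iff_ultrafilter.1 hcl
  have hU' : Tendsto (id : ProbabilityMeasure (Vec q) → _) (U : Filter _) (𝓝 Q) :=
    hU.trans nhdsWithin_le_nhds
  have hdom : ∀ᶠ R : ProbabilityMeasure (Vec q) in (U : Filter _), R ∈ tylerDomain q :=
    hU eventually_mem_nhdsWithin
  have h1 := tendsto_integral_tylerScore hQ.1 hU' hC (hU hB) hUC
  have h2 := tendsto_matrix_mul hUC h1
  -- Written as a product equal to 1, the equation passes to the limit without continuity of matrix
  -- inversion.
  have h3 : C * ∫ y, tylerScore C y ∂(Q : Measure (Vec q)) = 1 := by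
    refine tendsto_nhds_unique h2 (tendsto_const_nhds.congr' ?_)
    filter_upwards [hdom] with R hR
    have hs := tylerMatrix_spec hq hR
    rw [id, hs.1, Matrix.nonsing_inv_mul]
    rw [hs.2.2]
    exact isUnit_one
  have h4 := (Matrix.inv_eq_right_inv h3).symm
  have hmin := isPrecisionMinimizer_inv_tylerMatrix hq hQ
  exact eq_of_integral_tylerScore_eq_inv hq hQ hmin.1.1 hmin.1.2 (posDef_of_mem_tylerBox hC) hC.2.1
    (integral_tylerScore_eq_inv hq hQ.1 hmin) h4

/-- The equation expresses the matrix as the integral of the score at its inverse, so convergence of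
the inverses is enough. -/
lemma tendsto_tylerMatrix (hq : 1 ≤ q) (hQ : Q ∈ tylerDomain q) :
    Tendsto (fun R : ProbabilityMeasure (Vec q) => tylerMatrix R) (𝓝[tylerDomain q] Q)
      (𝓝 (tylerMatrix Q)) := by
  obtain ⟨B, -, hB⟩ := eventually_nhdsWithin_mem_tylerBox hq hQ
  have hBQ := hB.self_of_nhdsWithin hQ
  have h := tendsto_integral_tylerScore hQ.1 (R := fun R => R) (tendsto_id'.2 nhdsWithin_le_nhds) hBQ
    hB (tendsto_inv_tylerMatrix hq hQ)
  rw [(tylerMatrix_spec hq hQ).1] at h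
  refine h.congr' ?_
  filter_upwards [eventually_mem_nhdsWithin] with R hR
  exact (tylerMatrix_spec hq hR).1

end TylerNeighbourhood

/-! ### The linearized estimating equation and its injectivity. -/

section TylerLinearization

variable {q : ℕ} {Q : ProbabilityMeasure (Vec q)}

/-- The linear map `X ↦ ∫ (yᵀ X y / yᵀ C y) (q y yᵀ / yᵀ D y) R(dy)`. -/
noncomputable def tylerPsi (C D : Mat q) (R : ProbabilityMeasure (Vec q)) : Mat q →L[ℝ] Mat q :=
  ∑ k, ∑ l, (entryCLM k l).smulRight
    (∫ y, (quadForm (Matrix.single k l 1) y / quadForm C y) • tylerScore D y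
      ∂(R : Measure (Vec q)))

lemma measurable_quadForm_div_smul (X C D : Mat q) :
    Measurable fun y => (quadForm X y / quadForm C y) • tylerScore D y :=
  ((continuous_quadForm X).measurable.div (continuous_quadForm C).measurable).smul
    (measurable_tylerScore D)

lemma norm_quadForm_div_smul_le {B : ℝ} {C D : Mat q} (hC : C ∈ tylerBox q B)
    (hD : D ∈ tylerBox q B) (X : Mat q) (y : Vec q) :
    ‖(quadForm X y / quadForm C y) • tylerScore D y‖
      ≤ ‖X‖ * Real.exp B * (q * Real.exp B) := by
  rw [norm_smul]
  exact mul_le_mul (abs_quadForm_div_le hC _ y) (norm_tylerScore_le hD y) (norm_nonneg _)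
    (by positivity)

lemma integrable_quadForm_div_smul {B : ℝ} {C D : Mat q} (hC : C ∈ tylerBox q B)
    (hD : D ∈ tylerBox q B) (X : Mat q) (R : ProbabilityMeasure (Vec q)) :
    Integrable (fun y => (quadForm X y / quadForm C y) • tylerScore D y)
      (R : Measure (Vec q)) :=
  Integrable.of_bound (measurable_quadForm_div_smul X C D).aestronglyMeasurable _
    (ae_of_all _ (norm_quadForm_div_smul_le hC hD X))

lemma quadForm_single (k l : Fin q) (y : Vec q) :
    quadForm (Matrix.single k l 1) y = y k * y l := by
  rw [quadForm_eq_sum]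
  simp [Matrix.single_apply, ite_and]

/-- The definition by matrix units makes the map continuous and linear without hypotheses and
reduces convergence of operators to that of finitely many integrals; here it is identified with the
intended integral. -/
lemma tylerPsi_apply {B : ℝ} {C D : Mat q} (hC : C ∈ tylerBox q B) (hD : D ∈ tylerBox q B)
    (R : ProbabilityMeasure (Vec q)) (X : Mat q) :
    tylerPsi C D R X = ∫ y, (quadForm X y / quadForm C y) • tylerScore D y
      ∂(R : Measure (Vec q)) := by
  have hi : ∀ k l, Integrable (fun y => X k l • (quadForm (Matrix.single k l 1) y / quadForm C y) •
      tylerScore D y) (R : Measure (Vec q)) := fun k l =>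
    (integrable_quadForm_div_smul hC hD (Matrix.single k l 1) R).smul (X k l)
  have h : ∀ y, (quadForm X y / quadForm C y) • tylerScore D y
      = ∑ k, ∑ l, X k l • (quadForm (Matrix.single k l 1) y / quadForm C y) • tylerScore D y := by
    intro y
    simp only [smul_smul, ← Finset.sum_smul, quadForm_single]
    rw [quadForm_eq_sum, Finset.sum_div]
    simp only [Finset.sum_div, mul_div_assoc]
  simp only [h]
  rw [integral_finsetSum _ fun k _ => integrable_finsetSum _ fun l _ => hi k l]
  simp only [tylerPsi, sum_apply, ContinuousLinearMap.smulRight_apply,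
    entryCLM_apply]
  refine Finset.sum_congr rfl fun k _ => ?_
  rw [integral_finsetSum _ fun l _ => hi k l]
  exact Finset.sum_congr rfl fun l _ => (integral_smul _ _).symm

lemma tendsto_tylerPsi {α : Type*} {l : Filter α} {R : α → ProbabilityMeasure (Vec q)}
    (hQ : (Q : Measure (Vec q)) {0} = 0) (hR : Tendsto R l (𝓝 Q)) {B : ℝ} {D : α → Mat q}
    {C : Mat q} (hC : C ∈ tylerBox q B) (hD : ∀ᶠ a in l, D a ∈ tylerBox q B)
    (hDC : Tendsto D l (𝓝 C)) :
    Tendsto (fun a => tylerPsi C (D a) (R a)) l (𝓝 (tylerPsi C C Q)) := by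
  refine tendsto_finsetSum _ fun i _ => tendsto_finsetSum _ fun j _ => ?_
  refine (((ContinuousLinearMap.smulRightL ℝ (Mat q) (Mat q)
    (entryCLM i j)).continuous.tendsto _).comp ?_ :)
  set X : Mat q := Matrix.single i j 1
  have hr : Tendsto (fun a => ‖X‖ * Real.exp B * (‖D a - C‖ * (Real.exp B * (q * Real.exp B))))
      l (𝓝 0) := by
    have := ((tendsto_iff_norm_sub_tendsto_zero.1 hDC).mul_const
      (Real.exp B * (q * Real.exp B))).const_mul (‖X‖ * Real.exp B)
    rwa [zero_mul, mul_zero] at this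
  refine tendsto_integral_of_uniform hQ hR hr (fun a => measurable_quadForm_div_smul _ _ _)
    (measurable_quadForm_div_smul _ _ _) (norm_quadForm_div_smul_le hC hC X) ?_ ?_
  · have hCp := (posDef_iff_quadForm.1 (posDef_of_mem_tylerBox hC)).2
    exact ((continuous_quadForm X).continuousOn.div (continuous_quadForm C).continuousOn
      fun y hy => (hCp y hy).ne').smul (continuousOn_tylerScore (posDef_of_mem_tylerBox hC))
  · filter_upwards [hD] with a ha y
    rw [← smul_sub, norm_smul]
    exact mul_le_mul (abs_quadForm_div_le hC _ y) (norm_tylerScore_sub_le hC ha y) (norm_nonneg _)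
      (by positivity)

lemma isSymm_tylerPsi {B : ℝ} {C : Mat q} (hC : C ∈ tylerBox q B)
    (R : ProbabilityMeasure (Vec q)) (X : Mat q) : (tylerPsi C C R X).IsSymm := by
  rw [tylerPsi_apply hC hC]
  exact isSymm_integral (integrable_quadForm_div_smul hC hC X R) fun y =>
    (isSymm_tylerScore C y).smul _

/-- Pointwise, tr(C · score) = q for y ≠ 0, so both sides integrate q yᵀXy / yᵀCy. -/
lemma trace_mul_tylerPsi {B : ℝ} {C : Mat q} (hC : C ∈ tylerBox q B)
    {R : ProbabilityMeasure (Vec q)}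
    (h : ∫ y, tylerScore C y ∂(R : Measure (Vec q)) = C⁻¹) (X : Mat q) :
    (C * tylerPsi C C R X).trace = (X * C⁻¹).trace := by
  rw [tylerPsi_apply hC hC, ← h, ← traceMulCLM_apply, ← traceMulCLM_apply,
    ← (traceMulCLM C).integral_comp_comm (integrable_quadForm_div_smul hC hC X R),
    ← (traceMulCLM X).integral_comp_comm
      (integrable_tylerScore (posDef_of_mem_tylerBox hC) hC.2.1 R)]
  congr 1
  funext y
  rw [map_smul, traceMulCLM_apply, traceMulCLM_apply, trace_mul_tylerScore, trace_mul_tylerScore,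
    smul_eq_mul, mul_left_comm]
  congr 1
  rcases eq_or_ne (quadForm C y) 0 with h0 | h0
  · simp [h0]
  · rw [div_self h0, mul_one]

/-- The linear map `X ↦ C X D`. -/
noncomputable def sandwichCLM (C D : Mat q) : Mat q →L[ℝ] Mat q :=
  LinearMap.toContinuousLinearMap
    { toFun := fun X => C * X * D
      map_add' := fun X Y => by rw [mul_add, add_mul]
      map_smul' := fun c X => by simp }

/-- The linearization of the estimating equation of Tyler's functional. -/
noncomputable def tylerLinearization (C : Mat q) (R : ProbabilityMeasure (Vec q)) :
    Mat q →L[ℝ] Mat q :=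
  ContinuousLinearMap.id ℝ (Mat q) - (tylerPsi C C R).comp (sandwichCLM C C)
    -- By the estimating equation the first two terms annihilate C⁻¹, the direction of rescaling.
    -- The trace term removes this kernel, and it is of second order along matrices of determinant
    -- one.
    + (traceMulCLM C).smulRight C⁻¹

lemma tylerLinearization_apply (C : Mat q) (R : ProbabilityMeasure (Vec q)) (X : Mat q) :
    tylerLinearization C R X
      = X - tylerPsi C C R (C * X * C) + (C * X).trace • C⁻¹ := rfl

/-- The map differs from the identity only by symmetric matrices. Hence the inverse preserves
symmetry although it is formed on all matrices. -/
lemma isSymm_of_isSymm_tylerLinearization {B : ℝ} {C : Mat q} (hC : C ∈ tylerBox q B)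
    {R : ProbabilityMeasure (Vec q)} {X : Mat q} (h : (tylerLinearization C R X).IsSymm) :
    X.IsSymm := by
  have h1 : X = tylerLinearization C R X + tylerPsi C C R (C * X * C)
      - (C * X).trace • C⁻¹ := by
    rw [tylerLinearization_apply]; abel
  rw [h1]
  exact (h.add (isSymm_tylerPsi hC R _)).sub
    ((posDef_iff_quadForm.1 (posDef_of_mem_tylerBox hC).inv).1.smul _)

lemma trace_mul_tylerLinearization {B : ℝ} {C : Mat q} (hC : C ∈ tylerBox q B)
    {R : ProbabilityMeasure (Vec q)}
    (h : ∫ y, tylerScore C y ∂(R : Measure (Vec q)) = C⁻¹) (X : Mat q) :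
    (C * tylerLinearization C R X).trace = q * (C * X).trace := by
  have hu : IsUnit C.det := by rw [hC.2.1]; exact isUnit_one
  rw [tylerLinearization_apply, mul_add, mul_sub, Matrix.trace_add, Matrix.trace_sub,
    trace_mul_tylerPsi hC h, Matrix.mul_nonsing_inv_cancel_right _ _ hu, Matrix.mul_smul,
    Matrix.mul_nonsing_inv _ hu, Matrix.trace_smul, Matrix.trace_one, Fintype.card_fin, smul_eq_mul]
  ring

lemma quadForm_toEuclideanLin {C : Mat q} (hC : C.IsSymm) (X : Mat q) (x : Vec q) :
    quadForm X (Matrix.toEuclideanLin C x) = quadForm (C * X * C) x := by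
  rw [quadForm, quadForm, Matrix.toLpLin_apply, ← Matrix.mulVec_mulVec, ← Matrix.mulVec_mulVec,
    Matrix.dotProduct_mulVec x.ofLp, ← Matrix.mulVec_transpose, hC.eq]

/-- A kernel element X has tr(CX) = 0, so X is fixed by the integral operator. Testing this at z =
Cx, for x maximizing the ratio of Δ = CXC to C, gives the same alternative as for uniqueness, whence
Δ = cC. The trace condition forces c = 0. -/
lemma tylerLinearization_injective (hq : 1 ≤ q) {R : ProbabilityMeasure (Vec q)}
    (hR : R ∈ tylerDomain q) {B : ℝ} {C : Mat q} (hC : C ∈ tylerBox q B)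
    (h : ∫ y, tylerScore C y ∂(R : Measure (Vec q)) = C⁻¹) :
    Function.Injective (tylerLinearization C R) := by
  rw [injective_iff_map_eq_zero]
  intro X hX
  have hCpd := posDef_of_mem_tylerBox hC
  have hCp := posDef_iff_quadForm.1 hCpd
  have hu : IsUnit C.det := by rw [hC.2.1]; exact isUnit_one
  have hq0 : (0 : ℝ) < q := by exact_mod_cast hq
  have hR' : ∀ᵐ y ∂(R : Measure (Vec q)), y ≠ 0 := by rw [ae_iff]; simpa using hR.1
  have hXs : X.IsSymm := by
    refine isSymm_of_isSymm_tylerLinearization hC (R := R) ?_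
    rw [hX]
    exact Matrix.isSymm_zero
  have htr : (C * X).trace = 0 := by
    have h1 := trace_mul_tylerLinearization hC h X
    rw [hX, mul_zero, Matrix.trace_zero] at h1
    exact (mul_eq_zero.1 h1.symm).resolve_left hq0.ne'
  have hXpsi : X = tylerPsi C C R (C * X * C) := by
    rw [tylerLinearization_apply, htr, zero_smul, add_zero, sub_eq_zero] at hX
    exact hX
  set Δ := C * X * C with hΔ
  have hΔs : Δ.IsSymm := by
    rw [Matrix.IsSymm, hΔ, Matrix.transpose_mul, Matrix.transpose_mul, hCp.1.eq, hXs.eq, mul_assoc]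
  obtain ⟨c, e, he, hce, hle⟩ := exists_max_quadForm_ratio hq hCpd Δ
  have key : Δ = c • C := by
    refine eq_smul_of_ae_orthogonal hR hCpd hΔs hle he hce fun x hx => ?_
    set z := Matrix.toEuclideanLin C x with hz
    have i0 := integrable_quadForm_tylerScore hCpd hC.2.1 z R
    have i1 : Integrable (fun y => quadForm Δ y / quadForm C y *
        (q / quadForm C y * inner ℝ z y ^ 2)) (R : Measure (Vec q)) := by
      have := (quadFormCLM z).integrable_comp (integrable_quadForm_div_smul hC hC Δ R)
      simpa only [quadFormCLM_apply, quadForm_smul, quadForm_tylerScore] using this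
    have h1 : ∫ y, quadForm Δ y / quadForm C y * (q / quadForm C y * inner ℝ z y ^ 2)
        ∂(R : Measure (Vec q)) = quadForm Δ x := by
      have h2 : quadForm Δ x = quadForm X z := by rw [hz, quadForm_toEuclideanLin hCp.1]
      rw [h2, hXpsi, tylerPsi_apply hC hC, ← quadFormCLM_apply,
        ← (quadFormCLM z).integral_comp_comm (integrable_quadForm_div_smul hC hC Δ R)]
      simp only [quadFormCLM_apply, quadForm_smul, quadForm_tylerScore]
    have h2 : ∫ y, q / quadForm C y * inner ℝ z y ^ 2 ∂(R : Measure (Vec q)) = quadForm C x := by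
      rw [integral_quadForm_tylerScore hCpd hC.2.1 h, hz, quadForm_toEuclideanLin hCp.1,
        Matrix.mul_nonsing_inv _ hu, one_mul]
    have h3 : ∫ y, (c * (q / quadForm C y * inner ℝ z y ^ 2)
        - quadForm Δ y / quadForm C y * (q / quadForm C y * inner ℝ z y ^ 2))
        ∂(R : Measure (Vec q)) = 0 := by
      rw [integral_sub (i0.const_mul c) i1, integral_const_mul, h1, h2, hx, sub_self]
    have h5 : ∀ y : Vec q, 0 ≤ c * (q / quadForm C y * inner ℝ z y ^ 2)
        - quadForm Δ y / quadForm C y * (q / quadForm C y * inner ℝ z y ^ 2) := fun y => by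
      rcases eq_or_ne y 0 with rfl | hy
      · simp
      have p := hCp.2 y hy
      rw [← sub_mul]
      exact mul_nonneg (sub_nonneg.2 ((div_le_iff₀ p).2 (hle y))) (by positivity)
    have h6 := (integral_eq_zero_iff_of_nonneg h5 ((i0.const_mul c).sub i1)).1 h3
    filter_upwards [h6, hR'] with y hy hy0
    have p := hCp.2 y hy0
    rw [Pi.zero_apply, ← sub_mul] at hy
    rcases mul_eq_zero.1 hy with h | h
    · right
      rw [sub_eq_zero, eq_div_iff p.ne'] at h
      exact h.symm
    · left
      exact pow_eq_zero_iff two_ne_zero |>.1 ((mul_eq_zero.1 h).resolve_left (by positivity))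
  have h1 : C * X = c • 1 := by
    have h2 : C * X * C * C⁻¹ = c • C * C⁻¹ := by rw [← hΔ, key]
    rwa [Matrix.mul_nonsing_inv_cancel_right _ _ hu, Matrix.smul_mul, Matrix.mul_nonsing_inv _ hu]
      at h2
  have h2 : c = 0 := by
    rw [h1, Matrix.trace_smul, Matrix.trace_one, Fintype.card_fin, smul_eq_mul] at htr
    exact (mul_eq_zero.1 htr).resolve_right hq0.ne'
  rw [h2, zero_smul] at h1
  rw [← Matrix.nonsing_inv_mul_cancel_left C X hu, h1, mul_zero]

end TylerLinearization

/-! ### The influence function of Tyler's functional. -/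

section TylerInfluence

variable {q : ℕ} {Q : ProbabilityMeasure (Vec q)}

open Classical in
/-- The function `tylerScore C - C⁻¹`, with value zero at zero. -/
noncomputable def centeredScore (C : Mat q) (y : Vec q) : Mat q :=
  if y = 0 then 0 else tylerScore C y - C⁻¹

lemma centeredScore_of_ne (C : Mat q) {y : Vec q} (hy : y ≠ 0) :
    centeredScore C y = tylerScore C y - C⁻¹ := if_neg hy

@[simp]
lemma centeredScore_zero (C : Mat q) : centeredScore C (0 : Vec q) = 0 := if_pos rfl

lemma measurable_centeredScore (C : Mat q) : Measurable (centeredScore C) :=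
  Measurable.ite (measurableSet_singleton 0) measurable_const
    ((measurable_tylerScore C).sub measurable_const)

lemma tylerScore_neg (C : Mat q) (y : Vec q) : tylerScore C (-y) = tylerScore C y := by
  have h1 : quadForm C (-y) = quadForm C y := by simp [quadForm, Matrix.mulVec_neg]
  rw [tylerScore, tylerScore, h1]
  congr 1
  ext k l
  simp

lemma centeredScore_neg (C : Mat q) (y : Vec q) : centeredScore C (-y) = centeredScore C y := by
  rcases eq_or_ne y 0 with rfl | hy
  · rw [neg_zero]
  · rw [centeredScore_of_ne C hy, centeredScore_of_ne C (neg_ne_zero.2 hy), tylerScore_neg]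

lemma isSymm_centeredScore {C : Mat q} (hC : C.PosDef) (y : Vec q) :
    (centeredScore C y).IsSymm := by
  rcases eq_or_ne y 0 with rfl | hy
  · rw [centeredScore_zero]
    exact Matrix.isSymm_zero
  · rw [centeredScore_of_ne C hy]
    exact (isSymm_tylerScore C y).sub (posDef_iff_quadForm.1 hC.inv).1

lemma continuousOn_centeredScore {C : Mat q} (hC : C.PosDef) :
    ContinuousOn (centeredScore C) {0}ᶜ :=
  ((continuousOn_tylerScore hC).sub continuousOn_const).congr fun _ hy => centeredScore_of_ne C hy

lemma norm_centeredScore_le {B : ℝ} {C : Mat q} (hC : C ∈ tylerBox q B) (y : Vec q) :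
    ‖centeredScore C y‖ ≤ q * Real.exp B + ‖C⁻¹‖ := by
  rcases eq_or_ne y 0 with rfl | hy
  · rw [centeredScore_zero, norm_zero]
    positivity
  · rw [centeredScore_of_ne C hy]
    exact (norm_sub_le _ _).trans (add_le_add_left (norm_tylerScore_le hC y) _)

lemma integrable_centeredScore {B : ℝ} {C : Mat q} (hC : C ∈ tylerBox q B)
    (R : ProbabilityMeasure (Vec q)) : Integrable (centeredScore C) (R : Measure (Vec q)) :=
  Integrable.of_bound (measurable_centeredScore C).aestronglyMeasurable _
    (ae_of_all _ (norm_centeredScore_le hC))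

lemma integral_centeredScore {B : ℝ} {C : Mat q} (hC : C ∈ tylerBox q B)
    {R : ProbabilityMeasure (Vec q)} (hR : (R : Measure (Vec q)) {0} = 0) :
    ∫ y, centeredScore C y ∂(R : Measure (Vec q))
      = ∫ y, tylerScore C y ∂(R : Measure (Vec q)) - C⁻¹ := by
  have hR' : ∀ᵐ y ∂(R : Measure (Vec q)), y ≠ 0 := by rw [ae_iff]; simpa using hR
  rw [integral_congr_ae (g := fun y => tylerScore C y - C⁻¹)
    (hR'.mono fun y hy => centeredScore_of_ne C hy),
    integral_sub (integrable_tylerScore (posDef_of_mem_tylerBox hC) hC.2.1 R)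
      (integrable_const _)]
  simp

lemma trace_mul_centeredScore {C : Mat q} (hC : C.PosDef) (y : Vec q) :
    (C * centeredScore C y).trace = 0 := by
  rcases eq_or_ne y 0 with rfl | hy
  · simp
  · have h0 := ((posDef_iff_quadForm.1 hC).2 y hy).ne'
    rw [centeredScore_of_ne C hy, mul_sub, Matrix.trace_sub, trace_mul_tylerScore, div_self h0,
      Matrix.mul_nonsing_inv _ hC.det_pos.ne'.isUnit, Matrix.trace_one, Fintype.card_fin]
    ring

/-- The derivative of the determinant at 1 is the trace, so the constraint det = 1 makes the trace
of the increment of smaller order. -/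
lemma isLittleO_trace_of_det_eq_one {α : Type*} {l : Filter α} {C : Mat q} {D : α → Mat q}
    (hD : Tendsto D l (𝓝 0)) (hdet : ∀ᶠ a in l, (1 + C * D a).det = 1) :
    (fun a => (C * D a).trace) =o[l] D := by
  have h1 : Tendsto (fun a => C * D a) l (𝓝 0) := by
    have := tendsto_matrix_mul (tendsto_const_nhds (x := C)) hD
    rwa [mul_zero] at this
  have h2 : Tendsto (fun a => 1 + C * D a) l (𝓝 1) := by
    have := h1.const_add (1 : Mat q)
    rwa [add_zero] at this
  have h3 := hasFDerivAt_det_one.isLittleO.comp_tendsto h2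
  have h4 : (fun a => C * D a) =O[l] D :=
    IsBigO.of_bound ‖C‖ (Eventually.of_forall fun a => Matrix.frobenius_norm_mul C (D a))
  refine (h3.congr' (f₂ := fun a => -(C * D a).trace) (g₂ := fun a => C * D a) ?_ ?_).trans_isBigO
    h4 |>.neg_left.congr_left fun a => neg_neg _
  · filter_upwards [hdet] with a ha
    simp only [Function.comp_apply]
    rw [ha, Matrix.det_one, add_sub_cancel_left, traceMulCLM_apply, one_mul, sub_self, zero_sub]
  · exact Eventually.of_forall fun a => by simp

/-- The remainder is a sum of three exact terms: the change of the integral operator with R, the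
change of the inverse matrix in its argument, and the trace term. Continuity makes the first two,
and the determinant constraint the third, of smaller order than the increment. -/
lemma tylerMatrix_sub_expansion (hq : 1 ≤ q) (hQ : Q ∈ tylerDomain q) :
    (fun R : ProbabilityMeasure (Vec q) =>
      tylerLinearization (tylerMatrix Q)⁻¹ Q (tylerMatrix R - tylerMatrix Q)
        - ∫ y, centeredScore (tylerMatrix Q)⁻¹ y ∂(R : Measure (Vec q)))
      =o[𝓝[tylerDomain q] Q] fun R => tylerMatrix R - tylerMatrix Q := by
  obtain ⟨B, -, hB⟩ := eventually_nhdsWithin_mem_tylerBox hq hQ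
  have hBQ := hB.self_of_nhdsWithin hQ
  obtain ⟨hQe, hQp, hQd⟩ := tylerMatrix_spec hq hQ
  have hQinv : ((tylerMatrix Q)⁻¹)⁻¹ = tylerMatrix Q :=
    Matrix.nonsing_inv_nonsing_inv _ (by rw [hQd]; exact isUnit_one)
  have hCt := tendsto_inv_tylerMatrix hq hQ
  have hVt := tendsto_tylerMatrix hq hQ
  have hdom : ∀ᶠ R : ProbabilityMeasure (Vec q) in 𝓝[tylerDomain q] Q, R ∈ tylerDomain q :=
    eventually_mem_nhdsWithin
  set V := tylerMatrix Q with hV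
  set C := V⁻¹ with hC
  set l := 𝓝[tylerDomain q] Q
  have hCV : C * V = 1 := Matrix.nonsing_inv_mul _ (by rw [hQd]; exact isUnit_one)
  have hDt : Tendsto (fun R => tylerMatrix R - V) l (𝓝 0) := by
    have := hVt.sub_const V
    rwa [sub_self] at this
  have hO : (fun R => (tylerMatrix R)⁻¹ * (tylerMatrix R - V) * C) =O[l]
      fun R => tylerMatrix R - V := by
    have h1 : (fun R => (tylerMatrix R)⁻¹) =O[l] fun _ => (1 : ℝ) := hCt.isBigO_one ℝ
    have h2 : (fun R => (tylerMatrix R)⁻¹ * (tylerMatrix R - V) * C) =O[l]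
        fun R => ‖(tylerMatrix R)⁻¹‖ * ‖tylerMatrix R - V‖ :=
      IsBigO.of_bound ‖C‖ (Eventually.of_forall fun R => by
        rw [Real.norm_of_nonneg (by positivity), mul_comm ‖C‖]
        exact (Matrix.frobenius_norm_mul _ _).trans (mul_le_mul_of_nonneg_right
          (Matrix.frobenius_norm_mul _ _) (norm_nonneg _)))
    refine (h2.trans (h1.norm_left.mul (isBigO_refl (fun R => ‖tylerMatrix R - V‖) l))).trans ?_
    simp only [one_mul]
    exact (isBigO_refl _ l).norm_left
  have e1 : (fun R => (tylerPsi C (tylerMatrix R)⁻¹ R - tylerPsi C C Q)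
      ((tylerMatrix R)⁻¹ * (tylerMatrix R - V) * C)) =o[l] fun R => tylerMatrix R - V := by
    have ht : Tendsto (fun R => tylerPsi C (tylerMatrix R)⁻¹ R - tylerPsi C C Q) l (𝓝 0) := by
      have := (tendsto_tylerPsi hQ.1 (R := fun R => R) (tendsto_id'.2 nhdsWithin_le_nhds)
        hBQ hB hCt).sub_const (tylerPsi C C Q)
      rwa [sub_self] at this
    have h1 := ((isLittleO_one_iff ℝ).2 ht).norm_left.mul_isBigO hO.norm_left.norm_right
    simp only [one_mul] at h1
    refine (IsBigO.of_bound 1 (Eventually.of_forall fun R => ?_)).trans_isLittleO h1.of_norm_right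
    rw [one_mul, Real.norm_of_nonneg (by positivity)]
    exact ContinuousLinearMap.le_opNorm _ _
  have e2 : (fun R => tylerPsi C C Q (((tylerMatrix R)⁻¹ - C) * (tylerMatrix R - V) * C)) =o[l]
      fun R => tylerMatrix R - V := by
    have ht : Tendsto (fun R => (tylerMatrix R)⁻¹ - C) l (𝓝 0) := by
      have := hCt.sub_const C
      rwa [sub_self] at this
    have h1 := ((isLittleO_one_iff ℝ).2 ht).norm_left.mul_isBigO
      (isBigO_refl (fun R => ‖tylerMatrix R - V‖) l)
    simp only [one_mul] at h1
    refine (((tylerPsi C C Q).isBigO_comp _ l).trans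
      (IsBigO.of_bound ‖C‖ (Eventually.of_forall fun R => ?_))).trans_isLittleO h1.of_norm_right
    rw [Real.norm_of_nonneg (by positivity), mul_comm ‖C‖]
    exact (Matrix.frobenius_norm_mul _ _).trans (mul_le_mul_of_nonneg_right
      (Matrix.frobenius_norm_mul _ _) (norm_nonneg _))
  have e3 : (fun R => (C * (tylerMatrix R - V)).trace • V) =o[l] fun R => tylerMatrix R - V := by
    have h1 : (fun R => (C * (tylerMatrix R - V)).trace) =o[l] fun R => tylerMatrix R - V := by
      refine isLittleO_trace_of_det_eq_one hDt ?_
      filter_upwards [hdom] with R hR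
      rw [mul_sub, hCV, add_sub_cancel, Matrix.det_mul, hC, Matrix.det_nonsing_inv, hQd,
        (tylerMatrix_spec hq hR).2.2]
      simp
    refine (IsBigO.of_bound ‖V‖ (Eventually.of_forall fun R => ?_)).trans_isLittleO h1
    rw [norm_smul, mul_comm]
  refine ((e1.add e2).add e3).congr' ?_ EventuallyEq.rfl
  filter_upwards [hdom, hB] with R hR hRB
  obtain ⟨hRe, hRp, hRd⟩ := tylerMatrix_spec hq hR
  have hRu : IsUnit (tylerMatrix R).det := by rw [hRd]; exact isUnit_one
  -- Resolvent identity for the difference of inverses, which turns `tylerScore_sub` into a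
  -- statement about the increment of the matrix.
  have hdiff : (tylerMatrix R)⁻¹ * (tylerMatrix R - V) * C = C - (tylerMatrix R)⁻¹ := by
    rw [mul_sub, Matrix.nonsing_inv_mul _ hRu, sub_mul, one_mul, mul_assoc, hC,
      Matrix.mul_nonsing_inv _ (by rw [hQd]; exact isUnit_one), mul_one]
  have h1 : tylerPsi C (tylerMatrix R)⁻¹ R ((tylerMatrix R)⁻¹ * (tylerMatrix R - V) * C)
      = tylerMatrix R - ∫ y, tylerScore C y ∂(R : Measure (Vec q)) := by
    rw [hdiff, tylerPsi_apply hBQ hRB]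
    conv_rhs => rw [← hRe]
    rw [← integral_sub (integrable_tylerScore (posDef_of_mem_tylerBox hRB) hRB.2.1 R)
      (integrable_tylerScore (posDef_of_mem_tylerBox hBQ) hBQ.2.1 R)]
    congr 1
    funext y
    exact (tylerScore_sub (posDef_of_mem_tylerBox hBQ) (posDef_of_mem_tylerBox hRB) y).symm
  rw [integral_centeredScore hBQ hR.1, hQinv, tylerLinearization_apply, hQinv,
    sub_apply, h1, sub_mul, sub_mul, map_sub]
  abel

/-- Tyler's functional has a normalized influence function. -/
theorem exists_isInfluenceFunction_tyler (hq : 1 ≤ q) (hQ : Q ∈ tylerDomain q) :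
    ∃ J : Vec q → Mat q, (tyler q).IsInfluenceFunction Q J ∧ IsTylerNormalized Q J := by
  obtain ⟨B, -, hB⟩ := eventually_nhdsWithin_mem_tylerBox hq hQ
  have hBQ := hB.self_of_nhdsWithin hQ
  obtain ⟨hQe, hQp, hQd⟩ := tylerMatrix_spec hq hQ
  have hQinv : ((tylerMatrix Q)⁻¹)⁻¹ = tylerMatrix Q :=
    Matrix.nonsing_inv_nonsing_inv _ (by rw [hQd]; exact isUnit_one)
  have hexp := tylerMatrix_sub_expansion hq hQ
  set C := (tylerMatrix Q)⁻¹ with hC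
  have hCpd := posDef_of_mem_tylerBox hBQ
  have hCe : ∫ y, tylerScore C y ∂(Q : Measure (Vec q)) = C⁻¹ := by rw [hQinv, hQe]
  set G := tylerLinearization C Q with hG
  have hinj : Function.Injective (G : Mat q →ₗ[ℝ] Mat q) :=
    tylerLinearization_injective hq hQ hBQ hCe
  -- An injective endomorphism in finite dimension is invertible; the influence function is its
  -- inverse applied to the centered score.
  let T : Mat q →L[ℝ] Mat q := LinearMap.toContinuousLinearMap
    (LinearEquiv.ofInjectiveEndo (G : Mat q →ₗ[ℝ] Mat q) hinj).symm.toLinearMap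
  have hGT : ∀ X, G (T X) = X := fun X =>
    (LinearEquiv.ofInjectiveEndo (G : Mat q →ₗ[ℝ] Mat q) hinj).apply_symm_apply X
  have hTG : ∀ X, T (G X) = X := fun X =>
    (LinearEquiv.ofInjectiveEndo (G : Mat q →ₗ[ℝ] Mat q) hinj).symm_apply_apply X
  have hint : ∀ R : ProbabilityMeasure (Vec q), ∫ y, T (centeredScore C y) ∂(R : Measure (Vec q))
      = T (∫ y, centeredScore C y ∂(R : Measure (Vec q))) := fun R =>
    T.integral_comp_comm (integrable_centeredScore hBQ R)
  refine ⟨fun y => T (centeredScore C y), ⟨?_, ?_, ?_, ?_, ?_, ?_⟩, ?_, ?_, ?_⟩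
  · exact T.continuous.measurable.comp (measurable_centeredScore C)
  · exact ⟨‖T‖ * (q * Real.exp B + ‖C⁻¹‖), fun y => (T.le_opNorm _).trans
      (mul_le_mul_of_nonneg_left (norm_centeredScore_le hBQ y) (norm_nonneg _))⟩
  · intro y
    simp only [centeredScore_neg]
  · intro y
    refine isSymm_of_isSymm_tylerLinearization hBQ (R := Q) ?_
    rw [← hG, hGT]
    exact isSymm_centeredScore hCpd y
  · rw [hint, integral_centeredScore hBQ hQ.1, hCe, sub_self, map_zero]
  · have h1 : (fun R : ProbabilityMeasure (Vec q) => tylerMatrix R - tylerMatrix Q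
        - ∫ y, T (centeredScore C y) ∂(R : Measure (Vec q))) =o[𝓝[tylerDomain q] Q]
        fun R => tylerMatrix R - tylerMatrix Q := by
      refine ((T.isBigO_comp _ _).trans_isLittleO hexp).congr_left fun R => ?_
      rw [map_sub, hTG, hint]
    -- The remainder is so far small relative to the increment. Therefore the increment is O(∫ J
    -- dR), which gives the required form.
    refine h1.trans_isBigO (h1.right_isBigO_sub.congr_right fun R => ?_)
    abel
  · simp
  · exact T.continuous.comp_continuousOn (continuousOn_centeredScore hCpd)
  · intro y _
    have h1 := trace_mul_tylerLinearization hBQ hCe (T (centeredScore C y))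
    rw [← hG, hGT, trace_mul_centeredScore hCpd] at h1
    exact (mul_eq_zero.1 h1.symm).resolve_left (by positivity)

end TylerInfluence

/-! ### Assembly of the two cases. -/

theorem mainTheorem1 {q : ℕ} (hq : 1 ≤ q)
    -- the functional of scatter
    (S : ScatterFunctional q)
    (hS : (S.IsLinearEquivariant ∧ S.IsDifferentiable) ∨ S = tyler q)
    -- the data
    {Ω : Type*} [MeasurableSpace Ω] (μ : Measure Ω) [IsProbabilityMeasure μ]
    (P : ProbabilityMeasure (Vec q)) (X : ℕ → Ω → Vec q)
    (hX : ∀ i, HasLaw (X i) (P : Measure (Vec q)) μ) (hind : iIndepFun X μ)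
    (hQ : symmetrized P ∈ S.domain) :
    -- there is an influence function at `Q(P)`
    (∃ J : Vec q → Mat q, S.IsInfluenceFunction (symmetrized P) J ∧
      (S = tyler q → IsTylerNormalized (symmetrized P) J)) ∧
    -- and for any such function the following holds
    ∀ J : Vec q → Mat q, S.IsInfluenceFunction (symmetrized P) J →
      (S = tyler q → IsTylerNormalized (symmetrized P) J) →
    ∀ {Ω' : Type*} [MeasurableSpace Ω'] (μ' : Measure Ω') [IsProbabilityMeasure μ']
      (G₁ G₂ : Ω' → Mat q),
      IndepFun G₁ G₂ μ' →
      IsCenteredGaussian μ' G₁ (fun A => ∫ ω, (frob A (H₁ P J (X 0 ω))) ^ 2 ∂μ) →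
      IsCenteredGaussian μ' G₂ (fun A => ∫ ω, (frob A (H₂ P J (X 0 ω) (X 1 ω))) ^ 2 ∂μ) →
    -- the complete estimator
    (Tendsto (fun n => μ {ω | S.IsDefinedAt (empiricalDiff n (X · ω))}) atTop (𝓝 1) ∧
      IsLittleOpInvSqrt μ (fun n ω =>
        S.eval (empiricalDiff n (X · ω)) - (S.toFun (symmetrized P)
          + (2 : ℝ) • ∫ x, H₁ P J x ∂(empirical n (X · ω)))) ∧
      TendstoInDistribution (fun (n : ℕ) ω =>
          √(n : ℝ) • (S.eval (empiricalDiff n (X · ω)) - S.toFun (symmetrized P)))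
        atTop (fun ω' => (2 : ℝ) • G₁ ω') (fun _ => μ) μ') ∧
    -- the incomplete estimator with `(n - 1) / 2 ≥ d(n) → ∞`
    (∀ d : ℕ → ℕ, (∀ᶠ n in atTop, (d n : ℝ) ≤ ((n : ℝ) - 1) / 2) → Tendsto d atTop atTop →
      Tendsto (fun n => μ {ω | S.IsDefinedAt (empiricalDiffInc n (d n) (X · ω))})
        atTop (𝓝 1) ∧
      IsLittleOpInvSqrt μ (fun n ω =>
        S.eval (empiricalDiffInc n (d n) (X · ω)) - (S.toFun (symmetrized P)
          + (2 : ℝ) • ∫ x, H₁ P J x ∂(empirical n (X · ω)))) ∧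
      TendstoInDistribution (fun (n : ℕ) ω =>
          √(n : ℝ) • (S.eval (empiricalDiffInc n (d n) (X · ω)) - S.toFun (symmetrized P)))
        atTop (fun ω' => (2 : ℝ) • G₁ ω') (fun _ => μ) μ') ∧
    -- the incomplete estimator with fixed `d ≥ 1`
    (∀ d : ℕ, 1 ≤ d →
      Tendsto (fun n => μ {ω | S.IsDefinedAt (empiricalDiffInc n d (X · ω))}) atTop (𝓝 1) ∧
      IsLittleOpInvSqrt μ (fun n ω =>
        S.eval (empiricalDiffInc n d (X · ω))
          - (S.eval (empiricalDiff n (X · ω)) + M P J n d (X · ω))) ∧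
      TendstoInDistribution (fun (n : ℕ) ω =>
          (√(n : ℝ) • ∫ x, H₁ P J x ∂(empirical n (X · ω)),
            √((n * d : ℕ) : ℝ) • M P J n d (X · ω)))
        atTop (fun ω' => (G₁ ω', G₂ ω')) (fun _ => μ) μ' ∧
      TendstoInDistribution (fun (n : ℕ) ω =>
          √(n : ℝ) • (S.eval (empiricalDiffInc n d (X · ω)) - S.toFun (symmetrized P)))
        atTop (fun ω' => (2 : ℝ) • G₁ ω' + (√(d : ℝ))⁻¹ • G₂ ω') (fun _ => μ) μ') := by
  have key : IsGδ S.domain ∧ (∀ Q ∈ S.domain, ∃ J : Vec q → Mat q, S.IsInfluenceFunction Q J ∧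
      (S = tyler q → IsTylerNormalized Q J)) ∧
      ∀ᶠ R : ProbabilityMeasure (Vec q) in 𝓝 (symmetrized P),
        ((symmetrized P : Measure (Vec q)) {0} = 0 → (R : Measure (Vec q)) {0} = 0) →
          R ∈ S.domain := by
    -- The split is on this equality rather than on the disjunction because the normalization of J
    -- is demanded exactly when it holds.
    by_cases h : S = tyler q
    · subst h
      refine ⟨isGδ_tylerDomain hq, fun Q hQ => ?_, ?_⟩
      · obtain ⟨J, hJ, hJn⟩ := exists_isInfluenceFunction_tyler hq hQ
        exact ⟨J, hJ, fun _ => hJn⟩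
      · obtain ⟨B, -, hB⟩ := eventually_mem_tylerDomain_and_mem_tylerBox hq hQ
        exact hB.mono fun R hR h0 => (hR (h0 hQ.1)).1
    · obtain ⟨hopen, hinf⟩ := (hS.resolve_right h).2
      refine ⟨hopen.isGδ, fun Q hQ => ?_, ?_⟩
      · obtain ⟨J, hJ⟩ := hinf Q hQ
        exact ⟨J, hJ, fun h' => absurd h' h⟩
      · filter_upwards [hopen.mem_nhds hQ] with R hR _ using hR
  obtain ⟨hGδ, hinf, hdom⟩ := key
  refine ⟨hinf _ hQ, fun J hJ _ Ω' _ μ' _ G₁ G₂ hG hG₁ hG₂ => ?_⟩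
  exact asymptotics_of_isInfluenceFunction hGδ
    (fun Q hQ => (hinf Q hQ).imp fun _ h => h.1) hX hind hdom hJ hG hG₁ hG₂
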